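/- A Coxeter simplex in $\mathbb E^n$ ($n\ge 1$) is an $n$-dimensional simplex all of whose dihedral angles have the form $\pi/m$ with an integer $m\ge 2$ (for $n=1$ the two facets are parallel, $m=\infty$). For a Coxeter simplex $T$, let $\Sigma(T)$ be its Coxeter diagram and $G_T$ the group generated by the reflections in the facets of $T$. The images $g(T)$, $g\in G_T$, are called the fundamental simplices of $G_T$. The diagrams $\widetilde C_2$, $\widetilde G_2$, $\widetilde F_4$ are the paths whose consecutive edges have labels $(4,4)$, $(3,6)$, $(3,4,3,3)$, respectively. Let $F$ and $P$ be Coxeter simplices in $\mathbb E^n$ with $\Sigma(P)=\Sigma(F)$ and $G_P\subset G_F$. Then: 0) The index is finite and $[G_F:G_P]=m\,k^n$ for some integer $k\ge 1$, where $m=1$, or $\Sigma(F)=\widetilde C_2$ and $m=2$, or $\Sigma(F)=\widetilde G_2$ and $m=3$, or $\Sigma(F)=\widetilde F_4$ and $m=4$. 1) The index $[G_F:G_P]$ determines the subgroup $G_P\subset G_F$ uniquely up to an automorphism of $G_F$: if $Q$ is another Coxeter simplex with $\Sigma(Q)=\Sigma(F)$, $G_Q\subset G_F$ and $[G_F:G_Q]=[G_F:G_P]$,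 then some automorphism of $G_F$, induced by conjugation with an isometry of $\mathbb E^n$, takes $G_P$ to $G_Q$. 2) Suppose that $G_P\subset G_F$ is maximal, i.e. there is no Coxeter simplex $T$ in $\mathbb E^n$ with $G_P\subsetneq G_T\subsetneq G_F$. Then either $P$ is the image of a fundamental simplex of $G_F$ under a homothety whose dilation factor is a positive integer, or $G_P$ is one of the following three subgroups. Here $f_1,f_2,\dots$ are the facets of a suitable fundamental simplex of $G_F$, numbered along the path $\Sigma(F)$ with the labels in the above order, $r_i$ is the reflection in $f_i$, and a list gives the hyperplanes of the facets of $P$ in the order of the nodes along the path $\Sigma(P)$: - $\Sigma(F)=\Sigma(P)=\widetilde C_2$, facets of $P$: $f_2,\ f_3,\ r_1(f_2)$; index $2$; - $\Sigma(F)=\Sigma(P)=\widetilde G_2$, facets of $P$: $r_1r_2(f_3),\ f_3,\ f_2$; index $3$; - $\Sigma(F)=\Sigma(P)=\widetilde F_4$, facets of $P$: $f_4,\ f_3,\ f_2,\ f_1,\ r_5r_4r_3(f_2)$; index $4$. -/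

import Mathlib

open scoped Real

namespace CoxeterSimplex

variable {V : Type*} [NormedAddCommGroup V] [InnerProductSpace ℝ V]

/-- The hyperplane (inside the span of the simplex) carrying the facet of `T` opposite to the
`i`-th vertex.  Facets of a simplex are labelled by their opposite vertices. -/
def facet {n : ℕ} [NeZero n] (T : Affine.Simplex ℝ V n) (i : Fin (n + 1)) :
    AffineSubspace ℝ V :=
  affineSpan ℝ (Set.range (T.faceOpposite i).points)

/-- The orthogonal reflection in the `i`-th facet of `T`. -/
noncomputable def facetReflection {n : ℕ} [NeZero n] (T : Affine.Simplex ℝ V n)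
    (i : Fin (n + 1)) : V ≃ᵃⁱ[ℝ] V :=
  EuclideanGeometry.reflection (affineSpan ℝ (Set.range (T.faceOpposite i).points))

/-- The group `G_T` generated by the reflections in the facets of `T`. -/
noncomputable def reflGroup {n : ℕ} [NeZero n] (T : Affine.Simplex ℝ V n) :
    Subgroup (V ≃ᵃⁱ[ℝ] V) :=
  Subgroup.closure (Set.range (facetReflection T))

/-- The dihedral angle formed by the `i`-th and `j`-th facets of `T`.  The vector from the foot
of the altitude at a vertex to that vertex is an inward normal of the opposite facet, and the
dihedral angle is `π` minus the angle between the inward normals.  It is `0` if `i ≠ j` and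
the facets are parallel (end points of a segment), and it is `π` if `i = j`. -/
noncomputable def dihedralAngle {n : ℕ} [NeZero n] (T : Affine.Simplex ℝ V n)
    (i j : Fin (n + 1)) : ℝ :=
  π - InnerProductGeometry.angle (T.points i - T.altitudeFoot i) (T.points j - T.altitudeFoot j)

/-- `T` is a Coxeter simplex whose Coxeter diagram is given by the Coxeter matrix `M`, the facets
of `T` being matched with the nodes of the diagram by the bijection `σ`: the facets with nodes
`σ i` and `σ j` form the angle `π / M (σ i) (σ j)`.  The entry `0` of a Coxeter matrix stands
for `∞`; it gives the angle `0`, that is, parallel facets (a bold edge). -/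
def MatchesDiagram {n : ℕ} [NeZero n] (T : Affine.Simplex ℝ V n) {B : Type}
    (M : CoxeterMatrix B) (σ : Fin (n + 1) ≃ B) : Prop :=
  ∀ i j, dihedralAngle T i j = π / (M (σ i) (σ j) : ℝ)

/-- `T` is a Coxeter simplex with Coxeter diagram `M`, up to a relabelling of the nodes. -/
def HasDiagram {n : ℕ} [NeZero n] (T : Affine.Simplex ℝ V n) {B : Type}
    (M : CoxeterMatrix B) : Prop :=
  ∃ σ : Fin (n + 1) ≃ B, MatchesDiagram T M σ

/-- `T` is a Coxeter simplex: all dihedral angles are of the form `π / m`, with integers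
`m ≥ 2` (or `m = ∞` for parallel facets). -/
def IsCoxeter {n : ℕ} [NeZero n] (T : Affine.Simplex ℝ V n) : Prop :=
  ∃ M : CoxeterMatrix (Fin (n + 1)), HasDiagram T M

/-- `P` and `F` are Coxeter simplices with the same Coxeter diagram. -/
def SameDiagram {n : ℕ} [NeZero n] (P F : Affine.Simplex ℝ V n) : Prop :=
  ∃ M : CoxeterMatrix (Fin (n + 1)), HasDiagram P M ∧ HasDiagram F M

/-- `C` is, up to a relabelling of its vertices, a fundamental simplex of `G_F`, i.e. an image
`g(F)` with `g ∈ G_F`. -/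
def IsChamber {m n : ℕ} [NeZero n] (C : Affine.Simplex ℝ V m) (F : Affine.Simplex ℝ V n) :
    Prop :=
  ∃ g ∈ reflGroup F, Set.range C.points = g '' Set.range F.points

/-- The diagram `C̃₂`: a path with marks `4, 4`. -/
def affineC₂ : CoxeterMatrix (Fin 3) where
  M := !![1, 4, 2;
          4, 1, 4;
          2, 4, 1]
  off_diagonal := by simp; decide

/-- The diagram `G̃₂`: a path with marks `3, 6`. -/
def affineG₂ : CoxeterMatrix (Fin 3) where
  M := !![1, 3, 2;
          3, 1, 6;
          2, 6, 1]
  off_diagonal := by simp; decide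

/-- The diagram `F̃₄`: a path with marks `3, 4, 3, 3`. -/
def affineF₄ : CoxeterMatrix (Fin 5) where
  M := !![1, 3, 2, 2, 2;
          3, 1, 4, 2, 2;
          2, 4, 1, 3, 2;
          2, 2, 3, 1, 3;
          2, 2, 2, 3, 1]
  off_diagonal := by simp; decide

/-- `P` is obtained by a homothety, with a positive integer dilation factor, from a fundamental
simplex of `G_F`. -/
def IsHomothetic {n : ℕ} [NeZero n] (P F : Affine.Simplex ℝ V n) : Prop :=
  ∃ C : Affine.Simplex ℝ V n, IsChamber C F ∧
    ∃ (c : V) (k : ℕ), 0 < k ∧ ∀ i, P.points i = AffineMap.homothety c (k : ℝ) (C.points i)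

/-- The exceptional subgroup of type `C̃₂`.  With the facets `f₀, f₁, f₂` of a fundamental
simplex `C` of `G_F` ordered along the diagram and `rᵢ` the reflection in `fᵢ`, the facets of
`P` are, in the order along the diagram, `f₁, f₂, r₀(f₁)`.  The index is `2`. -/
def IsExceptionalC₂ {n : ℕ} [NeZero n] (P F : Affine.Simplex ℝ V n) : Prop :=
  ∃ C D : Affine.Simplex ℝ V 2,
    IsChamber C F ∧ Set.range D.points = Set.range P.points ∧
    MatchesDiagram C affineC₂ (Equiv.refl _) ∧ MatchesDiagram D affineC₂ (Equiv.refl _) ∧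
    facet D 0 = facet C 1 ∧
    facet D 1 = facet C 2 ∧
    facet D 2 = (facet C 1).map (facetReflection C 0).toAffineMap ∧
    (reflGroup P).relIndex (reflGroup F) = 2

/-- The exceptional subgroup of type `G̃₂`: the facets of `P` are, in the order along the
diagram, `r₀ r₁(f₂), f₂, f₁`.  The index is `3`. -/
def IsExceptionalG₂ {n : ℕ} [NeZero n] (P F : Affine.Simplex ℝ V n) : Prop :=
  ∃ C D : Affine.Simplex ℝ V 2,
    IsChamber C F ∧ Set.range D.points = Set.range P.points ∧
    MatchesDiagram C affineG₂ (Equiv.refl _) ∧ MatchesDiagram D affineG₂ (Equiv.refl _) ∧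
    facet D 0 = (facet C 2).map (facetReflection C 0 * facetReflection C 1).toAffineMap ∧
    facet D 1 = facet C 2 ∧
    facet D 2 = facet C 1 ∧
    (reflGroup P).relIndex (reflGroup F) = 3

/-- The exceptional subgroup of type `F̃₄`: the facets of `P` are, in the order along the
diagram, `f₃, f₂, f₁, f₀, r₄ r₃ r₂(f₁)`.  The index is `4`. -/
def IsExceptionalF₄ {n : ℕ} [NeZero n] (P F : Affine.Simplex ℝ V n) : Prop :=
  ∃ C D : Affine.Simplex ℝ V 4,
    IsChamber C F ∧ Set.range D.points = Set.range P.points ∧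
    MatchesDiagram C affineF₄ (Equiv.refl _) ∧ MatchesDiagram D affineF₄ (Equiv.refl _) ∧
    facet D 0 = facet C 3 ∧
    facet D 1 = facet C 2 ∧
    facet D 2 = facet C 1 ∧
    facet D 3 = facet C 0 ∧
    facet D 4 = (facet C 1).map
      (facetReflection C 4 * facetReflection C 3 * facetReflection C 2).toAffineMap ∧
    (reflGroup P).relIndex (reflGroup F) = 4

/-- Maximality of `G_P ⊂ G_F`: no Coxeter simplex `T` has `G_T` strictly between `G_P` and
`G_F`. -/
def IsMaximalIn {n : ℕ} [NeZero n] (P F : Affine.Simplex ℝ V n) : Prop :=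
  reflGroup P ≤ reflGroup F ∧
    ¬ ∃ T : Affine.Simplex ℝ V n, IsCoxeter T ∧
      reflGroup P < reflGroup T ∧ reflGroup T < reflGroup F

end CoxeterSimplex

/-! ### Affine functions as pairs (gradient, constant), their reflections, and the action of
isometries. -/

namespace CoxeterSimplex

variable {V : Type*} [NormedAddCommGroup V] [InnerProductSpace ℝ V]

open scoped RealInnerProductSpace
open Module

set_option linter.unusedSectionVars false

/-! Each facet is encoded by the affine function with unit gradient that vanishes on it and is
positive inside the simplex. Tits' lemma (`nonneg_of_len_le`) makes the closed simplex a strict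
fundamental domain of its reflection group (`eq_and_mem_gpAt`), so no mirror cuts a fundamental
simplex and the group is discrete. Hence only finitely many directions of mirrors occur
(`finite_normals`), and a simple system for them yields a special point, one that lies on a mirror
of every direction. Inside the closed simplex such points are vertices (`eq_vertex_of_isSpecial`).

Since P and F have the same diagram they are similar, so G_P and G_F have equally many normals. The
inclusion of groups then forces the same normals (`normals_eq`), and a special vertex v of P is
special for G_F. Near v both groups have the same stabilizer, so some fundamental simplex C of G_F
has the same cone at v as P (`exists_isAligned`). The two simplices differ only in the facet
opposite v.

The outer normal of that facet lies in the closed chamber of the finite group at v, so it is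
determined by its orbit under this group. There are at most two orbits of normals, because the
diagram at v has at most one edge with label at least 4 (`heavy_unique`). The diagram isomorphism,
normalized to fix the node of the last facet, either respects the orbits, and the last facets are
parallel, or it reverses the heavy edge (`eq_or_swap`). Explicit vectors of nonpositive norm in the
Gram form leave only C̃₂, G̃₂ and F̃₄ for a reversal with a new direction (`classification`).

Mirrors of the relevant direction are equally spaced from v (`exists_eq_nat_mul`), so the height of
P is kμ times that of C, with μ equal to 1, √2, √3 or √2. Comparing covolumes of the translation
lattices, the index is the n-th power of this ratio (`relIndex_eq_pow`), which gives m = μⁿ. The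
irrationality of √2 and √3 lets the index determine P once v and the cone are fixed. Translations
between special points normalize G_F, which gives uniqueness up to an isometry. In the exceptional
cases, contracting P towards v by 1/k yields an intermediate group different from G_F, so maximality
forces k = 1 (`IsAligned.eq_one_of_isMaximalIn`). -/

/-- The affine function with gradient `a.1` and constant term `a.2`. -/
noncomputable def ev (a : V × ℝ) (x : V) : ℝ := ⟪a.1, x⟫ + a.2

theorem ev_add (a b : V × ℝ) (x : V) : ev (a + b) x = ev a x + ev b x := by
  simp [ev, inner_add_left]; ring

theorem ev_sub (a b : V × ℝ) (x : V) : ev (a - b) x = ev a x - ev b x := by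
  simp [ev, inner_sub_left]; ring

theorem ev_smul (r : ℝ) (a : V × ℝ) (x : V) : ev (r • a) x = r * ev a x := by
  simp [ev, real_inner_smul_left]; ring

theorem ev_neg (a : V × ℝ) (x : V) : ev (-a) x = -ev a x := by
  simp [ev]; ring

theorem ev_zero (x : V) : ev (0 : V × ℝ) x = 0 := by simp [ev]

theorem ev_sum {ι : Type*} (s : Finset ι) (f : ι → V × ℝ) (x : V) :
    ev (∑ i ∈ s, f i) x = ∑ i ∈ s, ev (f i) x := by
  classical
  induction s using Finset.induction_on with
  | empty => simp [ev_zero]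
  | insert a s ha ih => rw [Finset.sum_insert ha, Finset.sum_insert ha, ev_add, ih]

theorem ev_add_vec (a : V × ℝ) (x y : V) : ev a (x + y) = ev a x + ⟪a.1, y⟫ := by
  simp [ev, inner_add_right]; ring

theorem ev_sub_ev (a : V × ℝ) (x y : V) : ev a x - ev a y = ⟪a.1, x - y⟫ := by
  simp [ev, inner_sub_right]

theorem ev_injective {a b : V × ℝ} (h : ∀ x, ev a x = ev b x) : a = b := by
  have h0 : a.2 = b.2 := by simpa [ev] using h 0
  refine Prod.ext ?_ h0
  refine ext_inner_right ℝ fun x => ?_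
  have := h x
  simp only [ev, h0] at this
  linarith

theorem ev_abs_sub_le (a : V × ℝ) (ha : ‖a.1‖ = 1) (x y : V) : |ev a x - ev a y| ≤ ‖x - y‖ := by
  rw [ev_sub_ev]
  simpa [ha] using abs_real_inner_le_norm a.1 (x - y)

/-- The function with gradient `u` vanishing at `v`. -/
noncomputable def rt (u v : V) : V × ℝ := (u, -⟪u, v⟫)

@[simp] theorem rt_fst (u v : V) : (rt u v).1 = u := rfl

theorem ev_rt (u v x : V) : ev (rt u v) x = ⟪u, x - v⟫ := by
  simp [ev, rt, inner_sub_right]; ring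

theorem eq_rt {a : V × ℝ} {v : V} (h : ev a v = 0) : a = rt a.1 v := by
  refine Prod.ext rfl ?_
  simp [ev, rt] at *
  linarith

/-- The translation by `t`. -/
noncomputable def trans (t : V) : V ≃ᵃⁱ[ℝ] V := AffineIsometryEquiv.constVAdd ℝ V t

@[simp] theorem trans_apply (t x : V) : trans t x = t + x := rfl

theorem trans_add (s t : V) : trans (s + t) = trans s * trans t := by
  ext x; simp [add_assoc]

theorem trans_zero : trans (0 : V) = 1 := by
  ext x; simp

theorem trans_neg (t : V) : trans (-t) = (trans t)⁻¹ := by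
  rw [eq_inv_iff_mul_eq_one, ← trans_add, neg_add_cancel, trans_zero]

theorem trans_injective : Function.Injective (trans : V → _) := by
  intro s t h
  simpa using congrArg (fun f => f 0) h

/-- The orthogonal reflection in the zero set of `a`, for a unit gradient. -/
noncomputable def refl (a : V × ℝ) : V ≃ᵃⁱ[ℝ] V :=
  trans (-(2 * a.2) • a.1) * (Submodule.reflection (ℝ ∙ a.1)ᗮ).toAffineIsometryEquiv

theorem linear_refl_apply (u x : V) (hu : ‖u‖ = 1) :
    Submodule.reflection (ℝ ∙ u)ᗮ x = x - (2 * ⟪u, x⟫) • u := by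
  rw [Submodule.reflection_orthogonal_apply, Submodule.reflection_singleton_apply]
  simp [hu, two_smul, two_mul, add_smul]

theorem refl_apply {a : V × ℝ} (ha : ‖a.1‖ = 1) (x : V) :
    refl a x = x - (2 * ev a x) • a.1 := by
  simp only [refl, AffineIsometryEquiv.coe_mul, Function.comp_apply,
    LinearIsometryEquiv.coe_toAffineIsometryEquiv, trans_apply, linear_refl_apply _ _ ha, ev]
  module

theorem ev_refl {a : V × ℝ} (ha : ‖a.1‖ = 1) (b : V × ℝ) (x : V) :
    ev b (refl a x) = ev b x - 2 * ⟪a.1, b.1⟫ * ev a x := by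
  rw [refl_apply ha, sub_eq_add_neg, ev_add_vec, inner_neg_right, real_inner_smul_right,
    real_inner_comm a.1 b.1]
  ring

theorem ev_refl_self {a : V × ℝ} (ha : ‖a.1‖ = 1) (x : V) : ev a (refl a x) = -ev a x := by
  rw [ev_refl ha, real_inner_self_eq_norm_sq, ha]; ring

theorem refl_mul_self {a : V × ℝ} (ha : ‖a.1‖ = 1) : refl a * refl a = 1 := by
  ext x
  simp only [AffineIsometryEquiv.coe_mul, Function.comp_apply, AffineIsometryEquiv.coe_one, id]
  rw [refl_apply ha (refl a x), ev_refl_self ha, refl_apply ha]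
  module

theorem refl_inv {a : V × ℝ} (ha : ‖a.1‖ = 1) : (refl a)⁻¹ = refl a :=
  inv_eq_of_mul_eq_one_left (refl_mul_self ha)

theorem refl_neg {a : V × ℝ} (ha : ‖a.1‖ = 1) : refl (-a) = refl a := by
  ext x
  rw [refl_apply ha, refl_apply (by simpa using ha), ev_neg]
  simp

theorem refl_eq_self_iff {a : V × ℝ} (ha : ‖a.1‖ = 1) (x : V) : refl a x = x ↔ ev a x = 0 := by
  have : a.1 ≠ 0 := fun h => by simp [h] at ha
  rw [refl_apply ha]
  simp [this]

theorem refl_ne_one {a : V × ℝ} (ha : ‖a.1‖ = 1) : refl a ≠ 1 := by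
  intro h
  have key : ∀ x, ev a x = 0 := fun x => (refl_eq_self_iff ha x).1 (by rw [h]; rfl)
  have h1 := key 0
  have h2 := key a.1
  simp only [ev, inner_zero_right, zero_add, real_inner_self_eq_norm_sq, ha] at h1 h2
  rw [h1] at h2
  norm_num at h2

theorem refl_mem_inj {a b : V × ℝ} (ha : ‖a.1‖ = 1) (hb : ‖b.1‖ = 1) (h : refl a = refl b) :
    a = b ∨ a = -b := by
  -- compare the displacement of the two reflections
  have key : ∀ x, ev a x • a.1 = ev b x • b.1 := by
    intro x
    have := congrArg (fun f => f x) h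
    simp only [refl_apply ha, refl_apply hb] at this
    have h2 : (2 : ℝ) • (ev a x • a.1) = (2 : ℝ) • (ev b x • b.1) := by
      simpa [smul_smul] using this
    exact smul_right_injective V (two_ne_zero) h2
  have hx : ev a ((1 - a.2) • a.1) = 1 := by
    simp [ev, real_inner_smul_right, ha]
  have h1 := key ((1 - a.2) • a.1)
  rw [hx, one_smul] at h1
  set c := ev b ((1 - a.2) • a.1)
  have hc : |c| = 1 := by
    have := congrArg norm h1
    rw [norm_smul, ha, hb, mul_one] at this
    simpa using this.symm
  have hb0 : b.1 ≠ 0 := fun h => by simp [h] at hb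
  have h2 : ∀ x, ev a x * c = ev b x := by
    intro x
    have := key x
    rw [h1, smul_smul] at this
    exact smul_left_injective ℝ hb0 this
  rcases eq_or_eq_neg_of_abs_eq hc with h | h
  · left; exact ev_injective fun x => by rw [← h2, h, mul_one]
  · right; exact ev_injective fun x => by rw [ev_neg, ← h2, h]; ring

/-- The action of isometries on affine functions. -/
noncomputable def act (g : V ≃ᵃⁱ[ℝ] V) (a : V × ℝ) : V × ℝ :=
  (g.linearIsometryEquiv a.1, ev a (g⁻¹ 0))

theorem ev_act_apply (g : V ≃ᵃⁱ[ℝ] V) (a : V × ℝ) (x : V) : ev (act g a) (g x) = ev a x := by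
  have h1 : x = g.linearIsometryEquiv.symm (g x) + g⁻¹ 0 := by
    apply g.injective
    have := g.map_vadd (g⁻¹ 0) (g.linearIsometryEquiv.symm (g x))
    simp only [vadd_eq_add] at this
    rw [this]
    simp
  conv_rhs => rw [h1, add_comm, ev_add_vec]
  simp only [act, ev]
  rw [LinearIsometryEquiv.inner_map_eq_flip]
  ring

theorem ev_act (g : V ≃ᵃⁱ[ℝ] V) (a : V × ℝ) (x : V) : ev (act g a) x = ev a (g⁻¹ x) := by
  conv_lhs => rw [← g.apply_symm_apply x]
  exact ev_act_apply g a _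

@[simp] theorem norm_act (g : V ≃ᵃⁱ[ℝ] V) (a : V × ℝ) : ‖(act g a).1‖ = ‖a.1‖ := by
  simp [act]

theorem inner_act (g : V ≃ᵃⁱ[ℝ] V) (a b : V × ℝ) : ⟪(act g a).1, (act g b).1⟫ = ⟪a.1, b.1⟫ := by
  simp [act]

theorem act_mul (g h : V ≃ᵃⁱ[ℝ] V) (a : V × ℝ) : act (g * h) a = act g (act h a) := by
  apply ev_injective; intro x
  simp only [ev_act, mul_inv_rev]; rfl

theorem act_one (a : V × ℝ) : act 1 a = a := by
  apply ev_injective; intro x; simp [ev_act]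

/-- This is the usual formula for a reflection acting on roots. It holds on V × ℝ with the
semidefinite form that only sees gradients, so parallel facets need no separate treatment in Tits'
argument. -/
theorem act_refl {a : V × ℝ} (ha : ‖a.1‖ = 1) (b : V × ℝ) :
    act (refl a) b = b - (2 * ⟪a.1, b.1⟫) • a := by
  apply ev_injective; intro x
  rw [ev_act, refl_inv ha, ev_refl ha, ev_sub, ev_smul]

theorem refl_act (g : V ≃ᵃⁱ[ℝ] V) {a : V × ℝ} (ha : ‖a.1‖ = 1) :
    refl (act g a) = g * refl a * g⁻¹ := by
  ext x
  obtain ⟨y, rfl⟩ := g.surjective x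
  have h : (g * refl a * g⁻¹) (g y) = g (refl a y) := by simp
  rw [h, refl_apply (by simpa using ha), ev_act_apply, refl_apply ha]
  have := g.map_vadd y (-(2 * ev a y) • a.1)
  simp only [vadd_eq_add] at this
  rw [show y - (2 * ev a y) • a.1 = -(2 * ev a y) • a.1 + y by module, this]
  simp [act]
  module

theorem act_trans (t : V) (a : V × ℝ) : act (trans t) a = (a.1, a.2 - ⟪a.1, t⟫) := by
  apply ev_injective; intro x
  rw [ev_act, ← trans_neg]
  simp [ev, inner_add_right]; ring

theorem refl_mul_refl_parallel {u : V} (hu : ‖u‖ = 1) (c d : ℝ) :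
    refl (u, c) * refl (u, d) = trans ((2 * (d - c)) • u) := by
  ext x
  have h1 : refl ((u, c) : V × ℝ) (refl (u, d) x) = (2 * (d - c)) • u + x := by
    rw [refl_apply (a := (u, c)) hu, refl_apply (a := (u, d)) hu]
    simp only [ev, inner_sub_right, real_inner_smul_right, real_inner_self_eq_norm_sq, hu]
    module
  exact h1

theorem refl_apply_rt {u v : V} (hu : ‖u‖ = 1) : refl (rt u v) v = v := by
  rw [refl_eq_self_iff (by simpa), ev_rt]; simp

/-! ### Coxeter families, word length and Tits' lemma. -/

/-- A family of unit affine functions whose zero sets meet at angles `π / m`, or are parallel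
with opposite gradients. -/
structure IsCoxFamily {ι : Type*} (A : ι → V × ℝ) : Prop where
  norm : ∀ i, ‖(A i).1‖ = 1
  gram : ∀ i j, i ≠ j → ∃ m : ℕ, m ≠ 1 ∧ ⟪(A i).1, (A j).1⟫ = -Real.cos (π / m)

/-- The group generated by the reflections of a family. -/
noncomputable def gp {ι : Type*} (A : ι → V × ℝ) : Subgroup (V ≃ᵃⁱ[ℝ] V) :=
  Subgroup.closure (Set.range fun i => refl (A i))

/-- The intersection of the half-spaces of a family. -/
def region {ι : Type*} (A : ι → V × ℝ) : Set V := {x | ∀ i, 0 ≤ ev (A i) x}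

theorem refl_mem_gp {ι : Type*} (A : ι → V × ℝ) (i : ι) : refl (A i) ∈ gp A :=
  Subgroup.subset_closure ⟨i, rfl⟩

/-- The word length of an isometry with respect to the reflections of a family. -/
noncomputable def len {ι : Type*} (A : ι → V × ℝ) (g : V ≃ᵃⁱ[ℝ] V) : ℕ :=
  sInf {k | ∃ l : List ι, l.length = k ∧ (l.map fun i => refl (A i)).prod = g}

section Length

variable {ι : Type*} {A : ι → V × ℝ}

theorem exists_word (hA : ∀ i, ‖(A i).1‖ = 1) {g : V ≃ᵃⁱ[ℝ] V} (hg : g ∈ gp A) :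
    ∃ l : List ι, (l.map fun i => refl (A i)).prod = g := by
  induction hg using Subgroup.closure_induction with
  | mem x hx => obtain ⟨i, rfl⟩ := hx; exact ⟨[i], by simp⟩
  | one => exact ⟨[], by simp⟩
  | mul x y _ _ hx hy =>
    obtain ⟨l, rfl⟩ := hx
    obtain ⟨l', rfl⟩ := hy
    exact ⟨l ++ l', by simp⟩
  | inv x _ hx =>
    obtain ⟨l, rfl⟩ := hx
    refine ⟨l.reverse, ?_⟩
    rw [List.prod_inv_reverse, List.map_reverse, List.map_map]
    congr 2
    exact List.map_congr_left fun i _ => (refl_inv (hA i)).symm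

theorem len_le_of_word {g : V ≃ᵃⁱ[ℝ] V} (l : List ι)
    (h : (l.map fun i => refl (A i)).prod = g) : len A g ≤ l.length :=
  Nat.sInf_le ⟨l, rfl, h⟩

theorem exists_word_len (hA : ∀ i, ‖(A i).1‖ = 1) {g : V ≃ᵃⁱ[ℝ] V} (hg : g ∈ gp A) :
    ∃ l : List ι, l.length = len A g ∧ (l.map fun i => refl (A i)).prod = g := by
  obtain ⟨l, hl⟩ := exists_word hA hg
  exact Nat.sInf_mem (s := {k | ∃ l : List ι, l.length = k ∧
    (l.map fun i => refl (A i)).prod = g}) ⟨_, l, rfl, hl⟩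

theorem len_mul_le (hA : ∀ i, ‖(A i).1‖ = 1) {g : V ≃ᵃⁱ[ℝ] V} (hg : g ∈ gp A) (i : ι) :
    len A (g * refl (A i)) ≤ len A g + 1 := by
  obtain ⟨l, hl, rfl⟩ := exists_word_len hA hg
  rw [← hl]
  exact (len_le_of_word (l ++ [i]) (by simp)).trans (by simp)

theorem len_le_mul (hA : ∀ i, ‖(A i).1‖ = 1) {g : V ≃ᵃⁱ[ℝ] V} (hg : g ∈ gp A) (i : ι) :
    len A g ≤ len A (g * refl (A i)) + 1 := by
  have := len_mul_le hA (mul_mem hg (refl_mem_gp A i)) i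
  rwa [mul_assoc, refl_mul_self (hA i), mul_one] at this

theorem exists_len_lt (hA : ∀ i, ‖(A i).1‖ = 1) {g : V ≃ᵃⁱ[ℝ] V} (hg : g ∈ gp A) (h1 : g ≠ 1) :
    ∃ i, len A (g * refl (A i)) < len A g := by
  obtain ⟨l, hl, rfl⟩ := exists_word_len hA hg
  rcases List.eq_nil_or_concat l with rfl | ⟨l, i, rfl⟩
  · simp at h1
  · refine ⟨i, ?_⟩
    rw [← hl]
    refine (len_le_of_word l ?_).trans_lt (by simp)
    simp [mul_assoc, refl_mul_self (hA i)]

/-- The letters of alternating words. -/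
def letter (s t : ι) (k : ℕ) : ι := if Even k then t else s

theorem letter_succ (s t : ι) (k : ℕ) : letter s t (k + 1) = letter t s k := by
  unfold letter
  by_cases h : Even k <;> simp [h, Nat.even_add_one]

/-- Alternating words of length `k` in two reflections, with last letter `t`. -/
noncomputable def alt (A : ι → V × ℝ) (s t : ι) : ℕ → (V ≃ᵃⁱ[ℝ] V)
  | 0 => 1
  | k + 1 => refl (A (letter s t k)) * alt A s t k

theorem alt_succ' (s t : ι) (k : ℕ) : alt A s t (k + 1) = alt A t s k * refl (A t) := by
  induction k generalizing s t with
  | zero => simp [alt, letter]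
  | succ k ih =>
    rw [alt, ih, alt, letter_succ, mul_assoc]

/-- The coefficients in the orbit of a root under a dihedral group. -/
def dihedralCoeff (c : ℝ) : ℕ → ℝ
  | 0 => 0
  | 1 => 1
  | k + 2 => 2 * c * dihedralCoeff c (k + 1) - dihedralCoeff c k

/-- The coefficients are Chebyshev values sin(kθ)/sin θ. Multiplying by the sine avoids dividing by
zero at θ = 0, where `dihedralCoeff_one` takes over. -/
theorem dihedralCoeff_cos (θ : ℝ) (k : ℕ) :
    dihedralCoeff (Real.cos θ) k * Real.sin θ = Real.sin (k * θ) := by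
  induction k using Nat.twoStepInduction with
  | zero => simp [dihedralCoeff]
  | one => simp [dihedralCoeff]
  | more k h1 h2 =>
    rw [dihedralCoeff, sub_mul, mul_assoc, h1, h2]
    have e1 : ((k + 2 : ℕ) : ℝ) * θ = (k + 1 : ℕ) * θ + θ := by push_cast; ring
    have e2 : (k : ℝ) * θ = (k + 1 : ℕ) * θ - θ := by push_cast; ring
    rw [e1, e2, Real.sin_add, Real.sin_sub]
    ring

theorem dihedralCoeff_one (k : ℕ) : dihedralCoeff 1 k = k := by
  induction k using Nat.twoStepInduction with
  | zero => simp [dihedralCoeff]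
  | one => simp [dihedralCoeff]
  | more k h1 h2 => rw [dihedralCoeff, h1, h2]; push_cast; ring

theorem sin_pi_div_pos {m : ℕ} (hm : 2 ≤ m) : 0 < Real.sin (π / m) := by
  have h2 : (2 : ℝ) ≤ m := by exact_mod_cast hm
  refine Real.sin_pos_of_pos_of_lt_pi (by positivity) ?_
  rw [div_lt_iff₀ (by positivity)]
  nlinarith [Real.pi_pos]

/-- The angle kπ/m stays in [0, π] as long as k ≤ m. For m = 0 the facets are parallel, π / 0 = 0 in
Lean, and the coefficient is k itself, so no bound on k is required. -/
theorem dihedralCoeff_nonneg {m : ℕ} (hm : m ≠ 1) {k : ℕ} (hk : m ≠ 0 → k ≤ m) :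
    0 ≤ dihedralCoeff (Real.cos (π / m)) k := by
  rcases Nat.eq_zero_or_pos m with rfl | h0
  · simp [dihedralCoeff_one]
  · have h2 : 2 ≤ m := by omega
    have hs := sin_pi_div_pos h2
    refine nonneg_of_mul_nonneg_left ?_ hs
    rw [dihedralCoeff_cos]
    have hk' : (k : ℝ) ≤ m := by exact_mod_cast hk (by omega)
    have : (0 : ℝ) < m := by exact_mod_cast h0
    refine Real.sin_nonneg_of_nonneg_of_le_pi (by positivity) ?_
    rw [mul_div_assoc', div_le_iff₀ this]
    nlinarith [Real.pi_pos]

theorem dihedralCoeff_self {m : ℕ} (hm : 2 ≤ m) :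
    dihedralCoeff (Real.cos (π / m)) m = 0 ∧ dihedralCoeff (Real.cos (π / m)) (m - 1) = 1 ∧
      dihedralCoeff (Real.cos (π / m)) (m + 1) = -1 := by
  have hs := sin_pi_div_pos hm
  have h0 : (m : ℝ) ≠ 0 := by positivity
  have h1 : dihedralCoeff (Real.cos (π / m)) m = 0 := by
    refine (mul_eq_zero.1 ?_).resolve_right hs.ne'
    rw [dihedralCoeff_cos, mul_div_cancel₀ _ h0, Real.sin_pi]
  have h2 : dihedralCoeff (Real.cos (π / m)) (m - 1) = 1 := by
    refine mul_right_cancel₀ hs.ne' ?_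
    rw [dihedralCoeff_cos, Nat.cast_sub (by omega), sub_mul, mul_div_cancel₀ _ h0]
    simp [Real.sin_pi_sub]
  refine ⟨h1, h2, ?_⟩
  obtain ⟨k, rfl⟩ : ∃ k, m = k + 1 := ⟨m - 1, by omega⟩
  rw [dihedralCoeff, h1]
  rw [show k + 1 - 1 = k by omega] at h2
  rw [h2]; ring

theorem act_add (g : V ≃ᵃⁱ[ℝ] V) (a b : V × ℝ) : act g (a + b) = act g a + act g b := by
  apply ev_injective; intro x; simp [ev_act, ev_add]

theorem act_sub (g : V ≃ᵃⁱ[ℝ] V) (a b : V × ℝ) : act g (a - b) = act g a - act g b := by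
  apply ev_injective; intro x; simp [ev_act, ev_sub]

theorem act_smul (g : V ≃ᵃⁱ[ℝ] V) (r : ℝ) (a : V × ℝ) : act g (r • a) = r • act g a := by
  apply ev_injective; intro x; simp [ev_act, ev_smul]

/-- The orbit stays in the plane spanned by the two functions, and the recursion defining
`dihedralCoeff` is exactly the effect of one more reflection on its two coordinates. -/
theorem act_alt_left (hA : ∀ i, ‖(A i).1‖ = 1) {s t : ι} {c : ℝ}
    (hc : ⟪(A s).1, (A t).1⟫ = -c) (k : ℕ) :
    act (alt A s t k) (A s) = dihedralCoeff c (k + 1) • A (letter s t (k + 1)) +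
      dihedralCoeff c k • A (letter s t k) := by
  induction k with
  | zero => simp [alt, dihedralCoeff, letter, act_one]
  | succ k ih =>
    have hc' : ⟪(A (letter s t k)).1, (A (letter s t (k + 1))).1⟫ = -c := by
      rw [letter_succ]
      unfold letter
      split_ifs
      · rw [real_inner_comm]; exact hc
      · exact hc
    have hl : letter s t (k + 1 + 1) = letter s t k := by rw [letter_succ, letter_succ]
    rw [alt, act_mul, ih, act_refl (hA _), hl]
    simp only [Prod.fst_add, Prod.smul_fst, inner_add_right, real_inner_smul_right, hc',
      real_inner_self_eq_norm_sq, hA]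
    rw [show dihedralCoeff c (k + 1 + 1) = 2 * c * dihedralCoeff c (k + 1) - dihedralCoeff c k
      from rfl]
    module

theorem act_alt_right (hA : ∀ i, ‖(A i).1‖ = 1) {s t : ι} {c : ℝ}
    (hc : ⟪(A s).1, (A t).1⟫ = -c) (k : ℕ) :
    act (alt A s t (k + 1)) (A t) = -(dihedralCoeff c (k + 1) • A (letter s t k) +
      dihedralCoeff c k • A (letter s t (k + 1))) := by
  have h := act_alt_left hA (s := t) (t := s) (by rw [real_inner_comm]; exact hc) k
  rw [alt_succ', act_mul, act_refl (hA t), real_inner_self_eq_norm_sq, hA, act_sub, act_smul, h]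
  rw [letter_succ t s, letter_succ s t]
  module

theorem isometry_ext_act {g h : V ≃ᵃⁱ[ℝ] V} (H : ∀ b : V × ℝ, act g b = act h b) : g = h := by
  rw [← inv_inj]
  ext x
  refine ext_inner_left ℝ fun u => ?_
  have := congrArg (fun b => ev b x) (H (u, 0))
  simp only [ev_act] at this
  simpa [ev] using this

theorem act_alt_of_orthogonal (hA : ∀ i, ‖(A i).1‖ = 1) {s t : ι} {b : V × ℝ}
    (hs : ⟪(A s).1, b.1⟫ = 0) (ht : ⟪(A t).1, b.1⟫ = 0) (k : ℕ) : act (alt A s t k) b = b := by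
  induction k with
  | zero => simp [alt, act_one]
  | succ k ih =>
    rw [alt, act_mul, ih, act_refl (hA _)]
    unfold letter
    split_ifs <;> simp [hs, ht]

/-- Both words act alike on `A s` and `A t` by the coefficients at the longest element, and
trivially on functions with gradient orthogonal to both. As 1 - c² ≠ 0, every affine function splits
into these parts, and an isometry is determined by its action on affine functions. -/
theorem alt_braid (hA : ∀ i, ‖(A i).1‖ = 1) {s t : ι} {m : ℕ} (hm : 2 ≤ m)
    (hc : ⟪(A s).1, (A t).1⟫ = -Real.cos (π / m)) : alt A s t m = alt A t s m := by
  set c := Real.cos (π / m) with hcdef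
  have hc1 : 1 - c ^ 2 ≠ 0 := by
    have := sin_pi_div_pos hm
    have h2 := Real.sin_sq_add_cos_sq (π / m)
    rw [← hcdef] at h2
    have : 0 < Real.sin (π / m) ^ 2 := by positivity
    linarith
  have hc' : ⟪(A t).1, (A s).1⟫ = -c := by rw [real_inner_comm]; exact hc
  obtain ⟨h0, h1, h2⟩ := dihedralCoeff_self hm
  rw [← hcdef] at h0 h1 h2
  obtain ⟨k, rfl⟩ : ∃ k, m = k + 1 := ⟨m - 1, by omega⟩
  rw [show k + 1 - 1 = k by omega] at h1
  have eS : act (alt A s t (k + 1)) (A s) = act (alt A t s (k + 1)) (A s) := by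
    rw [act_alt_left hA hc, act_alt_right hA hc', h0, h1, h2, letter_succ, letter_succ,
      letter_succ]
    module
  have eT : act (alt A s t (k + 1)) (A t) = act (alt A t s (k + 1)) (A t) := by
    rw [act_alt_right hA hc, act_alt_left hA hc', h0, h1, h2, letter_succ, letter_succ,
      letter_succ]
    module
  refine isometry_ext_act fun b => ?_
  -- The numbers p and q solve the 2 × 2 Gram system that makes b - pA_s - qA_t orthogonal to both
  -- gradients.
  set p := (⟪(A s).1, b.1⟫ + c * ⟪(A t).1, b.1⟫) / (1 - c ^ 2) with hp
  set q := (⟪(A t).1, b.1⟫ + c * ⟪(A s).1, b.1⟫) / (1 - c ^ 2) with hq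
  obtain ⟨b', hb'⟩ : ∃ b' : V × ℝ, b' = b - p • A s - q • A t := ⟨_, rfl⟩
  have hs : ⟪(A s).1, b'.1⟫ = 0 := by
    rw [hb']
    simp only [Prod.fst_sub, Prod.smul_fst, inner_sub_right, real_inner_smul_right, hc,
      real_inner_self_eq_norm_sq, hA, hp, hq]
    field_simp; ring
  have ht : ⟪(A t).1, b'.1⟫ = 0 := by
    rw [hb']
    simp only [Prod.fst_sub, Prod.smul_fst, inner_sub_right, real_inner_smul_right, hc',
      real_inner_self_eq_norm_sq, hA, hp, hq]
    field_simp; ring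
  have hb : b = b' + p • A s + q • A t := by rw [hb']; module
  rw [hb]
  simp only [act_add, act_smul, eS, eT, act_alt_of_orthogonal hA hs ht,
    act_alt_of_orthogonal hA ht hs]

theorem len_mul_alt_le (hA : ∀ i, ‖(A i).1‖ = 1) {g : V ≃ᵃⁱ[ℝ] V} (hg : g ∈ gp A) (s t : ι)
    (k : ℕ) : len A (g * alt A s t k) ≤ len A g + k := by
  induction k generalizing g with
  | zero => simp [alt]
  | succ k ih =>
    rw [alt, ← mul_assoc]
    exact (ih (mul_mem hg (refl_mem_gp A _))).trans (by have := len_mul_le hA hg (letter s t k); omega)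

/-- **Tits' lemma.** If right multiplication by the `s`-th reflection does not shorten `w`, then
the fundamental region is on the nonnegative side of the `w`-image of the `s`-th wall. -/
theorem nonneg_of_len_le (hA : IsCoxFamily A) (w : V ≃ᵃⁱ[ℝ] V) (hw : w ∈ gp A) (s : ι)
    (h : len A w ≤ len A (w * refl (A s))) {x : V} (hx : x ∈ region A) :
    0 ≤ ev (act w (A s)) x := by
  induction hn : len A w using Nat.strong_induction_on generalizing w s with
  | _ n ih =>
    subst hn
    by_cases hw1 : w = 1
    · subst hw1; rw [act_one]; exact hx s
    obtain ⟨t, ht⟩ := exists_len_lt hA.norm hw hw1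
    have hst : s ≠ t := by rintro rfl; omega
    obtain ⟨m, hm1, hm⟩ := hA.gram s t hst
    -- strip a maximal alternating word from the right
    let Q : ℕ → Prop := fun k => ∃ v ∈ gp A, w = v * alt A s t k ∧ len A w = len A v + k
    have hQ1 : Q 1 := by
      refine ⟨w * refl (A t), mul_mem hw (refl_mem_gp A t), ?_, ?_⟩
      · simp [alt, letter, mul_assoc, refl_mul_self (hA.norm t)]
      · have := len_le_mul hA.norm hw t
        omega
    have hQle : ∀ k, Q k → k ≤ len A w := by
      rintro k ⟨v, -, -, h⟩; omega
    classical
    obtain ⟨k, hk1, hQk, hmax⟩ : ∃ k, 1 ≤ k ∧ Q k ∧ ¬ Q (k + 1) := by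
      by_contra hcon
      push Not at hcon
      have : ∀ k, 1 ≤ k → Q k := by
        intro k hk
        induction k, hk using Nat.le_induction with
        | base => exact hQ1
        | succ k hk ih => exact hcon k hk ih
      have := hQle _ (this (len A w + 1) (by omega))
      omega
    obtain ⟨v, hv, hwv, hlen⟩ := hQk
    -- By maximality of the stripped word, and by `hY` because the word is reduced, neither of the
    -- two reflections shortens v on the right. So the induction hypothesis applies to v with both
    -- letters.
    have hX : len A v ≤ len A (v * refl (A (letter s t k))) := by
      by_contra hlt
      push Not at hlt
      refine hmax ⟨v * refl (A (letter s t k)), mul_mem hv (refl_mem_gp A _), ?_, ?_⟩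
      · rw [hwv, alt, ← mul_assoc, mul_assoc v, refl_mul_self (hA.norm _), mul_one]
      · have := len_le_mul hA.norm hv (letter s t k)
        omega
    obtain ⟨j, rfl⟩ : ∃ j, k = j + 1 := ⟨k - 1, by omega⟩
    have hY : len A v ≤ len A (v * refl (A (letter s t (j + 1 + 1)))) := by
      rw [letter_succ, letter_succ]
      have h1 := len_mul_alt_le hA.norm (mul_mem hv (refl_mem_gp A (letter s t j))) s t j
      rw [mul_assoc, ← alt, ← hwv] at h1
      omega
    have hkm : m ≠ 0 → j + 1 + 1 ≤ m := by
      intro hm0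
      by_contra hlt
      have hmk : m ≤ j + 1 := by omega
      -- the stripped word contains the longest element of the dihedral group
      have hQm : ∀ i ≤ j + 1, ∃ v ∈ gp A, w = v * alt A s t (j + 1 - i) ∧
          len A v + (j + 1 - i) ≤ len A w := by
        intro i
        induction i with
        | zero => intro _; exact ⟨v, hv, by simpa using hwv, by omega⟩
        | succ i ih =>
          intro hi
          obtain ⟨v', hv', h1, h2⟩ := ih (by omega)
          have e : j + 1 - i = (j + 1 - (i + 1)) + 1 := by omega
          rw [e] at h1 h2
          refine ⟨v' * refl (A (letter s t (j + 1 - (i + 1)))),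
            mul_mem hv' (refl_mem_gp A _), ?_, ?_⟩
          · rw [h1, alt, mul_assoc]
          · have := len_mul_le hA.norm hv' (letter s t (j + 1 - (i + 1)))
            omega
      obtain ⟨v', hv', h1, h2⟩ := hQm (j + 1 - m) (by omega)
      rw [show j + 1 - (j + 1 - m) = m by omega] at h1 h2
      obtain ⟨p, rfl⟩ : ∃ p, m = p + 1 := ⟨m - 1, by omega⟩
      -- The braid relation rewrites the last m letters to end in s. Cancelling that letter makes `w
      -- * refl (A s)` shorter than w, against the hypothesis.
      have h3 : w * refl (A s) = v' * alt A s t p := by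
        rw [h1, alt_braid hA.norm (by omega) hm, alt_succ', mul_assoc, mul_assoc,
          refl_mul_self (hA.norm s), mul_one]
      have := len_mul_alt_le hA.norm hv' s t p
      rw [← h3] at this
      omega
    have hlt : len A v < len A w := by omega
    have e1 := ih _ hlt v hv _ hX rfl
    have e2 := ih _ hlt v hv _ hY rfl
    -- The image of `A s` under w is a combination, with nonnegative coefficients since k + 1 ≤ m or
    -- m = 0, of the two images under v.
    rw [hwv, act_mul, act_alt_left hA.norm hm, act_add, act_smul, act_smul, ev_add, ev_smul,
      ev_smul]
    have c1 := dihedralCoeff_nonneg hm1 (k := j + 1 + 1) hkm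
    have c2 := dihedralCoeff_nonneg hm1 (k := j + 1) (fun h => by have := hkm h; omega)
    positivity

end Length

/-! ### The fundamental domain and the discreteness of the group. -/

theorem finite_of_bounded_of_separated {X : Type*} [MetricSpace X] [ProperSpace X] {s : Set X}
    (hb : Bornology.IsBounded s) {ε : ℝ} (hε : 0 < ε)
    (hs : ∀ x ∈ s, ∀ y ∈ s, dist x y < ε → x = y) : s.Finite := by
  obtain ⟨t, ht, hc⟩ := Metric.totallyBounded_iff.1
    (hb.isCompact_closure.totallyBounded) (ε / 2) (by positivity)
  have key : ∀ x ∈ s, ∃ y ∈ t, dist x y < ε / 2 := by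
    intro x hx
    simpa using hc (subset_closure hx)
  choose! f hf hfd using key
  refine Set.Finite.of_finite_image (f := f) (ht.subset (by rintro _ ⟨x, hx, rfl⟩; exact hf x hx)) ?_
  intro x hx y hy hxy
  refine hs x hx y hy ?_
  have h1 := hfd x hx
  have h2 := hfd y hy
  rw [← show f x = f y from hxy, dist_comm] at h2
  linarith [dist_triangle x (f x) y]

section Family

variable {ι : Type*} {A : ι → V × ℝ}

/-- The group generated by the reflections of a family whose mirrors contain a given point. -/
noncomputable def gpAt (A : ι → V × ℝ) (x : V) : Subgroup (V ≃ᵃⁱ[ℝ] V) :=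
  Subgroup.closure {r | ∃ i, ev (A i) x = 0 ∧ r = refl (A i)}

theorem gpAt_le (A : ι → V × ℝ) (x : V) : gpAt A x ≤ gp A := by
  refine (Subgroup.closure_le _).2 ?_
  rintro _ ⟨i, -, rfl⟩
  exact refl_mem_gp A i

theorem apply_eq_of_mem_gpAt (hA : ∀ i, ‖(A i).1‖ = 1) {g : V ≃ᵃⁱ[ℝ] V} {x : V}
    (hg : g ∈ gpAt A x) : g x = x := by
  induction hg using Subgroup.closure_induction with
  | mem r hr => obtain ⟨i, hi, rfl⟩ := hr; exact (refl_eq_self_iff (hA i) x).2 hi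
  | one => rfl
  | mul a b _ _ ha hb =>
    rw [AffineIsometryEquiv.coe_mul, Function.comp_apply, hb, ha]
  | inv a _ ha => rw [AffineIsometryEquiv.coe_inv, AffineIsometryEquiv.symm_apply_eq, ha]

/-- The region of a Coxeter family is a strict fundamental domain. -/
theorem eq_and_mem_gpAt (hA : IsCoxFamily A) {g : V ≃ᵃⁱ[ℝ] V} (hg : g ∈ gp A) {x : V}
    (hx : x ∈ region A) (hgx : g x ∈ region A) : g x = x ∧ g ∈ gpAt A x := by
  induction hn : len A g using Nat.strong_induction_on generalizing g with
  | _ n ih =>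
    subst hn
    by_cases h1 : g = 1
    · subst h1; exact ⟨rfl, one_mem _⟩
    obtain ⟨i, hi⟩ := exists_len_lt hA.norm hg h1
    have hgi := mul_mem hg (refl_mem_gp A i)
    -- Tits' lemma for g rᵢ, evaluated at g x, says that the i-th function is nonpositive at x. So x
    -- lies on this wall, and rᵢ can be stripped from g without changing g x.
    have h2 := nonneg_of_len_le hA _ hgi i (by
      rw [mul_assoc, refl_mul_self (hA.norm i), mul_one]; omega) hgx
    rw [act_mul, ev_act_apply, act_refl (hA.norm i), real_inner_self_eq_norm_sq, hA.norm,
      ev_sub, ev_smul] at h2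
    have h0 : ev (A i) x = 0 := le_antisymm (by linarith) (hx i)
    have hrx : refl (A i) x = x := (refl_eq_self_iff (hA.norm i) x).2 h0
    have hgrx : (g * refl (A i)) x = g x := by
      rw [AffineIsometryEquiv.coe_mul, Function.comp_apply, hrx]
    obtain ⟨e1, e2⟩ := ih _ hi hgi (by rw [hgrx]; exact hgx) rfl
    refine ⟨by rw [← hgrx, e1], ?_⟩
    have : g = g * refl (A i) * refl (A i) := by
      rw [mul_assoc, refl_mul_self (hA.norm i), mul_one]
    rw [this]
    exact mul_mem e2 (Subgroup.subset_closure ⟨i, h0, rfl⟩)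

theorem eq_one_of_apply_mem_region (hA : IsCoxFamily A) {g : V ≃ᵃⁱ[ℝ] V} (hg : g ∈ gp A) {p : V}
    (hp : ∀ i, 0 < ev (A i) p) (hgp : g p ∈ region A) : g = 1 := by
  have h := (eq_and_mem_gpAt hA hg (fun i => (hp i).le) hgp).2
  have : gpAt A p = ⊥ := by
    rw [gpAt, Subgroup.closure_eq_bot_iff]
    rintro _ ⟨i, hi, -⟩
    exact absurd hi (hp i).ne'
  rw [this] at h
  simpa using h

/-- A mirror through an interior point would give a nontrivial element of the stabilizer of that
point, which is trivial. -/
theorem ev_ne_zero_of_refl_mem (hA : IsCoxFamily A) {b : V × ℝ} (hb : ‖b.1‖ = 1)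
    (hbm : refl b ∈ gp A) {p : V} (hp : ∀ i, 0 < ev (A i) p) : ev b p ≠ 0 := by
  intro h
  have h1 := (refl_eq_self_iff hb p).2 h
  exact refl_ne_one hb (eq_one_of_apply_mem_region hA hbm hp (by rw [h1]; exact fun i => (hp i).le))

/-- No mirror of the group cuts the fundamental region. -/
theorem nonneg_of_pos_of_refl_mem (hA : IsCoxFamily A) {b : V × ℝ} (hb : ‖b.1‖ = 1)
    (hbm : refl b ∈ gp A) {p : V} (hp : ∀ i, 0 < ev (A i) p)
    {x : V} (hx : x ∈ region A) (hpos : 0 < ev b x) {y : V} (hy : y ∈ region A) : 0 ≤ ev b y := by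
  have aff : ∀ (a : V × ℝ) (s t : V) (r : ℝ),
      ev a (AffineMap.lineMap s t r) = (1 - r) * ev a s + r * ev a t := by
    intro a s t r
    simp only [ev, AffineMap.lineMap_apply, vsub_eq_sub, vadd_eq_add, inner_add_right,
      real_inner_smul_right, inner_sub_right]
    ring
  -- a mirror separating two points of the region meets its interior
  have main : ∀ z ∈ region A, ∀ w, (∀ i, 0 < ev (A i) w) → 0 ≤ ev b z * ev b w := by
    intro z hz w hw
    by_contra hneg
    push Not at hneg
    have hd : ev b z - ev b w ≠ 0 := by
      intro h
      rw [sub_eq_zero.1 h] at hneg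
      nlinarith [sq_nonneg (ev b w)]
    set r := ev b z / (ev b z - ev b w) with hr
    have hr0 : 0 < r := by
      rcases lt_or_gt_of_ne hd with h | h
      · exact div_pos_of_neg_of_neg (by by_contra hh; nlinarith) h
      · exact div_pos (by by_contra hh; nlinarith) h
    have hr1 : r ≤ 1 := by
      rcases lt_or_gt_of_ne hd with h | h
      · rw [hr, div_le_one_of_neg h]; by_contra hh; nlinarith
      · rw [hr, div_le_one h]; by_contra hh; nlinarith
    refine ev_ne_zero_of_refl_mem hA hb hbm (p := AffineMap.lineMap z w r) ?_ ?_
    · intro i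
      rw [aff]
      have := hz i
      have := hw i
      have : 0 < r * ev (A i) w := by positivity
      have : 0 ≤ (1 - r) * ev (A i) z := mul_nonneg (by linarith) (hz i)
      linarith
    · rw [aff, hr]; field_simp; ring
  have hp0 := ev_ne_zero_of_refl_mem hA hb hbm hp
  have h1 := main x hx p hp
  have h2 : 0 < ev b p := by
    rcases lt_or_gt_of_ne hp0 with h | h
    · nlinarith
    · exact h
  have h3 := main y hy p hp
  by_contra hh
  push Not at hh
  nlinarith

/-- Take ε to be the distance from p to the nearest wall. Facet functions are 1-Lipschitz, so an
image of p closer than ε is still in the region, and the group element is trivial. -/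
theorem exists_separation [Finite ι] (hA : IsCoxFamily A) {p : V} (hp : ∀ i, 0 < ev (A i) p) :
    ∃ ε > 0, ∀ g ∈ gp A, ‖g p - p‖ < ε → g = 1 := by
  obtain ⟨ε, hε, hle⟩ : ∃ ε > 0, ∀ i, ε ≤ ev (A i) p := by
    have := Fintype.ofFinite ι
    rcases isEmpty_or_nonempty ι with h | h
    · exact ⟨1, one_pos, fun i => h.elim i⟩
    · obtain ⟨i, hi⟩ := Finite.exists_min fun i => ev (A i) p
      exact ⟨_, hp i, hi⟩
  refine ⟨ε, hε, fun g hg hlt => eq_one_of_apply_mem_region hA hg hp fun i => ?_⟩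
  have := abs_le.1 (ev_abs_sub_le (A i) (hA.norm i) (g p) p)
  linarith [hle i]

theorem finite_ball [Finite ι] [FiniteDimensional ℝ V] (hA : IsCoxFamily A) {p : V}
    (hp : ∀ i, 0 < ev (A i) p) (x : V) (R : ℝ) : {g | g ∈ gp A ∧ ‖g x - p‖ ≤ R}.Finite := by
  obtain ⟨ε, hε, h⟩ := exists_separation hA hp
  have := FiniteDimensional.proper ℝ V
  have inj : ∀ g ∈ gp A, ∀ g' ∈ gp A, dist (g p) (g' p) < ε → g = g' := by
    intro g hg g' hg' hd
    have h1 : g'⁻¹ * g = 1 := by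
      refine h _ (mul_mem (inv_mem hg') hg) ?_
      have e1 : (g'⁻¹ * g) p - p = g'⁻¹ (g p) - g'⁻¹ (g' p) := by simp
      rw [e1, ← dist_eq_norm, AffineIsometryEquiv.dist_map]
      exact hd
    rw [inv_mul_eq_one] at h1
    exact h1.symm
  refine Set.Finite.of_finite_image (f := fun g => g p) ?_ ?_
  · refine finite_of_bounded_of_separated ?_ hε ?_
    · refine (Metric.isBounded_closedBall (x := p) (r := R + ‖p - x‖)).subset ?_
      rintro _ ⟨g, ⟨-, hgR⟩, rfl⟩
      rw [Metric.mem_closedBall, dist_eq_norm]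
      have e1 : ‖g p - g x‖ = ‖p - x‖ := by rw [← dist_eq_norm, g.dist_map, dist_eq_norm]
      have := norm_sub_le_norm_sub_add_norm_sub (g p) (g x) p
      linarith
    · rintro _ ⟨g, ⟨hg, -⟩, rfl⟩ _ ⟨g', ⟨hg', -⟩, rfl⟩ hd
      rw [inj g hg g' hg' hd]
  · rintro g ⟨hg, -⟩ g' ⟨hg', -⟩ he
    exact inj g hg g' hg' (by simpa [he] using hε)

/-- Folding a point over a wall that separates it from p brings it closer to p. This drives the
descent in `exists_apply_nonneg`. -/
theorem norm_refl_sub_lt {a : V × ℝ} (ha : ‖a.1‖ = 1) {p y : V} (hp : 0 < ev a p)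
    (hy : ev a y < 0) : ‖refl a y - p‖ < ‖y - p‖ := by
  have h1 : ‖refl a y - p‖ ^ 2 < ‖y - p‖ ^ 2 := by
    rw [refl_apply ha, show y - (2 * ev a y) • a.1 - p = (y - p) - (2 * ev a y) • a.1 by module,
      norm_sub_sq_real, real_inner_smul_right, norm_smul, ha, real_inner_comm, ← ev_sub_ev]
    simp only [mul_one, Real.norm_eq_abs, sq_abs]
    nlinarith
  exact lt_of_pow_lt_pow_left₀ 2 (norm_nonneg _) h1

/-- Every orbit of a subgroup generated by some of the reflections meets the corresponding cone. -/
theorem exists_apply_nonneg [Finite ι] [FiniteDimensional ℝ V] (hA : IsCoxFamily A) {p : V}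
    (hp : ∀ i, 0 < ev (A i) p) (H : Subgroup (V ≃ᵃⁱ[ℝ] V)) (hH : H ≤ gp A) (x : V) :
    ∃ g ∈ H, ∀ i, refl (A i) ∈ H → 0 ≤ ev (A i) (g x) := by
  have hfin : {g | g ∈ H ∧ ‖g x - p‖ ≤ ‖x - p‖}.Finite :=
    (finite_ball hA hp x ‖x - p‖).subset fun g hg => ⟨hH hg.1, hg.2⟩
  -- By discreteness only finitely many orbit points are at most as far from p as x, so a nearest
  -- one exists. It cannot be folded closer.
  obtain ⟨g, ⟨hg, hgR⟩, hmin⟩ := Set.exists_min_image _ (fun g => ‖g x - p‖) hfin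
    ⟨1, one_mem _, le_rfl⟩
  refine ⟨g, hg, fun i hi => ?_⟩
  by_contra hneg
  push Not at hneg
  have h1 := norm_refl_sub_lt (hA.norm i) (hp i) hneg
  have h2 := hmin (refl (A i) * g) ⟨mul_mem hi hg, h1.le.trans hgR⟩
  exact absurd h1 (not_lt.2 h2)

theorem exists_apply_mem_region [Finite ι] [FiniteDimensional ℝ V] (hA : IsCoxFamily A) {p : V}
    (hp : ∀ i, 0 < ev (A i) p) (x : V) : ∃ g ∈ gp A, g x ∈ region A := by
  obtain ⟨g, hg, h⟩ := exists_apply_nonneg hA hp (gp A) le_rfl x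
  exact ⟨g, hg, fun i => h i (refl_mem_gp A i)⟩

end Family

/-! ### Facet functions as barycentric coordinates of a simplex. -/

theorem ev_weighted {ι : Type*} (s : Finset ι) (w : ι → ℝ) (p : ι → V) (hw : ∑ i ∈ s, w i = 1)
    (a : V × ℝ) : ev a (∑ i ∈ s, w i • p i) = ∑ i ∈ s, w i * ev a (p i) := by
  simp only [ev, inner_sum, real_inner_smul_right, mul_add, Finset.sum_add_distrib,
    ← Finset.sum_mul, hw, one_mul]

section Simplex

variable {n : ℕ} [NeZero n] (T : Affine.Simplex ℝ V n)

/-- The affine function with unit gradient that vanishes on the `i`-th facet and is positive at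
the opposite vertex. -/
noncomputable def root (i : Fin (n + 1)) : V × ℝ :=
  rt (‖T.points i - T.altitudeFoot i‖⁻¹ • (T.points i - T.altitudeFoot i)) (T.altitudeFoot i)

theorem norm_root (i : Fin (n + 1)) : ‖(root T i).1‖ = 1 := by
  have : ‖T.points i - T.altitudeFoot i‖ ≠ 0 :=
    norm_ne_zero_iff.2 (sub_ne_zero.2 (T.ne_altitudeFoot i))
  rw [root, rt_fst, norm_smul, norm_inv, norm_norm, inv_mul_cancel₀ this]

theorem ev_root_of_ne {i j : Fin (n + 1)} (h : j ≠ i) : ev (root T i) (T.points j) = 0 := by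
  have := T.inner_vsub_altitudeFoot_vsub_altitudeFoot_eq_zero h.symm
  simp only [vsub_eq_sub] at this
  rw [root, ev_rt, real_inner_smul_left, real_inner_comm, this, mul_zero]

theorem ev_root_self (i : Fin (n + 1)) : ev (root T i) (T.points i) = T.height i := by
  have h : ‖T.points i - T.altitudeFoot i‖ ≠ 0 :=
    norm_ne_zero_iff.2 (sub_ne_zero.2 (T.ne_altitudeFoot i))
  rw [root, ev_rt, real_inner_smul_left, real_inner_self_eq_norm_sq, Affine.Simplex.height,
    dist_eq_norm]
  field_simp

theorem ev_root (i j : Fin (n + 1)) :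
    ev (root T i) (T.points j) = if j = i then T.height i else 0 := by
  split_ifs with h
  · rw [h, ev_root_self]
  · exact ev_root_of_ne T h

theorem ev_root_nonneg (i j : Fin (n + 1)) : 0 ≤ ev (root T i) (T.points j) := by
  rw [ev_root]; split_ifs
  · exact (T.height_pos i).le
  · exact le_rfl

theorem points_mem_region (j : Fin (n + 1)) : T.points j ∈ region (root T) :=
  fun i => ev_root_nonneg T i j

theorem inner_root (i j : Fin (n + 1)) :
    ⟪(root T i).1, (root T j).1⟫ = -Real.cos (dihedralAngle T i j) := by
  rw [dihedralAngle, Real.cos_pi_sub, InnerProductGeometry.cos_angle, neg_neg, root, root, rt_fst,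
    rt_fst, real_inner_smul_left, real_inner_smul_right, div_eq_mul_inv, mul_inv]
  ring

variable [FiniteDimensional ℝ V] [hV : Fact (finrank ℝ V = n)]

theorem affineSpan_points : affineSpan ℝ (Set.range T.points) = ⊤ := by
  rw [T.independent.affineSpan_eq_top_iff_card_eq_finrank_add_one, hV.out]
  simp

theorem exists_weights (x : V) : ∃ w : Fin (n + 1) → ℝ, ∑ i, w i = 1 ∧ x = ∑ i, w i • T.points i := by
  obtain ⟨w, hw, rfl⟩ := eq_affineCombination_of_mem_affineSpan_of_fintype
    (show x ∈ affineSpan ℝ (Set.range T.points) by rw [affineSpan_points]; trivial)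
  refine ⟨w, hw, ?_⟩
  rw [Finset.affineCombination_eq_linear_combination _ _ _ hw]

theorem weights_eq {w : Fin (n + 1) → ℝ} (hw : ∑ i, w i = 1) (j : Fin (n + 1)) :
    ev (root T j) (∑ i, w i • T.points i) = w j * T.height j := by
  rw [ev_weighted _ _ _ hw]
  simp [ev_root]

theorem ev_eq_sum (a : V × ℝ) (x : V) :
    ev a x = ∑ i, ev (root T i) x / T.height i * ev a (T.points i) := by
  obtain ⟨w, hw, rfl⟩ := exists_weights T x
  rw [ev_weighted _ _ _ hw]
  refine Finset.sum_congr rfl fun i _ => ?_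
  rw [weights_eq T hw, mul_div_cancel_right₀ _ (T.height_pos i).ne']

/-- Up to the heights, the facet functions are the basis of the affine functions dual to the
vertices. -/
theorem eq_sum_root (a : V × ℝ) :
    a = ∑ i, (ev a (T.points i) / T.height i) • root T i := by
  apply ev_injective; intro x
  rw [ev_eq_sum T a x, ev_sum]
  refine Finset.sum_congr rfl fun i _ => ?_
  rw [ev_smul]; ring

theorem sum_ev_root (x : V) : ∑ i, ev (root T i) x / T.height i = 1 := by
  have := ev_eq_sum T ((0 : V), (1 : ℝ)) x
  simpa [ev] using this.symm

/-- The gradient of the expansion of the constant function 1. By `mul_height_eq` every linear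
relation between the facet normals is a multiple of this one. -/
theorem sum_root : ∑ i, (T.height i)⁻¹ • (root T i).1 = 0 := by
  have h := congrArg Prod.fst (eq_sum_root T ((0 : V), (1 : ℝ)))
  rw [Prod.fst_sum] at h
  simpa [ev] using h.symm

theorem eq_sum_points (x : V) : x = ∑ i, (ev (root T i) x / T.height i) • T.points i := by
  obtain ⟨w, hw, rfl⟩ := exists_weights T x
  refine Finset.sum_congr rfl fun i _ => ?_
  rw [weights_eq T hw, mul_div_cancel_right₀ _ (T.height_pos i).ne']

theorem ext_of_ev_root {x y : V} (h : ∀ i, ev (root T i) x = ev (root T i) y) : x = y := by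
  rw [eq_sum_points T x, eq_sum_points T y]
  simp [h]

theorem eq_point_of_ev_root {x : V} {i : Fin (n + 1)} (h : ∀ j ≠ i, ev (root T j) x = 0) :
    x = T.points i := by
  have h1 := sum_ev_root T x
  rw [Finset.sum_eq_single i (fun j _ hj => by rw [h j hj, zero_div]) (by simp)] at h1
  rw [div_eq_one_iff_eq (T.height_pos i).ne'] at h1
  refine ext_of_ev_root T fun j => ?_
  rcases eq_or_ne j i with rfl | hj
  · rw [h1, ev_root_self]
  · rw [h j hj, ev_root_of_ne T hj.symm]

/-- The facet functions are determined by their zeros, sign and norm. -/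
theorem eq_root {a : V × ℝ} (ha : ‖a.1‖ = 1) {i : Fin (n + 1)}
    (h0 : ∀ j ≠ i, ev a (T.points j) = 0) (hpos : 0 < ev a (T.points i)) : a = root T i := by
  have h := eq_sum_root T a
  rw [Finset.sum_eq_single i (fun j _ hj => by rw [h0 j hj, zero_div, zero_smul]) (by simp)] at h
  have hc : 0 < ev a (T.points i) / T.height i := div_pos hpos (T.height_pos i)
  have h2 := congrArg (fun b : V × ℝ => ‖b.1‖) h
  simp only [ha, Prod.smul_fst, norm_smul, norm_root, Real.norm_eq_abs, abs_of_pos hc] at h2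
  rw [mul_one] at h2
  rw [h, ← h2, one_smul]

theorem mem_facet (i : Fin (n + 1)) (x : V) : x ∈ facet T i ↔ ev (root T i) x = 0 := by
  constructor
  · intro hx
    have : facet T i ≤ AffineSubspace.mk' (T.altitudeFoot i) (ℝ ∙ (root T i).1)ᗮ := by
      refine affineSpan_le.2 ?_
      rw [Affine.Simplex.range_faceOpposite_points]
      rintro _ ⟨j, hj, rfl⟩
      rw [SetLike.mem_coe, AffineSubspace.mem_mk', Submodule.mem_orthogonal_singleton_iff_inner_right]
      have := ev_root_of_ne T (i := i) (j := j) hj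
      rwa [root, ev_rt] at this
    have h2 := this hx
    rw [AffineSubspace.mem_mk', Submodule.mem_orthogonal_singleton_iff_inner_right] at h2
    rw [root, ev_rt]
    exact h2
  · intro h
    rw [facet, Affine.Simplex.range_faceOpposite_points]
    have hs := sum_ev_root T x
    have hw : ∑ j, ev (root T j) x / T.height j = 1 := hs
    have hx := eq_sum_points T x
    rw [← Finset.affineCombination_eq_linear_combination _ _ _ hw] at hx
    rw [hx]
    refine affineCombination_mem_affineSpan_image hw ?_ _
    intro j _ hj
    have : j = i := by simpa using hj
    rw [this, h, zero_div]

/-- The point is split into its foot q on the facet hyperplane and a normal component, which the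
orthogonal reflection negates. -/
theorem facetReflection_eq (i : Fin (n + 1)) : facetReflection T i = refl (root T i) := by
  ext x
  have hne : Nonempty (affineSpan ℝ (Set.range (T.faceOpposite i).points)) := inferInstance
  obtain ⟨q, hq⟩ : ∃ q, q = x - ev (root T i) x • (root T i).1 := ⟨_, rfl⟩
  have hqm : q ∈ affineSpan ℝ (Set.range (T.faceOpposite i).points) := by
    refine (mem_facet T i q).2 ?_
    rw [hq, sub_eq_add_neg, ev_add_vec, inner_neg_right, real_inner_smul_right,
      real_inner_self_eq_norm_sq, norm_root]
    ring
  have hdir : ev (root T i) x • (root T i).1 ∈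
      (affineSpan ℝ (Set.range (T.faceOpposite i).points)).directionᗮ := by
    refine Submodule.smul_mem _ _ ?_
    rw [Submodule.mem_orthogonal]
    intro w hw
    have h1 : w +ᵥ q ∈ facet T i := AffineSubspace.vadd_mem_of_mem_direction hw hqm
    rw [mem_facet, vadd_eq_add, add_comm, ev_add_vec, (mem_facet T i q).1 hqm, zero_add] at h1
    rw [real_inner_comm, h1]
  have hx : x = ev (root T i) x • (root T i).1 +ᵥ q := by rw [hq, vadd_eq_add]; module
  rw [refl_apply (norm_root T i)]
  conv_lhs => rw [facetReflection, hx, EuclideanGeometry.reflection_orthogonal_vadd hqm hdir]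
  rw [hq, vadd_eq_add]
  module

theorem gp_root : gp (root T) = reflGroup T := by
  unfold gp reflGroup
  congr 2
  ext i : 1
  rw [facetReflection_eq]

theorem map_facet_eq (g : V ≃ᵃⁱ[ℝ] V) (i : Fin (n + 1)) (x : V) :
    x ∈ (facet T i).map g.toAffineMap ↔ ev (act g (root T i)) x = 0 := by
  obtain ⟨y, rfl⟩ := g.surjective x
  rw [ev_act_apply, ← mem_facet]
  constructor
  · rintro ⟨z, hz, hzy⟩
    have : z = y := g.injective hzy
    rwa [← this]
  · intro h
    exact ⟨y, h, rfl⟩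

theorem exists_interior : ∃ p, ∀ i, 0 < ev (root T i) p := by
  have hw : ∑ _i : Fin (n + 1), (1 / (n + 1 : ℝ)) = 1 := by
    simp; field_simp
  refine ⟨∑ i, (1 / (n + 1 : ℝ)) • T.points i, fun i => ?_⟩
  rw [weights_eq T hw]
  have := T.height_pos i
  positivity

theorem exists_region_bound (p : V) : ∃ R, 0 ≤ R ∧ ∀ x ∈ region (root T), ‖x - p‖ ≤ R := by
  refine ⟨∑ i, ‖T.points i - p‖, Finset.sum_nonneg fun _ _ => norm_nonneg _, fun x hx => ?_⟩
  have hs := sum_ev_root T x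
  have hx' : x - p = ∑ i, (ev (root T i) x / T.height i) • (T.points i - p) := by
    simp only [smul_sub, Finset.sum_sub_distrib, ← Finset.sum_smul, hs, one_smul]
    rw [← eq_sum_points T x]
  rw [hx']
  refine (norm_sum_le _ _).trans (Finset.sum_le_sum fun i _ => ?_)
  have h0 : ∀ j, 0 ≤ ev (root T j) x / T.height j := fun j => div_nonneg (hx j) (T.height_pos j).le
  have h1 : ev (root T i) x / T.height i ≤ 1 := by
    rw [← hs]; exact Finset.single_le_sum (fun j _ => h0 j) (Finset.mem_univ i)
  rw [norm_smul, Real.norm_eq_abs, abs_of_nonneg (h0 i)]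
  exact mul_le_of_le_one_left (norm_nonneg _) h1

/-- The image of a simplex under an isometry. -/
noncomputable def move (g : V ≃ᵃⁱ[ℝ] V) (T : Affine.Simplex ℝ V n) : Affine.Simplex ℝ V n :=
  T.map g.toAffineEquiv.toAffineMap g.injective

@[simp] theorem move_points (g : V ≃ᵃⁱ[ℝ] V) (i : Fin (n + 1)) :
    (move g T).points i = g (T.points i) := rfl

theorem root_move (g : V ≃ᵃⁱ[ℝ] V) (i : Fin (n + 1)) : root (move g T) i = act g (root T i) := by
  refine (eq_root _ (by rw [norm_act, norm_root]) (fun j hj => ?_) ?_).symm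
  · rw [move_points, ev_act_apply, ev_root_of_ne T hj]
  · rw [move_points, ev_act_apply, ev_root_self]; exact T.height_pos i

theorem root_reindex (e : Fin (n + 1) ≃ Fin (n + 1)) (i : Fin (n + 1)) :
    root (T.reindex e) i = root T (e.symm i) := by
  refine (eq_root _ (norm_root _ _) (fun j hj => ?_) ?_).symm
  · rw [Affine.Simplex.reindex_points, Function.comp_apply]
    exact ev_root_of_ne T (by simpa using hj)
  · rw [Affine.Simplex.reindex_points, Function.comp_apply, ev_root_self]; exact T.height_pos _

theorem reflGroup_move (g : V ≃ᵃⁱ[ℝ] V) (x : V ≃ᵃⁱ[ℝ] V) :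
    x ∈ reflGroup (move g T) ↔ g⁻¹ * x * g ∈ reflGroup T := by
  have key : ∀ (g : V ≃ᵃⁱ[ℝ] V) (T : Affine.Simplex ℝ V n) (x : V ≃ᵃⁱ[ℝ] V),
      x ∈ reflGroup (move g T) → g⁻¹ * x * g ∈ reflGroup T := by
    intro g T x hx
    rw [← gp_root] at hx ⊢
    induction hx using Subgroup.closure_induction with
    | mem r hr =>
      obtain ⟨i, rfl⟩ := hr
      simp only [root_move, refl_act g (norm_root T i)]
      have := refl_mem_gp (root T) i
      convert this using 1
      group
    | one => simp [one_mem]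
    | mul a b _ _ ha hb => convert mul_mem ha hb using 1; group
    | inv a _ ha => convert inv_mem ha using 1; group
  refine ⟨key g T x, fun h => ?_⟩
  have h2 := key g⁻¹ (move g T) (g⁻¹ * x * g) (by
    have : move g⁻¹ (move g T) = T := by
      refine Affine.Simplex.ext fun i => ?_
      simp
    rwa [this])
  convert h2 using 1
  group

theorem reflGroup_move_of_mem {g : V ≃ᵃⁱ[ℝ] V} (hg : g ∈ reflGroup T) :
    reflGroup (move g T) = reflGroup T := by
  ext x
  rw [reflGroup_move, Subgroup.mul_mem_cancel_right _ hg, Subgroup.mul_mem_cancel_left _ (inv_mem hg)]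

theorem reflGroup_reindex (e : Fin (n + 1) ≃ Fin (n + 1)) :
    reflGroup (T.reindex e) = reflGroup T := by
  rw [← gp_root, ← gp_root]
  unfold gp
  congr 1
  ext r
  simp only [Set.mem_range, root_reindex]
  exact ⟨fun ⟨i, h⟩ => ⟨_, h⟩, fun ⟨i, h⟩ => ⟨e i, by simpa using h⟩⟩

/-- The image of a simplex under a dilation. -/
noncomputable def dilate (v : V) (r : ℝ) (hr : 0 < r) (T : Affine.Simplex ℝ V n) :
    Affine.Simplex ℝ V n :=
  T.map (AffineMap.homothety v r) (fun x y h => by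
    simpa [AffineMap.homothety_apply, hr.ne'] using h)

theorem dilate_points (v : V) (r : ℝ) (hr : 0 < r) (i : Fin (n + 1)) :
    (dilate v r hr T).points i = AffineMap.homothety v r (T.points i) := rfl

theorem root_dilate (v : V) (r : ℝ) (hr : 0 < r) (i : Fin (n + 1)) :
    root (dilate v r hr T) i = ((root T i).1, r * ev (root T i) v - ⟪(root T i).1, v⟫) := by
  have key : ∀ x, ev ((root T i).1, r * ev (root T i) v - ⟪(root T i).1, v⟫)
      (AffineMap.homothety v r x) = r * ev (root T i) x := by
    intro x
    simp only [ev, AffineMap.homothety_apply, vsub_eq_sub, vadd_eq_add, inner_add_right,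
      real_inner_smul_right, inner_sub_right]
    ring
  symm
  refine eq_root (dilate v r hr T)
    (a := ((root T i).1, r * ev (root T i) v - ⟪(root T i).1, v⟫)) (norm_root T i)
    (fun j hj => ?_) ?_
  · rw [dilate_points, key, ev_root_of_ne T hj, mul_zero]
  · rw [dilate_points, key, ev_root_self]; exact mul_pos hr (T.height_pos i)

/-- The cosine is injective on [0, π], which contains both angles. The entry 0 gives π / 0 = 0, the
angle of parallel facets. From here on a diagram is handled through its Gram matrix alone. -/
theorem matchesDiagram_iff {B : Type} (M : CoxeterMatrix B) (σ : Fin (n + 1) ≃ B) :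
    MatchesDiagram T M σ ↔
      ∀ i j, ⟪(root T i).1, (root T j).1⟫ = -Real.cos (π / (M (σ i) (σ j) : ℝ)) := by
  unfold MatchesDiagram
  refine forall₂_congr fun i j => ?_
  rw [inner_root, neg_inj]
  refine ⟨fun h => by rw [h], fun h => ?_⟩
  refine Real.injOn_cos ⟨?_, ?_⟩ ⟨?_, ?_⟩ h
  · rw [dihedralAngle]; linarith [InnerProductGeometry.angle_le_pi (T.points i - T.altitudeFoot i)
      (T.points j - T.altitudeFoot j)]
  · rw [dihedralAngle]; linarith [InnerProductGeometry.angle_nonneg (T.points i - T.altitudeFoot i)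
      (T.points j - T.altitudeFoot j)]
  · positivity
  · rcases Nat.eq_zero_or_pos (M (σ i) (σ j)) with h | h
    · simp [h, Real.pi_pos.le]
    · exact div_le_self Real.pi_pos.le (by exact_mod_cast h)

theorem isCoxFamily_root (hT : IsCoxeter T) : IsCoxFamily (root T) := by
  obtain ⟨M, σ, h⟩ := hT
  refine ⟨norm_root T, fun i j hij => ⟨M (σ i) (σ j), ?_, (matchesDiagram_iff T M σ).1 h i j⟩⟩
  exact M.off_diagonal _ _ (by simpa using hij)

theorem SameDiagram.isCoxeter {P F : Affine.Simplex ℝ V n} (h : SameDiagram P F) :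
    IsCoxeter P ∧ IsCoxeter F := by
  obtain ⟨M, h1, h2⟩ := h
  exact ⟨⟨M, h1⟩, ⟨M, h2⟩⟩

theorem SameDiagram.exists_equiv {P F : Affine.Simplex ℝ V n} (h : SameDiagram P F) :
    ∃ τ : Fin (n + 1) ≃ Fin (n + 1), ∀ i j,
      ⟪(root P i).1, (root P j).1⟫ = ⟪(root F (τ i)).1, (root F (τ j)).1⟫ := by
  obtain ⟨M, ⟨σ, h1⟩, ⟨ρ, h2⟩⟩ := h
  refine ⟨σ.trans ρ.symm, fun i j => ?_⟩
  rw [(matchesDiagram_iff P M σ).1 h1, (matchesDiagram_iff F M ρ).1 h2]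
  simp

theorem isCoxeter_of_gram {T T' : Affine.Simplex ℝ V n} (hT : IsCoxeter T)
    (e : Fin (n + 1) ≃ Fin (n + 1))
    (h : ∀ i j, ⟪(root T' i).1, (root T' j).1⟫ = ⟪(root T (e i)).1, (root T (e j)).1⟫) :
    IsCoxeter T' := by
  obtain ⟨M, σ, h1⟩ := hT
  refine ⟨M, e.trans σ, (matchesDiagram_iff T' M _).2 fun i j => ?_⟩
  rw [h, (matchesDiagram_iff T M σ).1 h1]
  rfl

end Simplex

/-! ### Normals of mirrors, simple systems and special points. -/

/-- The unit normals of the mirrors of a group of isometries. -/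
def normals (G : Subgroup (V ≃ᵃⁱ[ℝ] V)) : Set V := {u | ‖u‖ = 1 ∧ ∃ c : ℝ, refl (u, c) ∈ G}

/-- A point is special if every mirror of the group is parallel to a mirror through it. -/
def IsSpecial (G : Subgroup (V ≃ᵃⁱ[ℝ] V)) (v : V) : Prop := ∀ u ∈ normals G, refl (rt u v) ∈ G

section Normals

variable {G : Subgroup (V ≃ᵃⁱ[ℝ] V)}

theorem linear_mem_normals {g : V ≃ᵃⁱ[ℝ] V} (hg : g ∈ G) {u : V} (hu : u ∈ normals G) :
    g.linearIsometryEquiv u ∈ normals G := by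
  obtain ⟨h1, c, hc⟩ := hu
  refine ⟨by simpa using h1, (act g (u, c)).2, ?_⟩
  have : (g.linearIsometryEquiv u, (act g (u, c)).2) = act g (u, c) := rfl
  rw [this, refl_act g h1]
  exact mul_mem (mul_mem hg hc) (inv_mem hg)

theorem mem_normals_of_refl_mem {a : V × ℝ} (ha : ‖a.1‖ = 1) (h : refl a ∈ G) : a.1 ∈ normals G :=
  ⟨ha, a.2, h⟩

theorem reflect_mem_normals {u w : V} (hu : u ∈ normals G) (hw : w ∈ normals G) :
    w - (2 * ⟪u, w⟫) • u ∈ normals G := by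
  obtain ⟨h1, c, hc⟩ := hu
  have h2 := linear_mem_normals hc hw
  have h3 := congrArg Prod.fst (act_refl (a := (u, c)) h1 (w, 0))
  simp only [Prod.fst_sub, Prod.smul_fst] at h3
  rw [← h3]
  exact h2

theorem act_rt_apply (g : V ≃ᵃⁱ[ℝ] V) (u v : V) :
    act g (rt u v) = rt (g.linearIsometryEquiv u) (g v) :=
  eq_rt (a := act g (rt u v)) (by rw [ev_act_apply, ev_rt, sub_self, inner_zero_right])

theorem IsSpecial.apply {v : V} (hv : IsSpecial G v) {g : V ≃ᵃⁱ[ℝ] V} (hg : g ∈ G) :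
    IsSpecial G (g v) := by
  intro u hu
  have h1 := linear_mem_normals (inv_mem hg) hu
  have h2 : rt u (g v) = act g (rt (g⁻¹.linearIsometryEquiv u) v) := by
    rw [act_rt_apply]
    congr 1
    exact (g.linearIsometryEquiv.apply_symm_apply u).symm
  rw [h2, refl_act g h1.1]
  exact mul_mem (mul_mem hg (hv _ h1)) (inv_mem hg)

/-- For mirrors through a common point, reflecting a normal amounts to conjugating the reflection.
This propagates specialness from a simple system to all normals. -/
theorem refl_rt_reflect {b u v : V} (hb : ‖b‖ = 1) (hu : ‖u‖ = 1) :
    refl (rt (u - (2 * ⟪b, u⟫) • b) v) = refl (rt b v) * refl (rt u v) * (refl (rt b v))⁻¹ := by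
  rw [← refl_act _ (by simpa using hu), act_refl (by simpa using hb)]
  congr 1
  apply ev_injective; intro x
  simp only [ev_rt, ev_sub, ev_smul, rt_fst, inner_sub_left, real_inner_smul_left]

end Normals

/-- A finite set of unit vectors that is stable under its reflections is generated by any simple
system. -/
theorem simple_system_induction {N : Set V} (hfin : N.Finite) (hunit : ∀ u ∈ N, ‖u‖ = 1)
    (hN : ∀ u ∈ N, ∀ w ∈ N, w - (2 * ⟪u, w⟫) • u ∈ N) {ι : Type*} [Fintype ι] {b : ι → V}
    (hb : LinearIndependent ℝ b) (hbN : ∀ i, b i ∈ N) {ξ : V} (hξ : ∀ i, 0 < ⟪ξ, b i⟫)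
    (hpos : ∀ u ∈ N, (∃ c : ι → ℝ, (∀ i, 0 ≤ c i) ∧ u = ∑ i, c i • b i) ∨
      ∃ c : ι → ℝ, (∀ i, 0 ≤ c i) ∧ -u = ∑ i, c i • b i)
    {Q : V → Prop} (hQb : ∀ i, Q (b i))
    (hQ : ∀ i, ∀ u ∈ N, Q u → Q (u - (2 * ⟪b i, u⟫) • b i)) : ∀ u ∈ N, Q u := by
  classical
  have hneg : ∀ u ∈ N, -u ∈ N := by
    intro u hu
    have := hN u hu u hu
    rwa [real_inner_self_eq_norm_sq, hunit u hu, show u - (2 * (1 : ℝ) ^ 2) • u = -u by module]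
      at this
  have hQneg : ∀ i, Q (-b i) := by
    intro i
    have := hQ i (b i) (hbN i) (hQb i)
    rwa [real_inner_self_eq_norm_sq, hunit _ (hbN i),
      show b i - (2 * (1 : ℝ) ^ 2) • b i = -b i by module] at this
  have hinv : ∀ i u, (u - (2 * ⟪b i, u⟫) • b i) -
      (2 * ⟪b i, u - (2 * ⟪b i, u⟫) • b i⟫) • b i = u := by
    intro i u
    rw [inner_sub_right, real_inner_smul_right, real_inner_self_eq_norm_sq, hunit _ (hbN i)]
    module
  let P : Set V := {u | u ∈ N ∧ ∃ c : ι → ℝ, (∀ i, 0 ≤ c i) ∧ u = ∑ i, c i • b i}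
  suffices h : ∀ u ∈ P, Q u ∧ Q (-u) by
    intro u hu
    rcases hpos u hu with hc | hc
    · exact (h u ⟨hu, hc⟩).1
    · simpa using (h (-u) ⟨hneg u hu, hc⟩).2
  by_contra hcon
  push Not at hcon
  -- A counterexample of least height with respect to ξ. Treating u and -u together lets the
  -- induction run over positive vectors only.
  obtain ⟨u, ⟨⟨huN, c, hc, hcu⟩, huQ⟩, hmin⟩ := Set.exists_min_image
    {u | u ∈ P ∧ (Q u → ¬ Q (-u))} (fun u => ⟪ξ, u⟫) (hfin.subset fun u hu => hu.1.1) hcon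
  have h1 : 0 < ∑ i, c i * ⟪b i, u⟫ := by
    have : ∑ i, c i * ⟪b i, u⟫ = ⟪∑ i, c i • b i, u⟫ := by
      simp [sum_inner, real_inner_smul_left]
    rw [this, ← hcu, real_inner_self_eq_norm_sq, hunit u huN]; norm_num
  -- Since u is a nonnegative combination of simple vectors with positive norm, it makes an acute
  -- angle with some simple vector. Reflecting in that vector lowers the height.
  obtain ⟨i, -, hi⟩ := Finset.exists_lt_of_sum_lt (s := Finset.univ) (f := fun _ : ι => (0 : ℝ))
    (by simpa using h1)
  have hbi : 0 < ⟪b i, u⟫ := by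
    by_contra hh
    push Not at hh
    nlinarith [hc i]
  have hu'N := hN _ (hbN i) u huN
  rcases hpos _ hu'N with hc' | ⟨d, hd, hdu⟩
  · have hlt : ⟪ξ, u - (2 * ⟪b i, u⟫) • b i⟫ < ⟪ξ, u⟫ := by
      rw [inner_sub_right, real_inner_smul_right]
      have := mul_pos hbi (hξ i)
      linarith
    have hQ' : Q (u - (2 * ⟪b i, u⟫) • b i) ∧ Q (-(u - (2 * ⟪b i, u⟫) • b i)) := by
      by_contra hh
      exact absurd hlt (not_lt.2 (hmin _ ⟨⟨hu'N, hc'⟩, by tauto⟩))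
    have e1 := hQ i _ hu'N hQ'.1
    rw [hinv] at e1
    have e2 := hQ i _ (hneg _ hu'N) hQ'.2
    rw [inner_neg_right, mul_neg, neg_smul, sub_neg_eq_add, neg_add_eq_sub, ← neg_sub, hinv] at e2
    exact huQ e1 e2
  -- A reflection in a simple vector changes only one coefficient, so if it turns u negative, all
  -- other coefficients vanish and u is that simple vector.
  · have h2 : ∑ j, (c j + d j - if j = i then 2 * ⟪b i, u⟫ else 0) • b j = 0 := by
      simp only [sub_smul, add_smul, Finset.sum_sub_distrib, Finset.sum_add_distrib, ← hcu, ← hdu,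
        ite_smul, zero_smul, Finset.sum_ite_eq', Finset.mem_univ, if_true]
      module
    have h3 := Fintype.linearIndependent_iff.1 hb _ h2
    have h4 : ∀ j ≠ i, c j = 0 := by
      intro j hj
      have := h3 j
      rw [if_neg hj] at this
      linarith [hc j, hd j]
    rw [Finset.sum_eq_single i (fun j _ hj => by rw [h4 j hj, zero_smul]) (by simp)] at hcu
    have h5 : c i = 1 := by
      have := hunit u huN
      rwa [hcu, norm_smul, hunit _ (hbN i), mul_one, Real.norm_eq_abs, abs_of_nonneg (hc i)] at this
    rw [h5, one_smul] at hcu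
    rw [hcu] at huQ
    exact huQ (hQb i) (hQneg i)

open scoped NNReal in
/-- Existence of simple systems. -/
theorem exists_simple_system [FiniteDimensional ℝ V] {N : Set V} (hfin : N.Finite)
    (hunit : ∀ u ∈ N, ‖u‖ = 1) (hN : ∀ u ∈ N, ∀ w ∈ N, w - (2 * ⟪u, w⟫) • u ∈ N) :
    ∃ (D : Finset V) (ξ : V), (∀ b ∈ D, b ∈ N) ∧ (∀ b ∈ D, 0 < ⟪ξ, b⟫) ∧
      LinearIndependent ℝ (fun b : D => (b : V)) ∧
      ∀ u ∈ N, (∃ c : D → ℝ, (∀ i, 0 ≤ c i) ∧ u = ∑ i, c i • (i : V)) ∨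
        ∃ c : D → ℝ, (∀ i, 0 ≤ c i) ∧ -u = ∑ i, c i • (i : V) := by
  classical
  have hneg : ∀ u ∈ N, -u ∈ N := by
    intro u hu
    have := hN u hu u hu
    rwa [real_inner_self_eq_norm_sq, hunit u hu, show u - (2 * (1 : ℝ) ^ 2) • u = -u by module]
      at this
  have := hfin.to_subtype
  -- A generic functional separates N into positive and negative vectors. The simple system D is a
  -- smallest set of positive vectors whose nonnegative combinations contain all of them.
  obtain ⟨f, hf⟩ := Module.exists_dual_forall_apply_ne_zero (K := ℝ) (fun u : N => (u : V))
    (fun u h => by have := hunit u u.2; simp [h] at this)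
  obtain ⟨ξ, hξ⟩ : ∃ ξ : V, ∀ x, f x = ⟪ξ, x⟫ :=
    ⟨(InnerProductSpace.toDual ℝ V).symm f.toContinuousLinearMap, fun x => by simp⟩
  have hξ0 : ∀ u ∈ N, ⟪ξ, u⟫ ≠ 0 := fun u hu => by rw [← hξ]; exact hf ⟨u, hu⟩
  let P : Finset V := hfin.toFinset.filter fun u => 0 < ⟪ξ, u⟫
  have hP : ∀ u, u ∈ P ↔ u ∈ N ∧ 0 < ⟪ξ, u⟫ := by simp [P]
  obtain ⟨D, hD, hmin⟩ := Finset.exists_min_image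
    (P.powerset.filter fun D : Finset V => ∀ u ∈ P, u ∈ Submodule.span ℝ≥0 (D : Set V)) Finset.card
    ⟨P, by simpa using fun u (hu : u ∈ P) => Submodule.subset_span (R := ℝ≥0) (Finset.mem_coe.2 hu)⟩
  simp only [Finset.mem_filter, Finset.mem_powerset, and_imp] at hD hmin
  obtain ⟨hDP, hDs⟩ := hD
  have hnonneg : ∀ (s : Set V), s ⊆ P → ∀ z ∈ Submodule.span ℝ≥0 s, 0 ≤ ⟪ξ, z⟫ := by
    intro s hs z hz
    induction hz using Submodule.span_induction with
    | mem x hx => exact ((hP x).1 (hs hx)).2.le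
    | zero => simp
    | add x y _ _ hx hy => rw [inner_add_right]; positivity
    | smul a x _ hx => rw [NNReal.smul_def, real_inner_smul_right]; positivity
  have hirr : ∀ β ∈ D, β ∉ Submodule.span ℝ≥0 ((D.erase β : Finset V) : Set V) := by
    intro β hβ hβs
    have h1 := hmin (D.erase β) ((Finset.erase_subset _ _).trans hDP) (by
      intro u hu
      have := hDs u hu
      rwa [← Finset.insert_erase hβ, Finset.coe_insert, Submodule.span_insert_eq_span hβs] at this)
    exact absurd (Finset.card_erase_lt_of_mem hβ) (not_lt.2 h1)
  -- a vector of `D` which is, up to a positive multiple, a combination of the others is redundant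
  have hred : ∀ β ∈ D, ∀ r : ℝ, ∀ z ∈ Submodule.span ℝ≥0 ((D.erase β : Finset V) : Set V),
      r • β = z → 0 < ⟪ξ, z⟫ → False := by
    intro β hβ r z hz hr hz0
    have hr0 : 0 < r := by
      rw [← hr, real_inner_smul_right] at hz0
      exact pos_of_mul_pos_left hz0 ((hP β).1 (hDP hβ)).2.le
    refine hirr β hβ ?_
    have h2 : Real.toNNReal r⁻¹ • z = β := by
      rw [NNReal.smul_def, Real.coe_toNNReal _ (by positivity), ← hr, smul_smul,
        inv_mul_cancel₀ hr0.ne', one_smul]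
    have h3 := Submodule.smul_mem _ (Real.toNNReal r⁻¹) hz
    rwa [h2] at h3
  have hsub : ∀ β, ((D.erase β : Finset V) : Set V) ⊆ P := fun β x hx =>
    hDP (Finset.mem_of_mem_erase hx)
  -- If two vectors of D formed an acute angle, the reflection of β in α would be positive or
  -- negative, and expanding it or its opposite over D would make β or α redundant.
  have hobt : ∀ α ∈ D, ∀ β ∈ D, α ≠ β → ⟪α, β⟫ ≤ 0 := by
    intro α hα β hβ hne
    by_contra hk
    push Not at hk
    have hαN := ((hP α).1 (hDP hα))
    have hβN := ((hP β).1 (hDP hβ))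
    have hγ := hN α hαN.1 β hβN.1
    rcases lt_or_gt_of_ne (hξ0 _ hγ) with h | h
    · have h1 : (2 * ⟪α, β⟫) • α - β ∈ P := by
        rw [hP]
        refine ⟨by simpa using hneg _ hγ, ?_⟩
        rw [← neg_sub, inner_neg_right]; linarith
      have h2 := hDs _ h1
      rw [← Finset.insert_erase hα, Finset.coe_insert, Submodule.mem_span_insert] at h2
      obtain ⟨c, z, hz, hcz⟩ := h2
      rw [NNReal.smul_def] at hcz
      refine hred α hα (2 * ⟪α, β⟫ - c) (β + z) (Submodule.add_mem _ (Submodule.subset_span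
        (Finset.mem_coe.2 (Finset.mem_erase.2 ⟨hne.symm, hβ⟩))) hz) ?_ ?_
      · rw [sub_smul, sub_eq_iff_eq_add, add_assoc, add_comm z, ← hcz]; abel
      · rw [inner_add_right]
        linarith [hnonneg _ (hsub α) z hz, hβN.2]
    · have h1 : β - (2 * ⟪α, β⟫) • α ∈ P := (hP _).2 ⟨hγ, h⟩
      have h2 := hDs _ h1
      rw [← Finset.insert_erase hβ, Finset.coe_insert, Submodule.mem_span_insert] at h2
      obtain ⟨c, z, hz, hcz⟩ := h2
      rw [NNReal.smul_def] at hcz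
      refine hred β hβ (1 - c) (z + (2 * ⟪α, β⟫) • α) (Submodule.add_mem _ hz ?_) ?_ ?_
      · have : (2 * ⟪α, β⟫) • α = Real.toNNReal (2 * ⟪α, β⟫) • α := by
          rw [NNReal.smul_def, Real.coe_toNNReal _ (by positivity)]
        rw [this]
        exact Submodule.smul_mem _ _ (Submodule.subset_span
          (Finset.mem_coe.2 (Finset.mem_erase.2 ⟨hne, hα⟩)))
      · rw [sub_smul, one_smul, sub_eq_iff_eq_add, add_right_comm, add_comm z, ← hcz]; abel
      · rw [inner_add_right, real_inner_smul_right]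
        have := hnonneg _ (hsub β) z hz
        have := mul_pos (mul_pos two_pos hk) hαN.2
        linarith
  have hcoef : ∀ u ∈ Submodule.span ℝ≥0 (D : Set V),
      ∃ c : D → ℝ, (∀ i, 0 ≤ c i) ∧ u = ∑ i, c i • (i : V) := by
    intro u hu
    induction hu using Submodule.span_induction with
    | mem x hx =>
      refine ⟨fun i => if i = ⟨x, hx⟩ then 1 else 0, fun i => by dsimp only; split_ifs <;> norm_num, ?_⟩
      simp
    | zero => exact ⟨0, by simp, by simp⟩
    | add x y _ _ hx hy =>
      obtain ⟨c, hc, rfl⟩ := hx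
      obtain ⟨d, hd, rfl⟩ := hy
      exact ⟨c + d, fun i => add_nonneg (hc i) (hd i), by simp [add_smul, Finset.sum_add_distrib]⟩
    | smul a x _ hx =>
      obtain ⟨c, hc, rfl⟩ := hx
      refine ⟨fun i => a * c i, fun i => mul_nonneg a.2 (hc i), ?_⟩
      simp [NNReal.smul_def, Finset.smul_sum, smul_smul]
  refine ⟨D, ξ, fun b hb => ((hP b).1 (hDP hb)).1, fun b hb => ((hP b).1 (hDP hb)).2, ?_, ?_⟩
  -- Vectors in an open half-space with pairwise nonpositive inner products are linearly
  -- independent.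
  · refine LinearMap.BilinForm.linearIndependent_of_pairwise_le_zero (innerₗ V) ?_ f _ ?_ ?_
    · intro x hx
      have : 0 < ‖x‖ := norm_pos_iff.2 hx
      simp only [LinearMap.BilinMap.toQuadraticMap_apply, innerₗ_apply_apply,
        real_inner_self_eq_norm_sq]
      positivity
    · intro i
      rw [hξ]; exact ((hP _).1 (hDP i.2)).2
    · intro i j hij
      exact hobt _ i.2 _ j.2 (fun h => hij (Subtype.ext h))
  · intro u hu
    rcases lt_or_gt_of_ne (hξ0 u hu) with h | h
    · right
      exact hcoef _ (hDs _ ((hP _).2 ⟨hneg u hu, by rw [inner_neg_right]; linarith⟩))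
    · left
      exact hcoef _ (hDs _ ((hP _).2 ⟨hu, h⟩))

theorem exists_common_zero [FiniteDimensional ℝ V] {ι : Type*} [Finite ι] {b : ι → V}
    (hb : LinearIndependent ℝ b) (c : ι → ℝ) : ∃ v, ∀ i, ⟪b i, v⟫ = c i := by
  let B := Basis.span hb
  obtain ⟨f, hf⟩ := (B.constr ℝ c).exists_extend
  refine ⟨(InnerProductSpace.toDual ℝ V).symm f.toContinuousLinearMap, fun i => ?_⟩
  rw [real_inner_comm, InnerProductSpace.toDual_symm_apply]
  have h1 := congrArg (fun g => g (B i)) hf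
  have h2 : ((B i : Submodule.span ℝ (Set.range b)) : V) = b i := by
    simp only [B, Basis.span_apply]
  simpa [h2] using h1

section Simplex

variable {n : ℕ} [NeZero n] (T : Affine.Simplex ℝ V n)
variable [FiniteDimensional ℝ V] [hV : Fact (finrank ℝ V = n)]

theorem root_mem_normals (i : Fin (n + 1)) : (root T i).1 ∈ normals (reflGroup T) := by
  refine mem_normals_of_refl_mem (norm_root T i) ?_
  rw [← gp_root]; exact refl_mem_gp _ i

/-- The unit sphere is compact, so it suffices to separate normals. Mirrors with nearby distinct
normals meet, and the product of their reflections is a rotation by a small angle about a common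
point. Moving this point into the fundamental simplex makes the rotation displace p by little, so it
is trivial by discreteness. -/
theorem finite_normals (hT : IsCoxeter T) : (normals (reflGroup T)).Finite := by
  have hA := isCoxFamily_root T hT
  obtain ⟨p, hp⟩ := exists_interior T
  obtain ⟨ε, hε, hsep⟩ := exists_separation hA hp
  obtain ⟨R, hR0, hR⟩ := exists_region_bound T p
  have := FiniteDimensional.proper ℝ V
  -- The rotation displaces the point by at most 4R‖u - u'‖, which is then below ε. The bound 1
  -- excludes u = -u', since opposite unit vectors are at distance 2.
  have hδ : 0 < min (ε / (4 * R + 4)) 1 := lt_min (by positivity) one_pos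
  refine finite_of_bounded_of_separated
    ((Metric.isBounded_sphere (x := (0 : V)) (r := 1)).subset fun u hu => by simpa using hu.1) hδ ?_
  rintro u ⟨hu, c, hc⟩ u' ⟨hu', c', hc'⟩ hd
  by_contra hne
  rw [dist_eq_norm, lt_min_iff] at hd
  obtain ⟨hd1, hd2⟩ := hd
  have hne' : u ≠ -u' := by
    rintro rfl
    have : ‖-u' - u'‖ = 2 := by
      rw [show -u' - u' = (-2 : ℝ) • u' by module, norm_smul, hu']; norm_num
    rw [this] at hd2; norm_num at hd2
  set k := ⟪u, u'⟫ with hk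
  have hk1 : 1 - k ^ 2 ≠ 0 := by
    intro h
    have h1 : (1 - k) * (1 + k) = 0 := by linarith
    rcases mul_eq_zero.1 h1 with h | h
    · exact hne ((inner_eq_one_iff_of_norm_eq_one (𝕜 := ℝ) hu hu').1 (by linarith))
    · refine hne' ((inner_eq_one_iff_of_norm_eq_one (𝕜 := ℝ) hu (by simpa using hu')).1 ?_)
      rw [inner_neg_right]; linarith
  obtain ⟨y, hy, hy'⟩ : ∃ y, ev (u, c) y = 0 ∧ ev (u', c') y = 0 := by
    refine ⟨((-c + k * c') / (1 - k ^ 2)) • u + ((-c' + k * c) / (1 - k ^ 2)) • u', ?_, ?_⟩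
    · simp only [ev, inner_add_right, real_inner_smul_right, real_inner_self_eq_norm_sq, hu, ← hk]
      field_simp; ring
    · simp only [ev, inner_add_right, real_inner_smul_right, real_inner_self_eq_norm_sq, hu',
        real_inner_comm u u', ← hk]
      field_simp; ring
  obtain ⟨g, hg, hgy⟩ := exists_apply_mem_region hA hp y
  rw [← gp_root] at hc hc'
  set q := g⁻¹ p with hq
  have hz : ‖q - y‖ ≤ R := by
    have h1 := hR _ hgy
    have h2 : dist q y = dist (g y) p := by
      rw [hq, ← g.dist_map, dist_comm]; simp
    rw [← dist_eq_norm, h2, dist_eq_norm]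
    exact h1
  have hr := hsep (g * (refl (u, c) * refl (u', c')) * g⁻¹)
    (mul_mem (mul_mem hg (mul_mem hc hc')) (inv_mem hg)) (by
      have e1 : ‖(g * (refl (u, c) * refl (u', c')) * g⁻¹) p - p‖ =
          ‖refl (u', c') q - refl (u, c) q‖ := by
        have e2 : p = g q := by simp [hq]
        rw [← dist_eq_norm, ← dist_eq_norm]
        have e3 : (g * (refl (u, c) * refl (u', c')) * g⁻¹) p =
          g (refl (u, c) (refl (u', c') q)) := rfl
        have e4 : refl (u, c) (refl (u, c) q) = q := by
          have := congrArg (fun f => f q) (refl_mul_self (a := (u, c)) hu)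
          simpa using this
        rw [e3]
        conv_lhs => rw [e2, g.dist_map, ← e4, AffineIsometryEquiv.dist_map]
        rw [e4]
      rw [e1, refl_apply (a := (u, c)) hu, refl_apply (a := (u', c')) hu']
      have e5 : ev (u, c) q = ⟪u, q - y⟫ := by rw [← ev_sub_ev (u, c), hy, sub_zero]
      have e6 : ev (u', c') q = ⟪u', q - y⟫ := by rw [← ev_sub_ev (u', c'), hy', sub_zero]
      rw [e5, e6]
      have e7 : q - (2 * ⟪u', q - y⟫) • u' - (q - (2 * ⟪u, q - y⟫) • u) =
          (2 : ℝ) • (⟪u - u', q - y⟫ • u + ⟪u', q - y⟫ • (u - u')) := by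
        rw [inner_sub_left]; module
      rw [e7, norm_smul]
      have e8 : ‖⟪u - u', q - y⟫ • u‖ ≤ ‖u - u'‖ * R := by
        rw [norm_smul, hu, mul_one]
        exact (norm_inner_le_norm _ _).trans (by gcongr)
      have e9 : ‖⟪u', q - y⟫ • (u - u')‖ ≤ R * ‖u - u'‖ := by
        rw [norm_smul]
        gcongr
        refine (norm_inner_le_norm _ _).trans ?_
        rw [hu', one_mul]; exact hz
      have e10 := norm_add_le (⟪u - u', q - y⟫ • u) (⟪u', q - y⟫ • (u - u'))
      rw [lt_div_iff₀ (by positivity)] at hd1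
      have : ‖(2 : ℝ)‖ = 2 := by norm_num
      rw [this]
      nlinarith [norm_nonneg (u - u')])
  have h1 : refl (u, c) * refl (u', c') = 1 := by
    rw [mul_inv_eq_one] at hr
    exact mul_eq_left.1 hr
  rw [mul_eq_one_iff_eq_inv, refl_inv (a := (u', c')) hu'] at h1
  rcases refl_mem_inj (a := (u, c)) (b := (u', c')) hu hu' h1 with h | h
  · exact hne (congrArg Prod.fst h)
  · exact hne' (congrArg Prod.fst h)

/-- Linearly independent simple normals allow a common point on one mirror for each of them.
Conjugation by these reflections produces a mirror through that point for every other normal. -/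
theorem exists_special (hT : IsCoxeter T) : ∃ v, IsSpecial (reflGroup T) v := by
  set G := reflGroup T
  have hfin := finite_normals T hT
  have hunit : ∀ u ∈ normals G, ‖u‖ = 1 := fun u hu => hu.1
  have hN : ∀ u ∈ normals G, ∀ w ∈ normals G, w - (2 * ⟪u, w⟫) • u ∈ normals G :=
    fun u hu w hw => reflect_mem_normals hu hw
  obtain ⟨D, ξ, hDN, hξ, hli, hpos⟩ := exists_simple_system hfin hunit hN
  have hc : ∀ b : D, ∃ c : ℝ, refl ((b : V), c) ∈ G := fun b => (hDN b b.2).2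
  choose c hc using hc
  obtain ⟨v, hv⟩ := exists_common_zero hli fun b => -c b
  have hb : ∀ b : D, refl (rt (b : V) v) ∈ G := by
    intro b
    have : rt (b : V) v = ((b : V), c b) := by rw [rt, hv, neg_neg]
    rw [this]; exact hc b
  refine ⟨v, simple_system_induction hfin hunit hN hli (fun b => hDN b b.2) (fun b => hξ b b.2)
    hpos (Q := fun u => refl (rt u v) ∈ G) hb fun b u hu hQ => ?_⟩
  rw [refl_rt_reflect (hunit _ (hDN b b.2)) (hunit u hu)]
  exact mul_mem (mul_mem (hb b) hQ) (inv_mem (hb b))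

/-- The special points in the closed fundamental simplex are vertices. -/
theorem eq_vertex_of_isSpecial (hT : IsCoxeter T) {x : V} (hx : x ∈ region (root T))
    (hs : IsSpecial (reflGroup T) x) : ∃ i, x = T.points i := by
  have hA := isCoxFamily_root T hT
  obtain ⟨i0, hi0⟩ : ∃ i, ev (root T i) x ≠ 0 := by
    by_contra h
    push Not at h
    have := sum_ev_root T x
    simp [h] at this
  refine ⟨i0, eq_point_of_ev_root T fun i1 hi1 => ?_⟩
  by_contra hne
  -- If x lies off two facets, the edge between the opposite vertices is parallel to every facet
  -- through x, so the stabilizer of x fixes x + y. Specialness puts the mirror through x of each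
  -- facet direction in this stabilizer. Thus y is orthogonal to all normals, which is impossible.
  set y := T.points i1 - T.points i0 with hy
  have hort : ∀ j, j ≠ i0 → j ≠ i1 → ⟪(root T j).1, y⟫ = 0 := by
    intro j h0 h1
    rw [hy, ← ev_sub_ev, ev_root_of_ne T h0.symm, ev_root_of_ne T h1.symm, sub_zero]
  have hfix : ∀ g ∈ gpAt (root T) x, g (x + y) = x + y := by
    intro g hg
    induction hg using Subgroup.closure_induction with
    | mem r hr =>
      obtain ⟨j, hj, rfl⟩ := hr
      rw [refl_eq_self_iff (norm_root T j), ev_add_vec, hj, hort j (by rintro rfl; exact hi0 hj)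
        (by rintro rfl; exact hne hj), add_zero]
    | one => rfl
    | mul a b _ _ ha hb => rw [AffineIsometryEquiv.coe_mul, Function.comp_apply, hb, ha]
    | inv a _ ha => rw [AffineIsometryEquiv.coe_inv, AffineIsometryEquiv.symm_apply_eq, ha]
  have h2 : ∀ i, ev (root T i) (x + y) = ev (root T i) x := by
    intro i
    have h1 := hs _ (root_mem_normals T i)
    rw [← gp_root] at h1
    have h3 := refl_apply_rt (v := x) (norm_root T i)
    have h4 := hfix _ (eq_and_mem_gpAt hA h1 hx (by rw [h3]; exact hx)).2
    rw [refl_eq_self_iff (a := rt (root T i).1 x) (norm_root T i), ev_rt, add_sub_cancel_left] at h4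
    rw [ev_add_vec, h4, add_zero]
  have h5 := ext_of_ev_root T h2
  rw [add_eq_left, hy, sub_eq_zero] at h5
  exact hi1 (T.independent.injective h5)

theorem exists_special_vertex (hT : IsCoxeter T) : ∃ i, IsSpecial (reflGroup T) (T.points i) := by
  obtain ⟨v, hv⟩ := exists_special T hT
  have hA := isCoxFamily_root T hT
  obtain ⟨p, hp⟩ := exists_interior T
  obtain ⟨g, hg, hgv⟩ := exists_apply_mem_region hA hp v
  rw [gp_root] at hg
  obtain ⟨i, hi⟩ := eq_vertex_of_isSpecial T hT hgv (hv.apply hg)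
  exact ⟨i, hi ▸ hv.apply hg⟩

end Simplex

/-! ### Similarities, and simplices with the same Gram matrix. -/

/-- A similarity of a Euclidean space. -/
structure Sim (V : Type*) [NormedAddCommGroup V] [InnerProductSpace ℝ V] where
  /-- the linear isometry -/
  O : V ≃ₗᵢ[ℝ] V
  /-- the ratio -/
  r : ℝ
  hr : 0 < r
  /-- the image of the origin -/
  t : V

namespace Sim

variable (S : Sim V)

/-- The underlying map. -/
def map (x : V) : V := S.r • S.O x + S.t

/-- The inverse similarity. -/
noncomputable def symm : Sim V where
  O := S.O.symm
  r := S.r⁻¹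
  hr := inv_pos.2 S.hr
  t := -(S.r⁻¹ • S.O.symm S.t)

theorem map_symm_map (x : V) : S.map (S.symm.map x) = x := by
  have := S.hr.ne'
  simp [map, symm, smul_add, smul_smul, this]

theorem symm_map_map (x : V) : S.symm.map (S.map x) = x := by
  have := S.hr.ne'
  simp [map, symm, smul_add, smul_smul, this]

/-- The image of an affine function, rescaled to preserve norms of gradients. -/
noncomputable def push (a : V × ℝ) : V × ℝ := (S.O a.1, S.r * a.2 - ⟪S.O a.1, S.t⟫)

theorem ev_push (a : V × ℝ) (x : V) : ev (S.push a) (S.map x) = S.r * ev a x := by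
  simp only [ev, push, map, inner_add_right, real_inner_smul_right, LinearIsometryEquiv.inner_map_map]
  ring

theorem norm_push (a : V × ℝ) : ‖(S.push a).1‖ = ‖a.1‖ := by simp [push]

theorem refl_push {a : V × ℝ} (ha : ‖a.1‖ = 1) (x : V) :
    refl (S.push a) (S.map x) = S.map (refl a x) := by
  rw [refl_apply (by rw [norm_push, ha]), refl_apply ha, ev_push]
  simp only [map, push, map_sub, map_smul]
  module

theorem push_symm_push (a : V × ℝ) : S.symm.push (S.push a) = a := by
  apply ev_injective; intro x
  have h := S.symm.ev_push (S.push a) (S.map x)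
  rw [symm_map_map, ev_push] at h
  rw [h]
  have := S.hr.ne'
  simp [symm, this]

end Sim

section Simplex

variable {n : ℕ} [NeZero n] (T : Affine.Simplex ℝ V n)
variable [FiniteDimensional ℝ V] [hV : Fact (finrank ℝ V = n)]

/-- Pairing the relation with the edge from vertex j to vertex i leaves only these two terms. -/
theorem mul_height_eq {c : Fin (n + 1) → ℝ} (h : ∑ i, c i • (root T i).1 = 0) (i j : Fin (n + 1)) :
    c i * T.height i = c j * T.height j := by
  have key : ∀ k, ⟪∑ i, c i • (root T i).1, T.points k - T.points j⟫ =
      c k * T.height k - c j * T.height j := by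
    intro k
    simp only [sum_inner, real_inner_smul_left, ← ev_sub_ev, ev_root]
    simp [mul_sub]
  have := key i
  rw [h, inner_zero_left] at this
  linarith

theorem eq_zero_of_sum_root {c : Fin (n + 1) → ℝ} (h : ∑ i, c i • (root T i).1 = 0)
    {j : Fin (n + 1)} (hj : c j = 0) : c = 0 := by
  ext i
  have := mul_height_eq T h i j
  rw [hj, zero_mul] at this
  exact (mul_eq_zero.1 this).resolve_right (T.height_pos i).ne'

theorem eq_zero_of_orthogonal {i0 : Fin (n + 1)} {y : V}
    (h : ∀ i ≠ i0, ⟪(root T i).1, y⟫ = 0) : y = 0 := by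
  have := eq_point_of_ev_root T (x := T.points i0 + y) (i := i0) fun j hj => by
    rw [ev_add_vec, ev_root_of_ne T hj.symm, h j hj, add_zero]
  simpa using this

theorem linearIndependent_root : LinearIndependent ℝ (root T) := by
  rw [Fintype.linearIndependent_iff]
  intro c hc j
  have := congrArg (fun a => ev a (T.points j)) hc
  simp only [ev_sum, ev_smul, ev_zero, ev_root] at this
  simpa [(T.height_pos j).ne'] using this

theorem linearIndependent_normal (i0 : Fin (n + 1)) :
    LinearIndependent ℝ (fun i : {i // i ≠ i0} => (root T i).1) := by
  rw [Fintype.linearIndependent_iff]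
  intro c hc j
  let c' : Fin (n + 1) → ℝ := fun i => if h : i ≠ i0 then c ⟨i, h⟩ else 0
  have h1 : ∑ i, c' i • (root T i).1 = 0 := by
    rw [Fintype.sum_eq_add_sum_subtype_ne _ i0, ← hc]
    simp only [c', ne_eq, not_true_eq_false, dite_false, zero_smul, zero_add]
    exact Finset.sum_congr rfl fun x _ => by rw [dif_pos x.2]
  have h2 := congrFun (eq_zero_of_sum_root T h1 (j := i0) (by simp [c'])) j
  simpa [c', j.2] using h2

/-- A basis of normals. -/
noncomputable def normalBasis (i0 : Fin (n + 1)) : Basis {i // i ≠ i0} ℝ V :=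
  have : Nonempty {i // i ≠ i0} := by
    have : Nontrivial (Fin (n + 1)) :=
      Fin.nontrivial_iff_two_le.2 (by have := NeZero.pos n; omega)
    obtain ⟨j, hj⟩ := exists_ne i0
    exact ⟨⟨j, hj⟩⟩
  basisOfLinearIndependentOfCardEqFinrank (linearIndependent_normal T i0) (by
    rw [hV.out, Fintype.card_subtype_compl]; simp)

theorem normalBasis_apply (i0 : Fin (n + 1)) (i : {i // i ≠ i0}) :
    normalBasis T i0 i = (root T i).1 := by
  simp [normalBasis]

/-- All normals but one form a basis, so the Gram matrix defines an isometry on them. The remaining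
normal is then matched because it is determined by its inner products with that basis. -/
theorem exists_isometry_of_gram {P F : Affine.Simplex ℝ V n} {τ : Fin (n + 1) ≃ Fin (n + 1)}
    (h : ∀ i j, ⟪(root P i).1, (root P j).1⟫ = ⟪(root F (τ i)).1, (root F (τ j)).1⟫) :
    ∃ O : V ≃ₗᵢ[ℝ] V, ∀ i, O (root P i).1 = (root F (τ i)).1 := by
  let B := normalBasis P 0
  let L := B.constr ℝ fun i => (root F (τ i)).1
  have hL : ∀ i : {i // i ≠ (0 : Fin (n + 1))}, L (root P i).1 = (root F (τ i)).1 := by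
    intro i
    rw [← normalBasis_apply]; exact B.constr_basis ℝ _ i
  have hin : ∀ x y, ⟪L x, L y⟫ = ⟪x, y⟫ := by
    intro x y
    rw [← B.sum_repr x, ← B.sum_repr y]
    simp only [map_sum, map_smul, sum_inner, inner_sum, real_inner_smul_left,
      real_inner_smul_right, B, normalBasis_apply, hL, ← h]
  let O := (L.isometryOfInner hin).toLinearIsometryEquiv rfl
  have hO : ∀ x, O x = L x := fun x => rfl
  refine ⟨O, fun i => ?_⟩
  by_cases hi : i = 0
  · subst hi
    rw [← sub_eq_zero]
    have : O.symm (O (root P 0).1 - (root F (τ 0)).1) = 0 := by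
      refine eq_zero_of_orthogonal P (i0 := 0) fun i hi => ?_
      rw [← O.inner_map_map, O.apply_symm_apply, inner_sub_right, O.inner_map_map, hO,
        hL ⟨i, hi⟩, h, sub_self]
    exact EmbeddingLike.map_eq_zero_iff.1 this
  · rw [hO]; exact hL ⟨i, hi⟩

/-- The ratio is chosen to match one height and the translation to match the corresponding vertex.
The other facets pass through that vertex, so matching gradients is enough for them. -/
theorem exists_sim_of_gram {P F : Affine.Simplex ℝ V n} {τ : Fin (n + 1) ≃ Fin (n + 1)}
    (h : ∀ i j, ⟪(root P i).1, (root P j).1⟫ = ⟪(root F (τ i)).1, (root F (τ j)).1⟫) :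
    ∃ S : Sim V, ∀ i, root F (τ i) = S.push (root P i) := by
  obtain ⟨O, hO⟩ := exists_isometry_of_gram h
  obtain ⟨r, hr⟩ : ∃ r, r = F.height (τ 0) / P.height 0 := ⟨_, rfl⟩
  have hr0 : 0 < r := by rw [hr]; exact div_pos (F.height_pos _) (P.height_pos _)
  let S : Sim V := ⟨O, r, hr0, F.points (τ 0) - r • O (P.points 0)⟩
  have hS : S.map (P.points 0) = F.points (τ 0) := by simp [S, Sim.map]
  refine ⟨S, fun i => ?_⟩
  have e1 : (root F (τ i)).1 = (S.push (root P i)).1 := (hO i).symm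
  have e2 : ev (root F (τ i)) (F.points (τ 0)) = ev (S.push (root P i)) (F.points (τ 0)) := by
    rw [← hS, S.ev_push, hS, ev_root, ev_root]
    by_cases hi : i = 0
    · subst hi
      have := (P.height_pos 0).ne'
      simp only [if_true, S, hr]; field_simp
    · have : ¬ τ 0 = τ i := fun h => hi (τ.injective h).symm
      rw [if_neg this, if_neg (Ne.symm hi), mul_zero]
  refine Prod.ext e1 ?_
  simp only [ev, e1] at e2
  linarith

theorem Sim.points {P F : Affine.Simplex ℝ V n} {τ : Fin (n + 1) ≃ Fin (n + 1)} {S : Sim V}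
    (h : ∀ i, root F (τ i) = S.push (root P i)) (i : Fin (n + 1)) :
    S.map (P.points i) = F.points (τ i) := by
  refine eq_point_of_ev_root F fun j hj => ?_
  obtain ⟨k, rfl⟩ := τ.surjective j
  rw [h, S.ev_push, ev_root_of_ne P (by rintro rfl; exact hj rfl), mul_zero]

theorem Sim.height {P F : Affine.Simplex ℝ V n} {τ : Fin (n + 1) ≃ Fin (n + 1)} {S : Sim V}
    (h : ∀ i, root F (τ i) = S.push (root P i)) (i : Fin (n + 1)) :
    F.height (τ i) = S.r * P.height i := by
  rw [← ev_root_self, ← ev_root_self, ← Sim.points h, h, S.ev_push]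

theorem Sim.symm_push {P F : Affine.Simplex ℝ V n} {τ : Fin (n + 1) ≃ Fin (n + 1)} {S : Sim V}
    (h : ∀ i, root F (τ i) = S.push (root P i)) (i : Fin (n + 1)) :
    root P (τ.symm i) = S.symm.push (root F i) := by
  obtain ⟨k, rfl⟩ := τ.surjective i
  rw [h, S.push_symm_push, τ.symm_apply_apply]

theorem Sim.exists_conj {P F : Affine.Simplex ℝ V n} {τ : Fin (n + 1) ≃ Fin (n + 1)} {S : Sim V}
    (h : ∀ i, root F (τ i) = S.push (root P i)) {g : V ≃ᵃⁱ[ℝ] V} (hg : g ∈ reflGroup P) :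
    ∃ g' ∈ reflGroup F, ∀ x, g' (S.map x) = S.map (g x) := by
  rw [← gp_root] at hg
  induction hg using Subgroup.closure_induction with
  | mem r hr =>
    obtain ⟨i, rfl⟩ := hr
    refine ⟨refl (root F (τ i)), by rw [← gp_root]; exact refl_mem_gp _ _, fun x => ?_⟩
    rw [h, S.refl_push (norm_root P i)]
  | one => exact ⟨1, one_mem _, fun x => rfl⟩
  | mul a b _ _ ha hb =>
    obtain ⟨a', ha', h1⟩ := ha
    obtain ⟨b', hb', h2⟩ := hb
    refine ⟨a' * b', mul_mem ha' hb', fun x => ?_⟩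
    rw [AffineIsometryEquiv.coe_mul, Function.comp_apply, h2, h1]; rfl
  | inv a _ ha =>
    obtain ⟨a', ha', h1⟩ := ha
    refine ⟨a'⁻¹, inv_mem ha', fun x => ?_⟩
    rw [AffineIsometryEquiv.coe_inv, AffineIsometryEquiv.symm_apply_eq, h1]
    simp

theorem Sim.refl_push_mem {P F : Affine.Simplex ℝ V n} {τ : Fin (n + 1) ≃ Fin (n + 1)} {S : Sim V}
    (h : ∀ i, root F (τ i) = S.push (root P i)) {a : V × ℝ} (ha : ‖a.1‖ = 1)
    (hm : refl a ∈ reflGroup P) : refl (S.push a) ∈ reflGroup F := by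
  obtain ⟨g', hg', h1⟩ := Sim.exists_conj h hm
  have : g' = refl (S.push a) := by
    ext x
    rw [← S.map_symm_map x, h1, S.refl_push ha]
  rwa [← this]

theorem Sim.trans_mem {P F : Affine.Simplex ℝ V n} {τ : Fin (n + 1) ≃ Fin (n + 1)} {S : Sim V}
    (h : ∀ i, root F (τ i) = S.push (root P i)) {t : V}
    (hm : trans t ∈ reflGroup P) : trans (S.r • S.O t) ∈ reflGroup F := by
  obtain ⟨g', hg', h1⟩ := Sim.exists_conj h hm
  have : g' = trans (S.r • S.O t) := by
    ext x
    rw [← S.map_symm_map x, h1, trans_apply, trans_apply]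
    simp only [Sim.map, map_add, smul_add]
    abel
  rwa [← this]

theorem Sim.mem_normals {P F : Affine.Simplex ℝ V n} {τ : Fin (n + 1) ≃ Fin (n + 1)} {S : Sim V}
    (h : ∀ i, root F (τ i) = S.push (root P i)) {u : V} (hu : u ∈ normals (reflGroup P)) :
    S.O u ∈ normals (reflGroup F) := by
  obtain ⟨h1, c, hc⟩ := hu
  exact mem_normals_of_refl_mem (a := S.push (u, c)) (by rw [S.norm_push]; exact h1)
    (Sim.refl_push_mem h h1 hc)

theorem Sim.isSpecial {P F : Affine.Simplex ℝ V n} {τ : Fin (n + 1) ≃ Fin (n + 1)} {S : Sim V}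
    (h : ∀ i, root F (τ i) = S.push (root P i)) {v : V} (hv : IsSpecial (reflGroup P) v) :
    IsSpecial (reflGroup F) (S.map v) := by
  intro u hu
  have h1 := hv _ (Sim.mem_normals (Sim.symm_push h) hu)
  have h2 := Sim.refl_push_mem h (a := rt (S.symm.O u) v) (by simpa using hu.1) h1
  rwa [eq_rt (a := S.push (rt (S.symm.O u) v)) (v := S.map v)
    (by rw [S.ev_push, ev_rt, sub_self, inner_zero_right, mul_zero]),
    show (S.push (rt (S.symm.O u) v)).1 = u from S.O.apply_symm_apply u] at h2

theorem normals_mono {G H : Subgroup (V ≃ᵃⁱ[ℝ] V)} (h : G ≤ H) : normals G ⊆ normals H :=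
  fun _ ⟨h1, c, hc⟩ => ⟨h1, c, h hc⟩

/-- The linear part of the similarity between P and F carries the normals of one group into those of
the other. Being finite, the two nested sets have the same size and are equal. -/
theorem normals_eq {P F : Affine.Simplex ℝ V n} (h : SameDiagram P F)
    (hle : reflGroup P ≤ reflGroup F) : normals (reflGroup P) = normals (reflGroup F) := by
  obtain ⟨τ, hτ⟩ := h.exists_equiv
  obtain ⟨S, hS⟩ := exists_sim_of_gram hτ
  have hP := finite_normals P h.isCoxeter.1
  have hF := finite_normals F h.isCoxeter.2
  refine Set.eq_of_subset_of_ncard_le (normals_mono hle) ?_ hF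
  rw [← Set.ncard_image_of_injective _ S.symm.O.injective]
  refine Set.ncard_le_ncard ?_ hP
  rintro _ ⟨u, hu, rfl⟩
  exact Sim.mem_normals (Sim.symm_push hS) hu

theorem IsSpecial.mono {G H : Subgroup (V ≃ᵃⁱ[ℝ] V)} (h : G ≤ H) (hN : normals G = normals H)
    {v : V} (hv : IsSpecial G v) : IsSpecial H v := fun u hu => h (hv u (hN ▸ hu))

/-! ### Aligning a simplex with a fundamental simplex at a special vertex. -/

/-- Two nonnegative transition matrices whose product is the identity leave no room for mixing: some
b j used in the expansion of a i is supported on a i alone, and the norms make them equal. -/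
theorem exists_eq_of_cones {ι κ : Type*} [Fintype ι] [Fintype κ] {a : ι → V × ℝ}
    {b : κ → V × ℝ} (hna : ∀ i, ‖(a i).1‖ = 1) (hnb : ∀ i, ‖(b i).1‖ = 1)
    (ha : LinearIndependent ℝ a)
    (hab : ∀ i, ∃ c : κ → ℝ, (∀ j, 0 ≤ c j) ∧ a i = ∑ j, c j • b j)
    (hba : ∀ j, ∃ c : ι → ℝ, (∀ i, 0 ≤ c i) ∧ b j = ∑ i, c i • a i) (i : ι) :
    ∃ j, a i = b j := by
  classical
  choose A hA0 hA using hab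
  choose B hB0 hB using hba
  have h1 : a i = ∑ k, (∑ j, A i j * B j k) • a k := by
    conv_lhs => rw [hA i]
    simp only [Finset.sum_smul]
    rw [Finset.sum_comm]
    refine Finset.sum_congr rfl fun j _ => ?_
    conv_lhs => rw [hB j, Finset.smul_sum]
    simp [smul_smul]
  have h2 : ∀ k, k ≠ i → ∑ j, A i j * B j k = 0 := by
    intro k hk
    have h3 : ∑ k, ((∑ j, A i j * B j k) - if k = i then 1 else 0) • a k = 0 := by
      simp only [sub_smul, Finset.sum_sub_distrib, ← h1]
      simp
    have := Fintype.linearIndependent_iff.1 ha _ h3 k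
    simpa [hk] using this
  obtain ⟨j, hj⟩ : ∃ j, A i j ≠ 0 := by
    by_contra hcon
    push Not at hcon
    have := hna i
    rw [hA i] at this
    simp [hcon] at this
  have h4 : ∀ k, k ≠ i → B j k = 0 := by
    intro k hk
    have := (Finset.sum_eq_zero_iff_of_nonneg
      (fun j _ => mul_nonneg (hA0 i j) (hB0 j k))).1 (h2 k hk) j (Finset.mem_univ j)
    exact (mul_eq_zero.1 this).resolve_left hj
  have h5 := hB j
  rw [Finset.sum_eq_single i (fun k _ hk => by rw [h4 k hk, zero_smul]) (by simp)] at h5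
  have h6 := congrArg (fun a : V × ℝ => ‖a.1‖) h5
  simp only [Prod.smul_fst, norm_smul, hna, hnb, Real.norm_eq_abs, abs_of_nonneg (hB0 j i)] at h6
  refine ⟨j, ?_⟩
  rw [h5, ← mul_one (B j i), ← h6, one_smul]

/-- Two simplicial cones that contain each other have the same facets. -/
theorem exists_equiv_of_cones {ι κ : Type*} [Fintype ι] [Fintype κ] {a : ι → V × ℝ}
    {b : κ → V × ℝ} (hna : ∀ i, ‖(a i).1‖ = 1) (hnb : ∀ i, ‖(b i).1‖ = 1)
    (ha : LinearIndependent ℝ a) (hb : LinearIndependent ℝ b)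
    (hab : ∀ i, ∃ c : κ → ℝ, (∀ j, 0 ≤ c j) ∧ a i = ∑ j, c j • b j)
    (hba : ∀ j, ∃ c : ι → ℝ, (∀ i, 0 ≤ c i) ∧ b j = ∑ i, c i • a i) :
    ∃ e : ι ≃ κ, ∀ i, a i = b (e i) := by
  choose f hf using exists_eq_of_cones hna hnb ha hab hba
  choose g hg using exists_eq_of_cones hnb hna hb hba hab
  refine ⟨⟨f, g, fun i => ha.injective ?_, fun j => hb.injective ?_⟩, hf⟩
  · rw [← hg, ← hf]
  · rw [← hf, ← hg]

theorem sum_subtype_ne {M : Type*} [AddCommMonoid M] {i0 : Fin (n + 1)} {f : Fin (n + 1) → M}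
    (h : f i0 = 0) : ∑ i, f i = ∑ i : {i // i ≠ i0}, f i := by
  rw [Fintype.sum_eq_add_sum_subtype_ne f i0, h, zero_add]

theorem isCoxeter_move {T : Affine.Simplex ℝ V n} (hT : IsCoxeter T) (g : V ≃ᵃⁱ[ℝ] V) :
    IsCoxeter (move g T) :=
  isCoxeter_of_gram hT (Equiv.refl _) fun i j => by
    rw [root_move, root_move, inner_act]; rfl

/-- A simplex with a special vertex can be moved by its group so that it has the same cone at this
vertex as a fundamental simplex of the larger group. -/
theorem exists_aligned {C P : Affine.Simplex ℝ V n} (hC : IsCoxeter C) (hP : IsCoxeter P)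
    (hle : reflGroup P ≤ reflGroup C) (hN : normals (reflGroup P) = normals (reflGroup C))
    {c0 p0 : Fin (n + 1)} (hv : C.points c0 = P.points p0)
    (hs : IsSpecial (reflGroup P) (P.points p0)) :
    ∃ w ∈ reflGroup P, w (P.points p0) = P.points p0 ∧ ∃ ρ : Fin (n + 1) ≃ Fin (n + 1),
      ρ p0 = c0 ∧ ∀ j ≠ p0, root C (ρ j) = root (move w P) j := by
  classical
  have hAC := isCoxFamily_root C hC
  obtain ⟨q, hq⟩ := exists_interior C
  obtain ⟨x, hx⟩ := exists_interior P
  set v := P.points p0 with hvdef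
  have hC0 : ∀ i ≠ c0, ev (root C i) v = 0 := fun i hi => by
    rw [← hv]; exact ev_root_of_ne C hi.symm
  -- An element of the stabilizer of v in G_C takes an interior point of P into the cone of C at v.
  -- Its generators are mirrors through v, which specialness puts in G_P.
  obtain ⟨w, hw, hpos⟩ := exists_apply_nonneg hAC hq (gpAt (root C) v) (gpAt_le _ _) x
  have hmem : ∀ i, ev (root C i) v = 0 → refl (root C i) ∈ reflGroup P := by
    intro i hi
    rw [eq_rt hi]
    exact hs _ (hN ▸ root_mem_normals C i)
  have hwv : w v = v := apply_eq_of_mem_gpAt (norm_root C) hw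
  have hwP : w ∈ reflGroup P := by
    refine (Subgroup.closure_le (K := reflGroup P)).2 ?_ hw
    rintro _ ⟨i, hi, rfl⟩
    exact hmem i hi
  have hP' := isCoxeter_move hP w
  have hAP := isCoxFamily_root _ hP'
  have hG' : reflGroup (move w P) = reflGroup P := reflGroup_move_of_mem P hwP
  have hx' : ∀ j, 0 < ev (root (move w P) j) (w x) := fun j => by
    rw [root_move, ev_act_apply]; exact hx j
  have hv' : (move w P).points p0 = v := hwv
  have hP0 : ∀ j ≠ p0, ev (root (move w P) j) v = 0 := fun j hj => by
    rw [← hv']; exact ev_root_of_ne _ hj.symm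
  -- the facet functions of `C` at `v` are positive on `move w P`
  have hCpos : ∀ i ≠ c0, 0 < ev (root C i) (w x) := by
    intro i hi
    refine lt_of_le_of_ne (hpos i (Subgroup.subset_closure ⟨i, hC0 i hi, rfl⟩)) (Ne.symm ?_)
    refine ev_ne_zero_of_refl_mem hAP (norm_root C i) ?_ hx'
    rw [gp_root, hG']; exact hmem i (hC0 i hi)
  have h1 : ∀ i ≠ c0, ∀ j, 0 ≤ ev (root C i) ((move w P).points j) := by
    intro i hi j
    refine nonneg_of_pos_of_refl_mem hAP (norm_root C i) ?_ hx' (fun k => (hx' k).le) (hCpos i hi)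
      (points_mem_region _ j)
    rw [gp_root, hG']; exact hmem i (hC0 i hi)
  -- a point of the interior of `C` close to `v`
  obtain ⟨y, ε, hε, hy, hyC⟩ : ∃ (y : V) (ε : ℝ), 0 < ε ∧ y = v + ε • (w x - v) ∧
      ∀ i, 0 < ev (root C i) y := by
    set D := ⟪(root C c0).1, w x - v⟫
    have hh := C.height_pos c0
    refine ⟨_, C.height c0 / (2 * (|D| + 1)), by positivity, rfl, fun i => ?_⟩
    rw [ev_add_vec, real_inner_smul_right]
    by_cases hi : i = c0
    · subst hi
      rw [show ev (root C i) v = C.height i by rw [← hv, ev_root_self]]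
      have h1 : -|D| ≤ D := neg_abs_le D
      have h3 : C.height i / (2 * (|D| + 1)) * |D| ≤ C.height i / 2 := by
        rw [div_mul_eq_mul_div, div_le_div_iff₀ (by positivity) (by positivity)]
        nlinarith [abs_nonneg D]
      have h4 : 0 < C.height i / (2 * (|D| + 1)) := by positivity
      change 0 < _ + _ * D
      nlinarith
    · rw [hC0 i hi, zero_add, ← ev_sub_ev, hC0 i hi, sub_zero]
      have := hCpos i hi
      positivity
  have h2 : ∀ j ≠ p0, ∀ i, 0 ≤ ev (root (move w P) j) (C.points i) := by
    intro j hj i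
    refine nonneg_of_pos_of_refl_mem hAC (norm_root _ j) ?_ hq (fun k => (hyC k).le) ?_
      (points_mem_region C i)
    · rw [gp_root]
      refine hle ?_
      rw [← hG', ← gp_root]; exact refl_mem_gp _ _
    · rw [hy, ev_add_vec, real_inner_smul_right, ← ev_sub_ev, hP0 j hj, sub_zero, zero_add]
      have := hx' j
      positivity
  -- Each facet function at v of one simplex is nonnegative on the vertices of the other and
  -- vanishes at v, so it is a nonnegative combination of the other's facet functions at v.
  obtain ⟨e, he⟩ := exists_equiv_of_cones
    (a := fun j : {j // j ≠ p0} => root (move w P) j) (b := fun i : {i // i ≠ c0} => root C i)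
    (fun _ => norm_root _ _) (fun _ => norm_root _ _)
    ((linearIndependent_root _).comp _ Subtype.val_injective)
    ((linearIndependent_root _).comp _ Subtype.val_injective)
    (fun j => ⟨fun i => ev (root (move w P) j) (C.points i) / C.height i,
      fun i => div_nonneg (h2 j j.2 i) (C.height_pos _).le, by
        conv_lhs => rw [eq_sum_root C (root (move w P) j)]
        refine sum_subtype_ne ?_
        rw [hv, hP0 j j.2, zero_div, zero_smul]⟩)
    (fun i => ⟨fun j => ev (root C i) ((move w P).points j) / (move w P).height j,
      fun j => div_nonneg (h1 i i.2 j) ((move w P).height_pos _).le, by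
        conv_lhs => rw [eq_sum_root (move w P) (root C i)]
        refine sum_subtype_ne ?_
        rw [hv', hC0 i i.2, zero_div, zero_smul]⟩)
  refine ⟨w, hwP, hwv, e.extendSubtype, ?_, fun j hj => ?_⟩
  · have := e.extendSubtype_not_mem p0 (by simp)
    simpa using this
  · rw [e.extendSubtype_apply_of_mem j hj]
    exact (he ⟨j, hj⟩).symm

/-- Fundamental simplices of the same group with a common special vertex are conjugate under the
stabilizer of this vertex. -/
theorem exists_conj_of_reflGroup_eq {C P : Affine.Simplex ℝ V n} (hC : IsCoxeter C)
    (hP : IsCoxeter P) (hG : reflGroup P = reflGroup C)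
    {c0 p0 : Fin (n + 1)} (hv : C.points c0 = P.points p0)
    (hs : IsSpecial (reflGroup P) (P.points p0)) :
    ∃ w ∈ reflGroup P, w (P.points p0) = P.points p0 ∧ ∃ ρ : Fin (n + 1) ≃ Fin (n + 1),
      ρ p0 = c0 ∧ ∀ j, root C (ρ j) = root (move w P) j := by
  obtain ⟨w, hw, hwv, ρ, hρ0, hρ⟩ := exists_aligned hC hP hG.le (by rw [hG]) hv hs
  have hG' : reflGroup (move w P) = reflGroup P := reflGroup_move_of_mem P hw
  have hP' := isCoxeter_move hP w
  obtain ⟨q, hq⟩ := exists_interior C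
  obtain ⟨x, hx⟩ := exists_interior (move w P)
  have hv' : (move w P).points p0 = C.points c0 := by rw [hv]; exact hwv
  have h1 : ∀ i j, 0 ≤ ev (root C i) ((move w P).points j) := by
    intro i j
    by_cases hi : i = c0
    · refine nonneg_of_pos_of_refl_mem (isCoxFamily_root _ hP') (norm_root C i) ?_ hx
        (points_mem_region _ p0) ?_ (points_mem_region _ j)
      · rw [gp_root, hG', hG, ← gp_root]; exact refl_mem_gp _ _
      · rw [hv', hi, ev_root_self]; exact C.height_pos _
    · obtain ⟨k, rfl⟩ := ρ.surjective i
      rw [hρ k (by rintro rfl; exact hi hρ0)]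
      exact ev_root_nonneg _ _ _
  have h2 : ∀ j i, 0 ≤ ev (root (move w P) j) (C.points i) := by
    intro j i
    by_cases hj : j = p0
    · refine nonneg_of_pos_of_refl_mem (isCoxFamily_root _ hC) (norm_root _ j) ?_ hq
        (points_mem_region _ c0) ?_ (points_mem_region _ i)
      · rw [gp_root, ← hG, ← hG', ← gp_root]; exact refl_mem_gp _ _
      · rw [← hv', hj, ev_root_self]; exact Affine.Simplex.height_pos _ _
    · rw [← hρ j hj]
      exact ev_root_nonneg _ _ _
  obtain ⟨e, he⟩ := exists_equiv_of_cones (a := root (move w P)) (b := root C)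
    (norm_root _) (norm_root _) (linearIndependent_root _) (linearIndependent_root _)
    (fun j => ⟨_, fun i => div_nonneg (h2 j i) (C.height_pos _).le, eq_sum_root C _⟩)
    (fun i => ⟨_, fun j => div_nonneg (h1 i j) ((move w P).height_pos _).le, eq_sum_root _ _⟩)
  refine ⟨w, hw, hwv, e, ?_, fun j => (he j).symm⟩
  by_contra hne
  have h3 := ev_root_self (move w P) p0
  rw [he, hv', ev_root_of_ne C (Ne.symm hne)] at h3
  exact absurd h3 (Affine.Simplex.height_pos _ _).ne

/-- Translations between special points normalize the group. -/
theorem trans_conj_mem {G : Subgroup (V ≃ᵃⁱ[ℝ] V)} {v v' : V} (hv : IsSpecial G v)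
    (hv' : IsSpecial G v') {a : V × ℝ} (ha : ‖a.1‖ = 1) (hm : refl a ∈ G) :
    refl (act (trans (v' - v)) a) ∈ G := by
  have hu := mem_normals_of_refl_mem ha hm
  -- Only the component of v' - v along the normal moves the mirror. Twice that component is the
  -- translation obtained from the parallel mirrors through v' and v.
  have h1 : refl (act (trans (v' - v)) a) = refl (rt a.1 v') * refl (rt a.1 v) * refl a := by
    rw [rt, rt, refl_mul_refl_parallel ha]
    ext x
    rw [AffineIsometryEquiv.coe_mul, Function.comp_apply, refl_apply (by simpa), refl_apply ha,
      act_trans, trans_apply]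
    simp only [ev, inner_sub_right]
    module
  rw [h1]
  exact mul_mem (mul_mem (hv' _ hu) (hv _ hu)) hm

theorem reflGroup_move_trans {T : Affine.Simplex ℝ V n} {v v' : V}
    (hv : IsSpecial (reflGroup T) v) (hv' : IsSpecial (reflGroup T) v') :
    reflGroup (move (trans (v' - v)) T) = reflGroup T := by
  have key : ∀ {v v' : V}, IsSpecial (reflGroup T) v → IsSpecial (reflGroup T) v' →
      reflGroup (move (trans (v' - v)) T) ≤ reflGroup T := by
    intro v v' hv hv'
    conv_lhs => rw [← gp_root]
    refine (Subgroup.closure_le _).2 ?_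
    rintro _ ⟨i, rfl⟩
    simp only [root_move]
    refine trans_conj_mem hv hv' (norm_root T i) ?_
    rw [← gp_root]; exact refl_mem_gp _ _
  refine le_antisymm (key hv hv') fun x hx => ?_
  rw [reflGroup_move]
  have h2 : trans (v' - v) * x * (trans (v' - v))⁻¹ ∈ reflGroup (move (trans (v' - v)) T) := by
    rw [reflGroup_move]; convert hx using 1; group
  refine key hv' hv ?_
  rw [reflGroup_move, ← neg_sub, trans_neg]
  convert hx using 1
  group

/-- The diagram isomorphism between two simplices with a common special vertex can be chosen to
match this vertex. -/
theorem exists_gram_equiv_fix {P C : Affine.Simplex ℝ V n} (hC : IsCoxeter C)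
    {τ : Fin (n + 1) ≃ Fin (n + 1)}
    (hτ : ∀ i j, ⟪(root P i).1, (root P j).1⟫ = ⟪(root C (τ i)).1, (root C (τ j)).1⟫)
    {c0 p0 : Fin (n + 1)} (hs : IsSpecial (reflGroup P) (P.points p0))
    (hs' : IsSpecial (reflGroup C) (C.points c0)) :
    ∃ τ' : Fin (n + 1) ≃ Fin (n + 1), τ' p0 = c0 ∧
      ∀ i j, ⟪(root P i).1, (root P j).1⟫ = ⟪(root C (τ' i)).1, (root C (τ' j)).1⟫ := by
  -- The similarity sends p0 to some special vertex of C, perhaps not c0. Translating that vertex to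
  -- c0 normalizes G_C, and the fundamental simplices at c0 are conjugate under its stabilizer. This
  -- corrects the bijection by a diagram automorphism of C.
  obtain ⟨S, hS⟩ := exists_sim_of_gram hτ
  have h1 := Sim.isSpecial hS hs
  rw [Sim.points hS] at h1
  have hG := reflGroup_move_trans h1 hs'
  have hv : C.points c0 = (move (trans (C.points c0 - C.points (τ p0))) C).points (τ p0) := by
    simp
  obtain ⟨w, -, -, κ, hκ0, hκ⟩ := exists_conj_of_reflGroup_eq hC (isCoxeter_move hC _) hG hv
    (by rw [hG, ← hv]; exact hs')
  refine ⟨τ.trans κ, hκ0, fun i j => ?_⟩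
  rw [hτ, Equiv.trans_apply, Equiv.trans_apply, hκ, hκ, root_move, root_move, root_move, root_move,
    inner_act, inner_act]

end Simplex

/-! ### The finite reflection group at a special vertex. -/

section Vertex

variable {n : ℕ} [NeZero n] (C : Affine.Simplex ℝ V n)
variable [FiniteDimensional ℝ V] [hV : Fact (finrank ℝ V = n)]

/-- The normals of the facets through a vertex lie in an open half-space. -/
theorem exists_pos_of_ne (j : Fin (n + 1)) : ∃ ξ : V, ∀ i ≠ j, 0 < ⟪ξ, (root C i).1⟫ := by
  obtain ⟨q, hq⟩ := exists_interior C
  refine ⟨q - C.points j, fun i hi => ?_⟩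
  rw [real_inner_comm, ← ev_sub_ev, ev_root_of_ne C hi.symm, sub_zero]
  exact hq i

variable {C} {c0 : Fin (n + 1)}

/-- The mirror through the special vertex with normal u belongs to the group and cannot cut C, so
its function is nonnegative on all vertices. These values are the coefficients, and the one at c0
vanishes. -/
theorem normal_eq_sum (hC : IsCoxeter C) (hs : IsSpecial (reflGroup C) (C.points c0)) {u : V}
    (hu : u ∈ normals (reflGroup C)) {q : V} (hq : ∀ i, 0 < ev (root C i) q)
    (hpos : 0 < ev (rt u (C.points c0)) q) :
    ∃ c : {i // i ≠ c0} → ℝ, (∀ i, 0 ≤ c i) ∧ u = ∑ i, c i • (root C i).1 := by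
  refine ⟨fun i => ev (rt u (C.points c0)) (C.points i) / C.height i, fun i => ?_, ?_⟩
  · refine div_nonneg ?_ (C.height_pos _).le
    refine nonneg_of_pos_of_refl_mem (isCoxFamily_root C hC) (b := rt u (C.points c0)) hu.1 ?_ hq
      (fun k => (hq k).le) hpos (points_mem_region C i)
    rw [gp_root]; exact hs u hu
  · have h1 := congrArg Prod.fst (eq_sum_root C (rt u (C.points c0)))
    rw [sum_subtype_ne (i0 := c0) (by rw [ev_rt, sub_self, inner_zero_right, zero_div, zero_smul]),
      Prod.fst_sum] at h1
    exact h1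

/-- Induction over the normals of a Coxeter group, by reflections in the facets through a special
vertex. -/
theorem normals_induction (hC : IsCoxeter C) (hs : IsSpecial (reflGroup C) (C.points c0))
    {Q : V → Prop} (hQb : ∀ i ≠ c0, Q (root C i).1)
    (hQ : ∀ i ≠ c0, ∀ u ∈ normals (reflGroup C), Q u →
      Q (u - (2 * ⟪(root C i).1, u⟫) • (root C i).1)) :
    ∀ u ∈ normals (reflGroup C), Q u := by
  obtain ⟨q, hq⟩ := exists_interior C
  obtain ⟨ξ, hξ⟩ := exists_pos_of_ne C c0
  refine simple_system_induction (finite_normals C hC) (fun u hu => hu.1)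
    (fun u hu w hw => reflect_mem_normals hu hw) (linearIndependent_normal C c0)
    (fun i => root_mem_normals C i) (fun i => hξ i i.2) (fun u hu => ?_) (fun i => hQb i i.2)
    (fun i => hQ i i.2)
  have hne := ev_ne_zero_of_refl_mem (isCoxFamily_root C hC) (b := rt u (C.points c0)) hu.1
    (by rw [gp_root]; exact hs u hu) hq
  rcases lt_or_gt_of_ne hne with h | h
  · right
    have hneg : -u ∈ normals (reflGroup C) := by
      have := reflect_mem_normals hu hu
      rwa [real_inner_self_eq_norm_sq, hu.1, show u - (2 * (1 : ℝ) ^ 2) • u = -u by module]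
        at this
    refine normal_eq_sum hC hs hneg hq ?_
    rw [ev_rt, inner_neg_left, ← ev_rt]; linarith
  · exact Or.inl (normal_eq_sum hC hs hu hq h)

/-- The normals of the facets through a special vertex do not split into orthogonal parts. -/
theorem forall_of_orthogonal (hC : IsCoxeter C) (hs : IsSpecial (reflGroup C) (C.points c0))
    {S : Set (Fin (n + 1))}
    (hS : ∀ i ≠ c0, ∀ j ≠ c0, i ∈ S → j ∉ S → ⟪(root C i).1, (root C j).1⟫ = 0) :
    (∀ i ≠ c0, i ∈ S) ∨ ∀ i ≠ c0, i ∉ S := by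
  classical
  -- If the last normal lies in the span of the S-part, the terms of `sum_root` outside S add up to
  -- a vector that lies in this span and is orthogonal to it. It vanishes, although its coefficients
  -- are positive.
  have main : ∀ S : Set (Fin (n + 1)),
      (∀ i ≠ c0, ∀ j ≠ c0, i ∈ S → j ∉ S → ⟪(root C i).1, (root C j).1⟫ = 0) →
      (root C c0).1 ∈ Submodule.span ℝ {u | ∃ i ≠ c0, i ∈ S ∧ u = (root C i).1} →
      ∀ i ≠ c0, i ∈ S := by
    intro S hS hθ j hj
    by_contra hjS
    set U := Submodule.span ℝ {u | ∃ i ≠ c0, i ∈ S ∧ u = (root C i).1}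
    set z := ∑ i, (if i ≠ c0 ∧ i ∉ S then (C.height i)⁻¹ else 0) • (root C i).1 with hz
    have hzU : z ∈ U := by
      have h1 : z = -∑ i, (if i ≠ c0 ∧ i ∉ S then 0 else (C.height i)⁻¹) • (root C i).1 := by
        rw [eq_neg_iff_add_eq_zero, hz, ← Finset.sum_add_distrib, ← sum_root C]
        refine Finset.sum_congr rfl fun i _ => ?_
        split_ifs <;> simp
      rw [h1]
      refine neg_mem (sum_mem fun i _ => ?_)
      split_ifs with h
      · simp
      · refine U.smul_mem _ ?_
        by_cases hi : i = c0
        · rw [hi]; exact hθ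
        · exact Submodule.subset_span ⟨i, hi, by by_contra h'; exact h ⟨hi, h'⟩, rfl⟩
    have hort : ∀ u ∈ U, ⟪z, u⟫ = 0 := by
      intro u hu
      induction hu using Submodule.span_induction with
      | mem u hu =>
        obtain ⟨i, hi, hiS, rfl⟩ := hu
        rw [hz, sum_inner]
        refine Finset.sum_eq_zero fun k _ => ?_
        rw [real_inner_smul_left]
        split_ifs with h
        · rw [real_inner_comm, hS i hi k h.1 hiS h.2, mul_zero]
        · rw [zero_mul]
      | zero => simp
      | add x y _ _ hx hy => rw [inner_add_right, hx, hy, add_zero]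
      | smul a x _ hx => rw [real_inner_smul_right, hx, mul_zero]
    have h0 : z = 0 := inner_self_eq_zero.1 (hort z hzU)
    have h1 := congrFun (eq_zero_of_sum_root C (hz ▸ h0) (j := c0) (by simp)) j
    simp only [ne_eq, hj, not_false_eq_true, hjS, and_self, if_true, Pi.zero_apply, inv_eq_zero] at h1
    exact (C.height_pos j).ne' h1
  -- Reflections in one part fix the span of the orthogonal part, so by induction each normal,
  -- including that of the facet c0, lies in one of the two spans.
  have hsplit : ∀ u ∈ normals (reflGroup C),
      u ∈ Submodule.span ℝ {u | ∃ i ≠ c0, i ∈ S ∧ u = (root C i).1} ∨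
      u ∈ Submodule.span ℝ {u | ∃ i ≠ c0, i ∈ Sᶜ ∧ u = (root C i).1} := by
    have hort : ∀ S : Set (Fin (n + 1)),
      (∀ i ≠ c0, ∀ j ≠ c0, i ∈ S → j ∉ S → ⟪(root C i).1, (root C j).1⟫ = 0) → ∀ i ≠ c0, i ∉ S →
      ∀ u ∈ Submodule.span ℝ {u | ∃ i ≠ c0, i ∈ S ∧ u = (root C i).1}, ⟪(root C i).1, u⟫ = 0 := by
      intro S hS i hi hiS u hu
      induction hu using Submodule.span_induction with
      | mem u hu =>
        obtain ⟨j, hj, hjS, rfl⟩ := hu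
        rw [real_inner_comm, hS j hj i hi hjS hiS]
      | zero => simp
      | add x y _ _ hx hy => rw [inner_add_right, hx, hy, add_zero]
      | smul a x _ hx => rw [real_inner_smul_right, hx, mul_zero]
    refine normals_induction hC hs (fun i hi => ?_) fun i hi u _ hu => ?_
    · by_cases h : i ∈ S
      · exact Or.inl (Submodule.subset_span ⟨i, hi, h, rfl⟩)
      · exact Or.inr (Submodule.subset_span ⟨i, hi, h, rfl⟩)
    · refine hu.imp (fun hu => ?_) fun hu => ?_
      · by_cases h : i ∈ S
        · exact sub_mem hu (Submodule.smul_mem _ _ (Submodule.subset_span ⟨i, hi, h, rfl⟩))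
        · rw [hort S hS i hi h u hu, mul_zero, zero_smul, sub_zero]; exact hu
      · by_cases h : i ∈ S
        · rw [hort Sᶜ (fun i hi j hj h1 h2 => by
            rw [real_inner_comm]; exact hS j hj i hi (not_not.1 h2) h1) i hi (not_not.2 h) u hu,
            mul_zero, zero_smul, sub_zero]
          exact hu
        · exact sub_mem hu (Submodule.smul_mem _ _ (Submodule.subset_span ⟨i, hi, h, rfl⟩))
  refine (hsplit _ (root_mem_normals C c0)).imp (main S hS) fun h => ?_
  exact main Sᶜ (fun i hi j hj h1 h2 => by
    rw [real_inner_comm]; exact hS j hj i hi (not_not.1 h2) h1) h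

/-- Vectors that are related by reflections in the facets through the vertex `c0`. -/
def Related (C : Affine.Simplex ℝ V n) (c0 : Fin (n + 1)) : V → V → Prop :=
  Relation.ReflTransGen fun u w => ∃ i ≠ c0, w = u - (2 * ⟪(root C i).1, u⟫) • (root C i).1

theorem Related.symm {u w : V} (h : Related C c0 u w) : Related C c0 w u := by
  induction h with
  | refl => exact Relation.ReflTransGen.refl
  | tail _ h ih =>
    refine Relation.ReflTransGen.trans (Relation.ReflTransGen.single ?_) ih
    obtain ⟨i, hi, rfl⟩ := h
    refine ⟨i, hi, ?_⟩
    rw [inner_sub_right, real_inner_smul_right, real_inner_self_eq_norm_sq, norm_root]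
    module

theorem Related.trans {u w z : V} (h : Related C c0 u w) (h' : Related C c0 w z) :
    Related C c0 u z := Relation.ReflTransGen.trans h h'

theorem Related.exists_gpAt {u w : V} (h : Related C c0 u w) :
    ∃ g ∈ gpAt (root C) (C.points c0), g.linearIsometryEquiv u = w := by
  induction h with
  | refl => exact ⟨1, one_mem _, rfl⟩
  | tail _ h ih =>
    obtain ⟨g, hg, rfl⟩ := ih
    obtain ⟨i, hi, rfl⟩ := h
    refine ⟨refl (root C i) * g, mul_mem (Subgroup.subset_closure
      ⟨i, ev_root_of_ne C hi.symm, rfl⟩) hg, ?_⟩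
    have := congrArg Prod.fst (act_refl (norm_root C i) (g.linearIsometryEquiv u, 0))
    exact this

/-- Related vectors in the closed chamber at the vertex coincide. -/
theorem Related.eq {u w : V} (hC : IsCoxeter C) (h : Related C c0 u w)
    (hu : ∀ i ≠ c0, ⟪(root C i).1, u⟫ ≤ 0) (hw : ∀ i ≠ c0, ⟪(root C i).1, w⟫ ≤ 0) : u = w := by
  obtain ⟨g, hg, hgu⟩ := h.exists_gpAt
  have hgv := apply_eq_of_mem_gpAt (norm_root C) hg
  -- For small ε the points v - εu and v - εw, where v is the vertex c0, lie in C itself. They are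
  -- related by an element fixing v, so the strict fundamental domain property identifies them.
  obtain ⟨ε, hε, h1⟩ : ∃ ε : ℝ, 0 < ε ∧ ∀ x : V, ‖x‖ = ‖u‖ →
      0 ≤ ev (root C c0) (C.points c0 - ε • x) := by
    have hh := C.height_pos c0
    refine ⟨C.height c0 / (‖u‖ + 1), by positivity, fun x hx => ?_⟩
    rw [sub_eq_add_neg, ← smul_neg, ev_add_vec, ev_root_self, real_inner_smul_right]
    have h2 := abs_le.1 (abs_real_inner_le_norm (root C c0).1 (-x))
    rw [norm_root, norm_neg, hx, one_mul] at h2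
    have h3 : C.height c0 / (‖u‖ + 1) * ‖u‖ ≤ C.height c0 := by
      rw [div_mul_eq_mul_div, div_le_iff₀ (by positivity)]
      nlinarith
    have h4 : 0 < C.height c0 / (‖u‖ + 1) := by positivity
    nlinarith [h2.1]
  have key : ∀ x : V, ‖x‖ = ‖u‖ → (∀ i ≠ c0, ⟪(root C i).1, x⟫ ≤ 0) →
      C.points c0 - ε • x ∈ region (root C) := by
    intro x hx hx' i
    by_cases hi : i = c0
    · rw [hi]; exact h1 x hx
    · rw [sub_eq_add_neg, ← smul_neg, ev_add_vec, ev_root_of_ne C (Ne.symm hi),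
        real_inner_smul_right, inner_neg_right]
      have := mul_nonneg hε.le (neg_nonneg.2 (hx' i hi))
      linarith
  have hgx : g (C.points c0 - ε • u) = C.points c0 - ε • w := by
    have := g.map_vadd (C.points c0) (-(ε • u))
    rw [hgv] at this
    simp only [vadd_eq_add, map_neg, map_smul, hgu] at this
    rw [sub_eq_neg_add, this, sub_eq_neg_add]
  have h2 := (eq_and_mem_gpAt (isCoxFamily_root C hC) (gpAt_le _ _ hg) (key u rfl hu)
    (hgx ▸ key w (by rw [← hgu]; simp) hw)).1
  rw [hgx] at h2
  have h3 : ε • w = ε • u := by simpa using h2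
  exact (smul_right_injective V hε.ne' h3).symm

end Vertex

/-! ### Vectors of nonpositive norm attached to forbidden subdiagrams. -/

/-- The last case collects m ≥ 5, where cos(π/5) = (1 + √5)/4 exceeds 3/4, and m = 0, where the
cosine is 1. -/
theorem cos_pi_div_cases {m : ℕ} (hm : m ≠ 1) :
    Real.cos (π / m) = 0 ∨ Real.cos (π / m) = 1 / 2 ∨ Real.cos (π / m) = √2 / 2 ∨
      3 / 4 < Real.cos (π / m) := by
  have h5 : (2 : ℝ) < √5 := by
    rw [Real.lt_sqrt (by norm_num)]; norm_num
  rcases Nat.lt_or_ge m 5 with h | h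
  · interval_cases m
    · right; right; right; norm_num
    · exact absurd rfl hm
    · left; simp
    · right; left; simp [Real.cos_pi_div_three]
    · right; right; left; simp [Real.cos_pi_div_four]
  · right; right; right
    have h1 : Real.cos (π / 5) ≤ Real.cos (π / m) := by
      have h5' : (5 : ℝ) ≤ m := by exact_mod_cast h
      refine Real.cos_le_cos_of_nonneg_of_le_pi (by positivity) ?_ ?_
      · linarith [Real.pi_pos]
      · exact div_le_div_of_nonneg_left Real.pi_pos.le (by norm_num) h5'
    rw [Real.cos_pi_div_five] at h1
    linarith

theorem sqrt_two_facts : √2 * √2 = 2 ∧ 7 / 5 < √2 ∧ √2 < 3 / 2 := by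
  refine ⟨Real.mul_self_sqrt (by norm_num), ?_, ?_⟩
  · rw [Real.lt_sqrt (by norm_num)]; norm_num
  · rw [Real.sqrt_lt' (by norm_num)]; norm_num

theorem eq_zero_of_inner_self_nonpos {x : V} (h : ⟪x, x⟫ ≤ 0) : x = 0 :=
  inner_self_eq_zero.1 (le_antisymm h real_inner_self_nonneg)

/-- The weights 1, 1, 2, √2 are those of the null vector of the affine diagram B̃₃. Larger labels
only decrease its norm. -/
theorem branch_vector_eq_zero {a b p q : V} (ha : ‖a‖ = 1) (hb : ‖b‖ = 1) (hp : ‖p‖ = 1)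
    (hq : ‖q‖ = 1) (hap : ⟪a, p⟫ ≤ -(1 / 2)) (hbp : ⟪b, p⟫ ≤ -(1 / 2)) (hpq : ⟪p, q⟫ ≤ -(√2 / 2))
    (hab : ⟪a, b⟫ ≤ 0) (haq : ⟪a, q⟫ ≤ 0) (hbq : ⟪b, q⟫ ≤ 0) :
    a + b + (2 : ℝ) • p + √2 • q = 0 := by
  obtain ⟨h2, h3, h4⟩ := sqrt_two_facts
  refine eq_zero_of_inner_self_nonpos ?_
  simp only [inner_add_left, inner_add_right, real_inner_smul_left, real_inner_smul_right,
    real_inner_self_eq_norm_sq a, real_inner_self_eq_norm_sq b, real_inner_self_eq_norm_sq p, real_inner_self_eq_norm_sq q,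
    ha, hb, hp, hq, real_inner_comm a b, real_inner_comm a p,
    real_inner_comm a q, real_inner_comm b p, real_inner_comm b q, real_inner_comm p q]
  nlinarith [mul_nonneg (Real.sqrt_nonneg 2) (neg_nonneg.2 haq),
    mul_nonneg (Real.sqrt_nonneg 2) (neg_nonneg.2 hbq),
    mul_nonneg (Real.sqrt_nonneg 2) (sub_nonneg.2 hpq)]

/-- The weights 1, 2, 3, 2√2, √2 form the null vector of F̃₄ along the path y, x, p, q, z. Keeping
the first inner product as a variable lets the same bound exclude the path and pin down its first
label. -/
theorem inner_long_vector_le {y x p q z : V} (hy : ‖y‖ = 1) (hx : ‖x‖ = 1) (hp : ‖p‖ = 1)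
    (hq : ‖q‖ = 1) (hz : ‖z‖ = 1) (hxp : ⟪x, p⟫ ≤ -(1 / 2)) (hpq : ⟪p, q⟫ ≤ -(√2 / 2))
    (hqz : ⟪q, z⟫ ≤ -(1 / 2)) (hyp : ⟪y, p⟫ ≤ 0) (hyq : ⟪y, q⟫ ≤ 0) (hyz : ⟪y, z⟫ ≤ 0)
    (hxq : ⟪x, q⟫ ≤ 0) (hxz : ⟪x, z⟫ ≤ 0) (hpz : ⟪p, z⟫ ≤ 0) {v : V}
    (hv : v = y + (2 : ℝ) • x + (3 : ℝ) • p + (2 * √2) • q + √2 • z) :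
    ⟪v, v⟫ ≤ 4 * (⟪y, x⟫ + 1 / 2) := by
  obtain ⟨h2, h3, h4⟩ := sqrt_two_facts
  rw [hv]
  simp only [inner_add_left, inner_add_right, real_inner_smul_left, real_inner_smul_right,
    real_inner_self_eq_norm_sq y, real_inner_self_eq_norm_sq x, real_inner_self_eq_norm_sq p, real_inner_self_eq_norm_sq q, real_inner_self_eq_norm_sq z,
    hy, hx, hp, hq, hz, real_inner_comm y x, real_inner_comm y p,
    real_inner_comm y q, real_inner_comm y z, real_inner_comm x p, real_inner_comm x q,
    real_inner_comm x z, real_inner_comm p q, real_inner_comm p z, real_inner_comm q z]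
  have h0 := Real.sqrt_nonneg 2
  have e1 := mul_nonneg h0 (neg_nonneg.2 hyq)
  have e2 := mul_nonneg h0 (neg_nonneg.2 hyz)
  have e3 := mul_nonneg h0 (neg_nonneg.2 hxq)
  have e4 := mul_nonneg h0 (neg_nonneg.2 hxz)
  have e5 := mul_nonneg h0 (neg_nonneg.2 hpz)
  have e6 := mul_nonneg h0 (sub_nonneg.2 hpq)
  have e7 : √2 * √2 * (⟪q, z⟫ + 1 / 2) = 2 * (⟪q, z⟫ + 1 / 2) := by rw [h2]
  nlinarith

/-- The sum of the normals along a cycle has norm at most 0 when all labels are 3. A heavy edge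
makes it negative. The longer cycles below are the same. -/
theorem inner_cycle_three_neg {a b c : V} (ha : ‖a‖ = 1) (hb : ‖b‖ = 1) (hc : ‖c‖ = 1)
    (hab : ⟪a, b⟫ ≤ -(1 / 2)) (hac : ⟪a, c⟫ ≤ -(1 / 2)) (hbc : ⟪b, c⟫ ≤ -(√2 / 2)) : False := by
  obtain ⟨h2, h3, h4⟩ := sqrt_two_facts
  have := real_inner_self_nonneg (x := a + b + c)
  simp only [inner_add_left, inner_add_right, real_inner_self_eq_norm_sq a, real_inner_self_eq_norm_sq b, real_inner_self_eq_norm_sq c,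
    ha, hb, hc, real_inner_comm a b, real_inner_comm a c, real_inner_comm b c] at this
  linarith

theorem inner_cycle_four_neg {x p q z : V} (hx : ‖x‖ = 1) (hp : ‖p‖ = 1) (hq : ‖q‖ = 1)
    (hz : ‖z‖ = 1) (hxp : ⟪x, p⟫ ≤ -(1 / 2)) (hpq : ⟪p, q⟫ ≤ -(√2 / 2)) (hqz : ⟪q, z⟫ ≤ -(1 / 2))
    (hxz : ⟪x, z⟫ ≤ -(1 / 2)) (hxq : ⟪x, q⟫ ≤ 0) (hpz : ⟪p, z⟫ ≤ 0) : False := by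
  obtain ⟨h2, h3, h4⟩ := sqrt_two_facts
  have := real_inner_self_nonneg (x := x + p + q + z)
  simp only [inner_add_left, inner_add_right, real_inner_self_eq_norm_sq x, real_inner_self_eq_norm_sq p, real_inner_self_eq_norm_sq q, real_inner_self_eq_norm_sq z,
    hx, hp, hq, hz, real_inner_comm x p, real_inner_comm x q, real_inner_comm x z, real_inner_comm p q,
    real_inner_comm p z, real_inner_comm q z] at this
  linarith

theorem inner_cycle_five_neg {t x p q z : V} (ht : ‖t‖ = 1) (hx : ‖x‖ = 1) (hp : ‖p‖ = 1)
    (hq : ‖q‖ = 1) (hz : ‖z‖ = 1) (hxp : ⟪x, p⟫ ≤ -(1 / 2)) (hpq : ⟪p, q⟫ ≤ -(√2 / 2))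
    (hqz : ⟪q, z⟫ ≤ -(1 / 2)) (htx : ⟪t, x⟫ ≤ -(1 / 2)) (htz : ⟪t, z⟫ ≤ -(1 / 2))
    (hxz : ⟪x, z⟫ ≤ 0) (hxq : ⟪x, q⟫ ≤ 0) (hpz : ⟪p, z⟫ ≤ 0) (htp : ⟪t, p⟫ ≤ 0)
    (htq : ⟪t, q⟫ ≤ 0) : False := by
  obtain ⟨h2, h3, h4⟩ := sqrt_two_facts
  have := real_inner_self_nonneg (x := t + x + p + q + z)
  simp only [inner_add_left, inner_add_right, real_inner_self_eq_norm_sq t, real_inner_self_eq_norm_sq x, real_inner_self_eq_norm_sq p, real_inner_self_eq_norm_sq q, real_inner_self_eq_norm_sq z,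
    ht, hx, hp, hq, hz, real_inner_comm t x, real_inner_comm t p, real_inner_comm t q, real_inner_comm t z,
    real_inner_comm x p, real_inner_comm x q, real_inner_comm x z, real_inner_comm p q,
    real_inner_comm p z, real_inner_comm q z] at this
  linarith

/-- Positivity of the norm with weights 1, 2, 2, 1 is what keeps the middle label of such a path
below 5. -/
theorem le_of_path_four {x p q z : V} (hx : ‖x‖ = 1) (hp : ‖p‖ = 1) (hq : ‖q‖ = 1)
    (hz : ‖z‖ = 1) (hxp : ⟪x, p⟫ ≤ -(1 / 2)) (hqz : ⟪q, z⟫ ≤ -(1 / 2))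
    (hxz : ⟪x, z⟫ ≤ 0) (hxq : ⟪x, q⟫ ≤ 0) (hpz : ⟪p, z⟫ ≤ 0) : -(3 / 4) ≤ ⟪p, q⟫ := by
  have := real_inner_self_nonneg (x := x + (2 : ℝ) • p + (2 : ℝ) • q + z)
  simp only [inner_add_left, inner_add_right, real_inner_smul_left, real_inner_smul_right,
    real_inner_self_eq_norm_sq x, real_inner_self_eq_norm_sq p, real_inner_self_eq_norm_sq q, real_inner_self_eq_norm_sq z,
    hx, hp, hq, hz, real_inner_comm x p, real_inner_comm x q, real_inner_comm x z, real_inner_comm p q,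
    real_inner_comm p z, real_inner_comm q z] at this
  linarith

/-- The null vector of C̃, or of C̃₂ when β is a single normal. A whole path is collapsed to one
vector β of norm at most 1. -/
theorem heavy_ends_vector_eq_zero {a b β : V} (ha : ‖a‖ = 1) (hb : ‖b‖ = 1) (hβ : ⟪β, β⟫ ≤ 1)
    (hab : ⟪a, b⟫ ≤ 0) (haβ : ⟪a, β⟫ ≤ -(√2 / 2)) (hbβ : ⟪b, β⟫ ≤ -(√2 / 2)) :
    a + b + √2 • β = 0 := by
  obtain ⟨h2, h3, h4⟩ := sqrt_two_facts
  refine eq_zero_of_inner_self_nonpos ?_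
  simp only [inner_add_left, inner_add_right, real_inner_smul_left, real_inner_smul_right,
    real_inner_self_eq_norm_sq a, real_inner_self_eq_norm_sq b, ha, hb, real_inner_comm a b,
    real_inner_comm a β, real_inner_comm b β]
  have e7 : √2 * (√2 * ⟪β, β⟫) = 2 * ⟪β, β⟫ := by rw [← mul_assoc, h2]
  nlinarith [mul_nonneg (Real.sqrt_nonneg 2) (sub_nonneg.2 haβ),
    mul_nonneg (Real.sqrt_nonneg 2) (sub_nonneg.2 hbβ)]

/-! ### The diagram at a special vertex has at most one heavy edge. -/

section Diagram

variable {n : ℕ} [NeZero n] {C : Affine.Simplex ℝ V n}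
variable [FiniteDimensional ℝ V] [hV : Fact (finrank ℝ V = n)] {c0 : Fin (n + 1)}

theorem inner_root_cases (hC : IsCoxeter C) {i j : Fin (n + 1)} (h : i ≠ j) :
    ⟪(root C i).1, (root C j).1⟫ = 0 ∨ ⟪(root C i).1, (root C j).1⟫ = -(1 / 2) ∨
      ⟪(root C i).1, (root C j).1⟫ = -(√2 / 2) ∨ ⟪(root C i).1, (root C j).1⟫ < -(3 / 4) := by
  obtain ⟨m, hm, h⟩ := (isCoxFamily_root C hC).gram i j h
  rw [h]
  rcases cos_pi_div_cases hm with h | h | h | h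
  · left; rw [h, neg_zero]
  · right; left; rw [h]
  · right; right; left; rw [h]
  · right; right; right; linarith

theorem inner_root_nonpos (hC : IsCoxeter C) {i j : Fin (n + 1)} (h : i ≠ j) :
    ⟪(root C i).1, (root C j).1⟫ ≤ 0 := by
  have := Real.sqrt_nonneg 2
  rcases inner_root_cases hC h with h | h | h | h <;> linarith

theorem inner_root_le_of_ne (hC : IsCoxeter C) {i j : Fin (n + 1)} (h : i ≠ j)
    (h0 : ⟪(root C i).1, (root C j).1⟫ ≠ 0) : ⟪(root C i).1, (root C j).1⟫ ≤ -(1 / 2) := by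
  obtain ⟨h2, h3, h4⟩ := sqrt_two_facts
  rcases inner_root_cases hC h with h | h | h | h
  · exact absurd h h0
  all_goals linarith

theorem inner_root_le_or (hC : IsCoxeter C) {i j : Fin (n + 1)} (h : i ≠ j) :
    ⟪(root C i).1, (root C j).1⟫ = 0 ∨ ⟪(root C i).1, (root C j).1⟫ = -(1 / 2) ∨
      ⟪(root C i).1, (root C j).1⟫ ≤ -(√2 / 2) := by
  obtain ⟨h2, h3, h4⟩ := sqrt_two_facts
  rcases inner_root_cases hC h with h | h | h | h
  · exact Or.inl h
  · exact Or.inr (Or.inl h)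
  all_goals right; right; linarith

/-- With label 3, reflecting the i-th normal in the j-th gives their sum, and reflecting that in the
i-th gives the j-th. -/
theorem related_of_inner_eq {i j : Fin (n + 1)} (hi : i ≠ c0) (hj : j ≠ c0)
    (h : ⟪(root C i).1, (root C j).1⟫ = -(1 / 2)) : Related C c0 (root C i).1 (root C j).1 := by
  refine (Relation.ReflTransGen.single ⟨j, hj, rfl⟩).trans
    (Relation.ReflTransGen.single ⟨i, hi, ?_⟩)
  have h' := h
  rw [real_inner_comm] at h'
  rw [h', inner_sub_right, real_inner_smul_right, real_inner_self_eq_norm_sq, norm_root, h]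
  module

theorem list_inner_le (hC : IsCoxeter C) {q x : Fin (n + 1)} {l : List (Fin (n + 1))}
    (hq : q ∉ l) : ⟪(root C q).1, (l.map fun i => (root C i).1).sum⟫ ≤ 0 ∧
    (x ∈ l → ⟪(root C q).1, (l.map fun i => (root C i).1).sum⟫ ≤ ⟪(root C q).1, (root C x).1⟫) := by
  induction l with
  | nil => simp
  | cons a l ih =>
    rw [List.mem_cons, not_or] at hq
    have h1 := inner_root_nonpos hC hq.1
    obtain ⟨h2, h3⟩ := ih hq.2
    rw [List.map_cons, List.sum_cons, inner_add_right]
    refine ⟨by linarith, fun hx => ?_⟩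
    rcases List.mem_cons.1 hx with rfl | hx
    · linarith
    · linarith [h3 hx]

/-- The diagram of the facets through a vertex. -/
def vertexGraph (C : Affine.Simplex ℝ V n) (c0 : Fin (n + 1)) : SimpleGraph (Fin (n + 1)) where
  Adj i j := i ≠ j ∧ i ≠ c0 ∧ j ≠ c0 ∧ ⟪(root C i).1, (root C j).1⟫ ≠ 0
  symm := ⟨fun i j h => ⟨h.1.symm, h.2.2.1, h.2.1, by rw [real_inner_comm]; exact h.2.2.2⟩⟩
  loopless := ⟨fun i h => h.1 rfl⟩

/-- Each new vertex of the path adds 1 to the squared norm, and its edge to the next vertex takes at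
least 1 away. -/
theorem path_norm_le (hC : IsCoxeter C) {i j : Fin (n + 1)} (w : (vertexGraph C c0).Walk i j)
    (hw : w.IsPath) : ⟪(w.support.map fun i => (root C i).1).sum,
      (w.support.map fun i => (root C i).1).sum⟫ ≤ 1 := by
  induction w with
  | nil => simp [norm_root]
  | cons h w ih =>
    rw [SimpleGraph.Walk.cons_isPath_iff] at hw
    have h1 := ih hw.1
    have h2 := (list_inner_le hC hw.2).2 w.start_mem_support
    have h3 := inner_root_le_of_ne hC h.1 h.2.2.2
    rw [SimpleGraph.Walk.support_cons, List.map_cons, List.sum_cons, inner_add_left,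
      inner_add_right, inner_add_right, real_inner_self_eq_norm_sq, norm_root]
    rw [real_inner_comm (root C _).1]
    linarith

theorem ne_of_mem_walk {i j k : Fin (n + 1)} (w : (vertexGraph C c0).Walk i j) (hi : i ≠ c0)
    (hk : k ∈ w.support) : k ≠ c0 := by
  induction w with
  | nil => simp at hk; rwa [hk]
  | cons h w ih =>
    rw [SimpleGraph.Walk.support_cons, List.mem_cons] at hk
    rcases hk with rfl | hk
    · exact hi
    · exact ih h.2.2.1 hk

theorem reachable (hC : IsCoxeter C) (hs : IsSpecial (reflGroup C) (C.points c0))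
    {i j : Fin (n + 1)} (hi : i ≠ c0) (hj : j ≠ c0) : (vertexGraph C c0).Reachable i j := by
  refine (forall_of_orthogonal hC hs (S := {k | (vertexGraph C c0).Reachable i k}) ?_).elim
    (fun h => h j hj) fun h => absurd (SimpleGraph.Reachable.refl i) (h i hi)
  · intro k hk l hl hik hil
    by_contra hne
    refine hil (hik.trans (SimpleGraph.Adj.reachable ⟨?_, hk, hl, hne⟩))
    rintro rfl
    exact hil hik

/-- The C̃ vector would be a vanishing nonnegative combination of normals that lie in an open
half-space. -/
theorem not_heavy_ends (hC : IsCoxeter C) {p q p' q' : Fin (n + 1)} (hp : p ≠ c0) (hq : q ≠ c0)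
    (hq' : q' ≠ c0) (hne : q ≠ q') (w : (vertexGraph C c0).Walk p p') (hw : w.IsPath)
    (h1 : q ∉ w.support) (h2 : q' ∉ w.support)
    (h3 : ⟪(root C q).1, (root C p).1⟫ ≤ -(√2 / 2))
    (h4 : ⟪(root C q').1, (root C p').1⟫ ≤ -(√2 / 2)) : False := by
  have h := heavy_ends_vector_eq_zero (norm_root C q) (norm_root C q') (path_norm_le hC w hw)
    (inner_root_nonpos hC hne) (((list_inner_le hC h1).2 w.start_mem_support).trans h3)
    (((list_inner_le hC h2).2 w.end_mem_support).trans h4)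
  obtain ⟨ξ, hξ⟩ := exists_pos_of_ne C c0
  have h5 := congrArg (fun x => ⟪ξ, x⟫) h
  have h6 : ∀ l : List (Fin (n + 1)), (∀ k ∈ l, k ≠ c0) →
      0 ≤ ⟪ξ, (l.map fun i => (root C i).1).sum⟫ := by
    intro l hl
    induction l with
    | nil => simp
    | cons a l ih =>
      rw [List.map_cons, List.sum_cons, inner_add_right]
      exact add_nonneg (hξ a (hl a (by simp))).le (ih fun k hk => hl k (by simp [hk]))
  have h7 := mul_nonneg (Real.sqrt_nonneg 2) (h6 w.support fun k hk => ne_of_mem_walk w hp hk)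
  simp only [inner_add_right, real_inner_smul_right, inner_zero_right] at h5
  linarith [hξ q hq, hξ q' hq']

/-- There is at most one heavy edge among the facets through a special vertex. -/
theorem heavy_unique (hC : IsCoxeter C) (hs : IsSpecial (reflGroup C) (C.points c0))
    {p q p' q' : Fin (n + 1)} (hp : p ≠ c0) (hq : q ≠ c0) (hp' : p' ≠ c0) (hq' : q' ≠ c0)
    (hpq : p ≠ q) (hpq' : p' ≠ q')
    (h1 : ⟪(root C p).1, (root C q).1⟫ ≤ -(√2 / 2))
    (h2 : ⟪(root C p').1, (root C q').1⟫ ≤ -(√2 / 2)) :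
    (p = p' ∧ q = q') ∨ (p = q' ∧ q = p') := by
  classical
  -- The first edge is oriented so that a path to the second edge starts at one end and avoids the
  -- other. The second edge is treated alike below, with the path shortened if necessary.
  obtain ⟨p, q, hp, hq, hpq, h1, hgoal, w, hw, hqw⟩ : ∃ a b, a ≠ c0 ∧ b ≠ c0 ∧ a ≠ b ∧
      ⟪(root C b).1, (root C a).1⟫ ≤ -(√2 / 2) ∧
      (((a = p' ∧ b = q') ∨ (a = q' ∧ b = p')) → (p = p' ∧ q = q') ∨ (p = q' ∧ q = p')) ∧
      ∃ w : (vertexGraph C c0).Walk a p', w.IsPath ∧ b ∉ w.support := by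
    obtain ⟨w, hw⟩ := (reachable hC hs hp hp').exists_isPath
    by_cases hqw : q ∈ w.support
    · refine ⟨q, p, hq, hp, hpq.symm, h1, by tauto, w.dropUntil q hqw, hw.dropUntil hqw, fun h => ?_⟩
      have h5 := hw.support_nodup
      rw [← w.take_spec hqw, SimpleGraph.Walk.support_append, List.nodup_append] at h5
      refine h5.2.2 p (SimpleGraph.Walk.start_mem_support _) p ?_ rfl
      rw [← SimpleGraph.Walk.cons_tail_support] at h
      exact (List.mem_cons.1 h).resolve_left hpq
    · exact ⟨p, q, hp, hq, hpq, by rwa [real_inner_comm], by tauto, w, hw, hqw⟩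
  refine hgoal ?_
  obtain ⟨p', q', hp', hq', hpq', h2, hgoal', w, hw, hqw, hqw'⟩ : ∃ a b, a ≠ c0 ∧ b ≠ c0 ∧ a ≠ b ∧
      ⟪(root C b).1, (root C a).1⟫ ≤ -(√2 / 2) ∧
      (((p = a ∧ q = b) ∨ (p = b ∧ q = a)) → (p = p' ∧ q = q') ∨ (p = q' ∧ q = p')) ∧
      ∃ w : (vertexGraph C c0).Walk p a, w.IsPath ∧ q ∉ w.support ∧ b ∉ w.support := by
    by_cases hqw' : q' ∈ w.support
    · refine ⟨q', p', hq', hp', hpq'.symm, h2, by tauto, w.takeUntil q' hqw', hw.takeUntil hqw',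
        fun h => hqw (w.support_takeUntil_subset_support hqw' h), ?_⟩
      exact SimpleGraph.Walk.endpoint_notMem_support_takeUntil hw hqw' hpq'
    · exact ⟨p', q', hp', hq', hpq', by rwa [real_inner_comm], by tauto, w, hw, hqw, hqw'⟩
  refine hgoal' ?_
  by_cases hqq : q = q'
  · subst hqq
    by_cases hpp : p = p'
    · exact Or.inl ⟨hpp, rfl⟩
    · refine (not_heavy_ends hC hq hp hp' hpp (SimpleGraph.Walk.nil : (vertexGraph C c0).Walk q q)
        (by simp) (by simpa using hpq) (by simpa using hpq') ?_ ?_).elim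
      · rwa [real_inner_comm]
      · rwa [real_inner_comm]
  · exact (not_heavy_ends hC hp hq hq' hqq w hw hqw hqw' h1 h2).elim

/-- The facets through a special vertex fall into at most two classes, and into one class if there
is no heavy edge. -/
theorem related_or (hC : IsCoxeter C) (hs : IsSpecial (reflGroup C) (C.points c0))
    {p q : Fin (n + 1)} (hp : p ≠ c0)
    (huniq : ∀ i ≠ c0, ∀ j ≠ c0, i ≠ j → ⟪(root C i).1, (root C j).1⟫ ≤ -(√2 / 2) → j = p ∨ j = q) :
    ∀ u ∈ normals (reflGroup C), Related C c0 (root C p).1 u ∨ Related C c0 (root C q).1 u := by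
  have h1 : ∀ i ≠ c0, Related C c0 (root C p).1 (root C i).1 ∨
      Related C c0 (root C q).1 (root C i).1 := by
    refine (forall_of_orthogonal hC hs (S := {i | Related C c0 (root C p).1 (root C i).1 ∨
      Related C c0 (root C q).1 (root C i).1}) ?_).resolve_right fun h =>
        absurd (Or.inl Relation.ReflTransGen.refl) (h p hp)
    · intro i hi j hj hiS hjS
      have hij : i ≠ j := by rintro rfl; exact hjS hiS
      rcases inner_root_le_or hC hij with h | h | h
      · exact h
      · have := related_of_inner_eq hi hj h
        exact absurd (hiS.imp (fun h => h.trans this) fun h => h.trans this) hjS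
      · refine absurd ?_ hjS
        rcases huniq i hi j hj hij h with rfl | rfl
        · exact Or.inl Relation.ReflTransGen.refl
        · exact Or.inr Relation.ReflTransGen.refl
  refine normals_induction hC hs h1 fun i hi u _ hu => ?_
  exact hu.imp (fun h => h.tail ⟨i, hi, rfl⟩) fun h => h.tail ⟨i, hi, rfl⟩

end Diagram

/-! ### Which facets can close the cone at a special vertex. -/

section Classification

variable {n : ℕ} [NeZero n] {C P : Affine.Simplex ℝ V n}
variable [FiniteDimensional ℝ V] [hV : Fact (finrank ℝ V = n)] {c0 : Fin (n + 1)}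

theorem exists_ne_index (c0 : Fin (n + 1)) : ∃ i, i ≠ c0 := by
  have : Nontrivial (Fin (n + 1)) :=
    Fin.nontrivial_iff_two_le.2 (by have := NeZero.pos n; omega)
  exact exists_ne c0

theorem exists_two_classes (hC : IsCoxeter C) (hs : IsSpecial (reflGroup C) (C.points c0)) :
    ∃ a b, ∀ u ∈ normals (reflGroup C), Related C c0 a u ∨ Related C c0 b u := by
  by_cases h : ∃ p q, p ≠ c0 ∧ q ≠ c0 ∧ p ≠ q ∧ ⟪(root C p).1, (root C q).1⟫ ≤ -(√2 / 2)
  · obtain ⟨p, q, hp, hq, hpq, h⟩ := h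
    refine ⟨_, _, related_or hC hs (q := q) hp fun i hi j hj hij h' => ?_⟩
    have := heavy_unique hC hs hp hq hi hj hpq hij h h'
    tauto
  · obtain ⟨p, hp⟩ := exists_ne_index c0
    exact ⟨_, _, related_or hC hs (q := p) hp fun i hi j hj hij h' => absurd ⟨i, j, hi, hj, hij, h'⟩ h⟩

theorem inner_nonpos_of_eq (hP : IsCoxeter P) (heq : ∀ j ≠ c0, root P j = root C j) :
    ∀ i ≠ c0, ⟪(root C i).1, (root P c0).1⟫ ≤ 0 := fun i hi => by
  rw [← heq i hi]; exact inner_root_nonpos hP hi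

/-- The two possible facets that complete the cone at a special vertex to a simplex with a given
diagram. -/
theorem eq_of_ne_of_ne {Q : Affine.Simplex ℝ V n} (hC : IsCoxeter C)
    (hs : IsSpecial (reflGroup C) (C.points c0)) (hP : IsCoxeter P)
    (hQ : IsCoxeter Q) (heqP : ∀ j ≠ c0, root P j = root C j)
    (heqQ : ∀ j ≠ c0, root Q j = root C j) (hNP : (root P c0).1 ∈ normals (reflGroup C))
    (hNQ : (root Q c0).1 ∈ normals (reflGroup C)) (h1 : (root P c0).1 ≠ (root C c0).1)
    (h2 : (root Q c0).1 ≠ (root C c0).1) : (root P c0).1 = (root Q c0).1 := by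
  obtain ⟨a, b, hab⟩ := exists_two_classes hC hs
  have hc0 := inner_nonpos_of_eq (C := C) (c0 := c0) hC fun j _ => rfl
  have hcP := inner_nonpos_of_eq hP heqP
  have hcQ := inner_nonpos_of_eq hQ heqQ
  -- Each class contains at most one vector of the closed chamber. Three such vectors share two
  -- classes, so two of them coincide.
  have key : ∀ {c u w : V}, Related C c0 c u → Related C c0 c w →
      (∀ i ≠ c0, ⟪(root C i).1, u⟫ ≤ 0) → (∀ i ≠ c0, ⟪(root C i).1, w⟫ ≤ 0) → u = w :=
    fun h h' hu hw => (h.symm.trans h').eq hC hu hw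
  rcases hab _ (root_mem_normals C c0) with h | h <;> rcases hab _ hNP with h' | h' <;>
    rcases hab _ hNQ with h'' | h''
  all_goals first
    | exact key h' h'' hcP hcQ
    | exact absurd (key h' h hcP hc0) h1
    | exact absurd (key h'' h hcQ hc0) h2

theorem Related.map {O : V ≃ₗᵢ[ℝ] V} {σ : Fin (n + 1) ≃ Fin (n + 1)} (hσ0 : σ c0 = c0)
    (hO : ∀ i ≠ c0, O (root C i).1 = (root C (σ i)).1) {u w : V} (h : Related C c0 u w) :
    Related C c0 (O u) (O w) := by
  induction h with
  | refl => exact Relation.ReflTransGen.refl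
  | tail _ h ih =>
    obtain ⟨i, hi, rfl⟩ := h
    refine ih.tail ⟨σ i, fun h => hi (σ.injective (h.trans hσ0.symm)), ?_⟩
    rw [map_sub, map_smul, hO i hi, ← hO i hi, O.inner_map_map, hO i hi]

/-- The diagram isomorphism preserves the unique heavy edge. If it fixes both ends, the induced
isometry preserves the two classes, so the last normal of P is related to its image, the last normal
of C, and they agree in the chamber. Otherwise the ends are swapped. Without a heavy edge there is
only one class. -/
theorem eq_or_swap (hC : IsCoxeter C) (hs : IsSpecial (reflGroup C) (C.points c0))
    (hP : IsCoxeter P) (heq : ∀ j ≠ c0, root P j = root C j)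
    (hN : (root P c0).1 ∈ normals (reflGroup C)) {σ : Fin (n + 1) ≃ Fin (n + 1)} (hσ0 : σ c0 = c0)
    (hσ : ∀ i j, ⟪(root P i).1, (root P j).1⟫ = ⟪(root C (σ i)).1, (root C (σ j)).1⟫) :
    (root P c0).1 = (root C c0).1 ∨ ∃ p q, p ≠ c0 ∧ q ≠ c0 ∧ p ≠ q ∧
      ⟪(root C p).1, (root C q).1⟫ ≤ -(√2 / 2) ∧ σ p = q ∧ σ q = p := by
  have hc0 := inner_nonpos_of_eq (C := C) (c0 := c0) hC fun j _ => rfl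
  have hcP := inner_nonpos_of_eq hP heq
  by_cases h : ∃ p q, p ≠ c0 ∧ q ≠ c0 ∧ p ≠ q ∧ ⟪(root C p).1, (root C q).1⟫ ≤ -(√2 / 2)
  · obtain ⟨p, q, hp, hq, hpq, h⟩ := h
    have hrel := related_or hC hs (q := q) hp fun i hi j hj hij h' => by
      have := heavy_unique hC hs hp hq hi hj hpq hij h h'
      tauto
    have hne : ∀ {i}, i ≠ c0 → σ i ≠ c0 := fun hi h => hi (σ.injective (h.trans hσ0.symm))
    have h1 := hσ p q
    rw [heq p hp, heq q hq] at h1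
    rcases heavy_unique hC hs hp hq (hne hp) (hne hq) hpq (fun h => hpq (σ.injective h)) h
      (h1 ▸ h) with ⟨h2, h3⟩ | ⟨h2, h3⟩
    · left
      obtain ⟨O, hO⟩ := exists_isometry_of_gram hσ
      have hO' : ∀ i ≠ c0, O (root C i).1 = (root C (σ i)).1 := fun i hi => by
        rw [← heq i hi]; exact hO i
      have hOθ := hO c0
      rw [hσ0] at hOθ
      refine Related.eq hC ?_ hcP hc0
      rcases hrel _ hN with h4 | h4
      · have h5 := Related.map hσ0 hO' h4
        rw [hO' p hp, ← h2, hOθ] at h5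
        exact h4.symm.trans h5
      · have h5 := Related.map hσ0 hO' h4
        rw [hO' q hq, ← h3, hOθ] at h5
        exact h4.symm.trans h5
    · exact Or.inr ⟨p, q, hp, hq, hpq, h, h3.symm, h2.symm⟩
  · left
    obtain ⟨p, hp⟩ := exists_ne_index c0
    have hrel := related_or hC hs (q := p) hp
      fun i hi j hj hij h' => absurd ⟨i, j, hi, hj, hij, h'⟩ h
    have h1 := (hrel _ hN).elim id id
    have h2 := (hrel _ (root_mem_normals C c0)).elim id id
    exact (h1.symm.trans h2).eq hC hcP hc0

/-- The simplex `C` has diagram `C̃₂`, and `u` completes its cone at the vertex `f₀` to another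
simplex of this type. -/
structure IsTypeC (C : Affine.Simplex ℝ V n) (u : V) (f₀ f₁ f₂ : Fin (n + 1)) : Prop where
  ne₀₁ : f₀ ≠ f₁
  ne₀₂ : f₀ ≠ f₂
  ne₁₂ : f₁ ≠ f₂
  cover : ∀ i, i = f₀ ∨ i = f₁ ∨ i = f₂
  inner₀₁ : ⟪(root C f₀).1, (root C f₁).1⟫ = -(√2 / 2)
  inner₀₂ : ⟪(root C f₀).1, (root C f₂).1⟫ = 0
  inner₁₂ : ⟪(root C f₁).1, (root C f₂).1⟫ = -(√2 / 2)
  eq : u = (root C f₁).1 + √2 • (root C f₀).1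

/-- The simplex `C` has diagram `G̃₂`, and `u` completes its cone at the vertex `f₀` to another
simplex of this type. -/
structure IsTypeG (C : Affine.Simplex ℝ V n) (u : V) (f₀ f₁ f₂ : Fin (n + 1)) : Prop where
  ne₀₁ : f₀ ≠ f₁
  ne₀₂ : f₀ ≠ f₂
  ne₁₂ : f₁ ≠ f₂
  cover : ∀ i, i = f₀ ∨ i = f₁ ∨ i = f₂
  inner₀₁ : ⟪(root C f₀).1, (root C f₁).1⟫ = -(1 / 2)
  inner₀₂ : ⟪(root C f₀).1, (root C f₂).1⟫ = 0
  inner₁₂ : ⟪(root C f₁).1, (root C f₂).1⟫ = -(√3 / 2)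
  eq : u = (root C f₂).1 + √3 • (root C f₁).1 + √3 • (root C f₀).1

/-- The simplex `C` has diagram `F̃₄`, and `u` completes its cone at the vertex `f₄` to another
simplex of this type. -/
structure IsTypeF (C : Affine.Simplex ℝ V n) (u : V) (f₀ f₁ f₂ f₃ f₄ : Fin (n + 1)) : Prop where
  ne₀₁ : f₀ ≠ f₁
  ne₀₂ : f₀ ≠ f₂
  ne₀₃ : f₀ ≠ f₃
  ne₀₄ : f₀ ≠ f₄
  ne₁₂ : f₁ ≠ f₂
  ne₁₃ : f₁ ≠ f₃
  ne₁₄ : f₁ ≠ f₄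
  ne₂₃ : f₂ ≠ f₃
  ne₂₄ : f₂ ≠ f₄
  ne₃₄ : f₃ ≠ f₄
  cover : ∀ i, i = f₀ ∨ i = f₁ ∨ i = f₂ ∨ i = f₃ ∨ i = f₄
  inner₀₁ : ⟪(root C f₀).1, (root C f₁).1⟫ = -(1 / 2)
  inner₀₂ : ⟪(root C f₀).1, (root C f₂).1⟫ = 0
  inner₀₃ : ⟪(root C f₀).1, (root C f₃).1⟫ = 0
  inner₀₄ : ⟪(root C f₀).1, (root C f₄).1⟫ = 0
  inner₁₂ : ⟪(root C f₁).1, (root C f₂).1⟫ = -(√2 / 2)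
  inner₁₃ : ⟪(root C f₁).1, (root C f₃).1⟫ = 0
  inner₁₄ : ⟪(root C f₁).1, (root C f₄).1⟫ = 0
  inner₂₃ : ⟪(root C f₂).1, (root C f₃).1⟫ = -(1 / 2)
  inner₂₄ : ⟪(root C f₂).1, (root C f₄).1⟫ = 0
  inner₃₄ : ⟪(root C f₃).1, (root C f₄).1⟫ = -(1 / 2)
  eq : u = (root C f₁).1 + √2 • ((root C f₂).1 + (root C f₃).1 + (root C f₄).1)

theorem eq_of_inner_eq {u w : V} (h : ∀ i ≠ c0, ⟪(root C i).1, u⟫ = ⟪(root C i).1, w⟫) : u = w :=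
  sub_eq_zero.1 (eq_zero_of_orthogonal C (i0 := c0) fun i hi => by
    rw [inner_sub_right, h i hi, sub_self])

theorem root_ne_zero (i : Fin (n + 1)) : (root C i).1 ≠ 0 := by
  rw [← norm_ne_zero_iff, norm_root]; exact one_ne_zero

/-- The rank two case, with the facet `c0` attached to the facet `p` only. -/
theorem rank_two_type (hC : IsCoxeter C) {p q : Fin (n + 1)} (hp : p ≠ c0) (hq : q ≠ c0)
    (hpq : p ≠ q) (hcov : ∀ i, i = c0 ∨ i = p ∨ i = q)
    (h : ⟪(root C p).1, (root C q).1⟫ ≤ -(√2 / 2))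
    (h0p : ⟪(root C c0).1, (root C p).1⟫ ≠ 0) (h0q : ⟪(root C c0).1, (root C q).1⟫ = 0) {u : V}
    (hup : ⟪(root C p).1, u⟫ = 0)
    (huq : ⟪(root C q).1, u⟫ = ⟪(root C c0).1, (root C p).1⟫) :
    IsTypeC C u c0 p q ∨ IsTypeG C u c0 p q := by
  obtain ⟨s2, s2a, s2b⟩ := sqrt_two_facts
  have hpp : ⟪(root C p).1, (root C p).1⟫ = 1 := by rw [real_inner_self_eq_norm_sq, norm_root, one_pow]
  have hqq : ⟪(root C q).1, (root C q).1⟫ = 1 := by rw [real_inner_self_eq_norm_sq, norm_root, one_pow]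
  have h00 : ⟪(root C c0).1, (root C c0).1⟫ = 1 := by
    rw [real_inner_self_eq_norm_sq, norm_root, one_pow]
  have hqp := real_inner_comm (root C p).1 (root C q).1
  have hp0 := real_inner_comm (root C p).1 (root C c0).1
  have hq0 := real_inner_comm (root C q).1 (root C c0).1
  set c := ⟪(root C p).1, (root C q).1⟫ with hc
  set d := ⟪(root C c0).1, (root C p).1⟫ with hd
  -- The three normals lie in a plane, and with the facets c0 and q orthogonal their linear
  -- dependence amounts to c² + d² = 1.
  have hcd : 1 - c ^ 2 = d ^ 2 := by
    have h1 : (1 - c ^ 2) • (root C c0).1 - d • (root C p).1 + (c * d) • (root C q).1 = 0 := by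
      refine eq_zero_of_orthogonal C (i0 := c0) fun i hi => ?_
      rcases (hcov i).resolve_left hi with rfl | rfl
      · rw [inner_add_right, inner_sub_right, real_inner_smul_right, real_inner_smul_right,
          real_inner_smul_right, hpp, ← hc, ← hp0]
        ring
      · rw [inner_add_right, inner_sub_right, real_inner_smul_right, real_inner_smul_right,
          real_inner_smul_right, hqq, ← hqp, ← hq0, h0q]
        ring
    have h2 := congrArg (fun x => ⟪(root C c0).1, x⟫) h1
    simp only [inner_add_right, inner_sub_right, real_inner_smul_right, inner_zero_right, h00, h0q,
      ← hd] at h2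
    nlinarith
  have hd0 : d ≤ -(1 / 2) := inner_root_le_of_ne hC hp.symm h0p
  rcases inner_root_cases hC hpq with h1 | h1 | h1 | h1
  · rw [← hc] at h1; linarith
  · rw [← hc] at h1; linarith
  · left
    rw [← hc] at h1
    have hd1 : d = -(√2 / 2) := by
      have h2 : (d + √2 / 2) * (d - √2 / 2) = 0 := by rw [h1] at hcd; nlinarith
      rcases mul_eq_zero.1 h2 with h2 | h2 <;> linarith
    refine ⟨hp.symm, hq.symm, hpq, hcov, hd1, h0q, h1, eq_of_inner_eq (C := C) (c0 := c0) fun i hi => ?_⟩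
    rcases (hcov i).resolve_left hi with rfl | rfl
    · rw [hup, inner_add_right, real_inner_smul_right, hpp, ← hp0, hd1]; linarith
    · rw [huq, inner_add_right, real_inner_smul_right, hqp, ← hq0, h0q, h1, hd1]; ring
  · right
    rw [← hc] at h1
    have s3 : √3 * √3 = 3 := Real.mul_self_sqrt (by norm_num)
    have s3' := Real.sqrt_nonneg 3
    -- Here d² = 1 - c² < 7/16, which only the label 3 allows. Then c = -√3/2, the label 6.
    have hd1 : d = -(1 / 2) := by
      rcases inner_root_cases hC hp.symm with h2 | h2 | h2 | h2
      · exact absurd h2 h0p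
      · exact h2
      · rw [← hd] at h2; rw [h2] at hcd; nlinarith
      · rw [← hd] at h2; nlinarith
    have hc1 : c = -(√3 / 2) := by
      have h2 : (c + √3 / 2) * (c - √3 / 2) = 0 := by rw [hd1] at hcd; nlinarith
      rcases mul_eq_zero.1 h2 with h2 | h2 <;> linarith
    refine ⟨hp.symm, hq.symm, hpq, hcov, hd1, h0q, hc1, eq_of_inner_eq (C := C) (c0 := c0) fun i hi => ?_⟩
    rcases (hcov i).resolve_left hi with rfl | rfl
    · rw [hup, inner_add_right, inner_add_right, real_inner_smul_right, real_inner_smul_right, hpp,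
        ← hp0, hd1, ← hc, hc1]; ring
    · rw [huq, inner_add_right, inner_add_right, real_inner_smul_right, real_inner_smul_right, hqq,
        hqp, ← hq0, h0q, hc1, hd1]; linarith

/-- The rank four case, with the facet `c0` attached to the facet `x`. -/
theorem rank_four_type (hC : IsCoxeter C) {x p q z : Fin (n + 1)} (hx : x ≠ c0) (hp : p ≠ c0)
    (hq : q ≠ c0) (hz : z ≠ c0) (hxp : x ≠ p) (hxq : x ≠ q) (hxz : x ≠ z) (hpq : p ≠ q)
    (hpz : p ≠ z) (hqz : q ≠ z) (hcov : ∀ i, i = c0 ∨ i = x ∨ i = p ∨ i = q ∨ i = z)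
    (ixp : ⟪(root C x).1, (root C p).1⟫ = -(1 / 2)) (ixq : ⟪(root C x).1, (root C q).1⟫ = 0)
    (ixz : ⟪(root C x).1, (root C z).1⟫ = 0) (ipq : ⟪(root C p).1, (root C q).1⟫ = -(√2 / 2))
    (ipz : ⟪(root C p).1, (root C z).1⟫ = 0) (iqz : ⟪(root C q).1, (root C z).1⟫ = -(1 / 2))
    (ix : ⟪(root C x).1, (root C c0).1⟫ ≠ 0) (ip : ⟪(root C p).1, (root C c0).1⟫ = 0)
    (iq : ⟪(root C q).1, (root C c0).1⟫ = 0)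
    {u : V} (hux : ⟪(root C x).1, u⟫ = ⟪(root C z).1, (root C c0).1⟫)
    (huz : ⟪(root C z).1, u⟫ = ⟪(root C x).1, (root C c0).1⟫)
    (hup : ⟪(root C p).1, u⟫ = 0) (huq : ⟪(root C q).1, u⟫ = 0) :
    IsTypeF C u z q p x c0 := by
  obtain ⟨s2, s2a, s2b⟩ := sqrt_two_facts
  have self : ∀ i, ⟪(root C i).1, (root C i).1⟫ = 1 := fun i => by
    rw [real_inner_self_eq_norm_sq, norm_root, one_pow]
  have ix' := inner_root_le_of_ne hC hx ix
  -- Attaching c0 to both ends of the path would close a cycle of length five with a heavy edge.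
  have iz : ⟪(root C z).1, (root C c0).1⟫ = 0 := by
    by_contra h
    have iz' := inner_root_le_of_ne hC hz h
    rw [real_inner_comm] at ix' iz'
    exact inner_cycle_five_neg (norm_root C c0) (norm_root C x) (norm_root C p) (norm_root C q)
      (norm_root C z) ixp.le ipq.le iqz.le ix' iz' ixz.le ixq.le ipz.le
      (inner_root_nonpos hC hp.symm) (inner_root_nonpos hC hq.symm)
  have ix1 : ⟪(root C x).1, (root C c0).1⟫ = -(1 / 2) := by
    refine le_antisymm ix' ?_
    have h1 := inner_long_vector_le (norm_root C c0) (norm_root C x) (norm_root C p) (norm_root C q)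
      (norm_root C z) ixp.le ipq.le iqz.le (inner_root_nonpos hC hp.symm)
      (inner_root_nonpos hC hq.symm) (inner_root_nonpos hC hz.symm) ixq.le ixz.le ipz.le rfl
    have h2 := real_inner_self_nonneg.trans h1
    rw [real_inner_comm] at h2
    linarith
  have cm : ∀ i j, ⟪(root C i).1, (root C j).1⟫ = ⟪(root C j).1, (root C i).1⟫ := fun i j =>
    real_inner_comm _ _
  refine ⟨hqz.symm, hpz.symm, hxz.symm, hz, hpq.symm, hxq.symm, hq, hxp.symm, hp, hx,
    fun i => by have := hcov i; tauto, ?_, ?_, ?_, iz, ?_, ?_, iq, ?_, ip, ix1,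
    eq_of_inner_eq (C := C) (c0 := c0) fun i hi => ?_⟩
  · rw [cm, iqz]
  · rw [cm, ipz]
  · rw [cm, ixz]
  · rw [cm, ipq]
  · rw [cm, ixq]
  · rw [cm, ixp]
  · simp only [inner_add_right, real_inner_smul_right]
    rcases (hcov i).resolve_left hi with rfl | rfl | rfl | rfl
    · rw [hux, iz, ixq, ixp, self, ix1]; ring
    · rw [hup, ipq, self, cm i x, ixp, ip]; ring
    · rw [huq, self, cm i p, ipq, cm i x, ixq, iq]; linarith
    · rw [huz, ix1, cm i q, iqz, cm i p, ipz, cm i x, ixz, iz]; ring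

theorem cover_of_orthogonal (hC : IsCoxeter C) (hs : IsSpecial (reflGroup C) (C.points c0))
    {S : Set (Fin (n + 1))} {p : Fin (n + 1)} (hp : p ≠ c0) (hpS : p ∈ S)
    (h : ∀ i ∈ S, ∀ j ≠ c0, j ∉ S → ⟪(root C i).1, (root C j).1⟫ = 0) (i : Fin (n + 1)) :
    i = c0 ∨ i ∈ S := by
  rcases forall_of_orthogonal hC hs (S := S) (fun i _ j hj hi hjS => h i hi j hj hjS) with h | h
  · exact or_iff_not_imp_left.2 (h i)
  · exact absurd hpS (h p hp)

/-- The four normals avoid the facet j, so they lie in an open half-space and cannot satisfy the B̃₃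
relation. Any omitted facet serves as j, so the lemma also applies to branches formed by the facet
c0 itself. -/
theorem no_branch (hC : IsCoxeter C) {a b p q j : Fin (n + 1)} (ha : a ≠ j) (hb : b ≠ j)
    (hp : p ≠ j) (hq : q ≠ j) (hab : a ≠ b) (haq : a ≠ q) (hbp : b ≠ p) (hbq : b ≠ q)
    (iap : ⟪(root C a).1, (root C p).1⟫ ≤ -(1 / 2)) (ipq : ⟪(root C p).1, (root C q).1⟫ ≤ -(√2 / 2)) :
    ⟪(root C p).1, (root C b).1⟫ = 0 := by
  rw [real_inner_comm]
  by_contra h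
  have h1 := branch_vector_eq_zero (norm_root C a) (norm_root C b) (norm_root C p) (norm_root C q)
    iap (inner_root_le_of_ne hC hbp h) ipq (inner_root_nonpos hC hab) (inner_root_nonpos hC haq)
    (inner_root_nonpos hC hbq)
  obtain ⟨ξ, hξ⟩ := exists_pos_of_ne C j
  have h2 := congrArg (fun x => ⟪ξ, x⟫) h1
  simp only [inner_add_right, real_inner_smul_right, inner_zero_right] at h2
  have h3 := mul_nonneg (Real.sqrt_nonneg 2) (hξ q hq).le
  linarith [hξ a ha, hξ b hb, hξ p hp]

theorem no_long_path (hC : IsCoxeter C) {y x p q z j : Fin (n + 1)} (hy : y ≠ j) (hx : x ≠ j)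
    (hp : p ≠ j) (hq : q ≠ j) (hz : z ≠ j) (hyx : y ≠ x) (hyp : y ≠ p) (hyq : y ≠ q) (hyz : y ≠ z)
    (hxq : x ≠ q) (hxz : x ≠ z) (hpz : p ≠ z)
    (ixp : ⟪(root C x).1, (root C p).1⟫ ≤ -(1 / 2)) (ipq : ⟪(root C p).1, (root C q).1⟫ ≤ -(√2 / 2))
    (iqz : ⟪(root C q).1, (root C z).1⟫ ≤ -(1 / 2)) : ⟪(root C x).1, (root C y).1⟫ = 0 := by
  rw [real_inner_comm]
  by_contra h
  have h1 := inner_long_vector_le (norm_root C y) (norm_root C x) (norm_root C p) (norm_root C q)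
      (norm_root C z) ixp ipq iqz (inner_root_nonpos hC hyp)
      (inner_root_nonpos hC hyq) (inner_root_nonpos hC hyz) (inner_root_nonpos hC hxq)
      (inner_root_nonpos hC hxz) (inner_root_nonpos hC hpz) rfl
  have h2 := eq_zero_of_inner_self_nonpos (h1.trans (by linarith [inner_root_le_of_ne hC hyx h]))
  obtain ⟨ξ, hξ⟩ := exists_pos_of_ne C j
  have h3 := congrArg (fun x => ⟪ξ, x⟫) h2
  simp only [inner_add_right, real_inner_smul_right, inner_zero_right] at h3
  have h4 := mul_nonneg (Real.sqrt_nonneg 2) (hξ q hq).le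
  have h5 := mul_nonneg (Real.sqrt_nonneg 2) (hξ z hz).le
  linarith [hξ y hy, hξ x hx, hξ p hp]

/-- The simplices completing the cone at a special vertex, up to diagram isomorphism. -/
theorem classification (hC : IsCoxeter C) (hs : IsSpecial (reflGroup C) (C.points c0))
    (hP : IsCoxeter P) (heq : ∀ j ≠ c0, root P j = root C j)
    (hN : (root P c0).1 ∈ normals (reflGroup C)) {σ : Fin (n + 1) ≃ Fin (n + 1)} (hσ0 : σ c0 = c0)
    (hσ : ∀ i j, ⟪(root P i).1, (root P j).1⟫ = ⟪(root C (σ i)).1, (root C (σ j)).1⟫) :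
    (root P c0).1 = (root C c0).1 ∨ (∃ f₁ f₂, IsTypeC C (root P c0).1 c0 f₁ f₂) ∨
      (∃ f₁ f₂, IsTypeG C (root P c0).1 c0 f₁ f₂) ∨
      ∃ f₀ f₁ f₂ f₃, IsTypeF C (root P c0).1 f₀ f₁ f₂ f₃ c0 := by
  obtain ⟨s2, s2a, s2b⟩ := sqrt_two_facts
  refine (eq_or_swap hC hs hP heq hN hσ0 hσ).imp_right ?_
  rintro ⟨p, q, hp, hq, hpq, h, hσp, hσq⟩
  have hne : ∀ {i}, i ≠ c0 → σ i ≠ c0 := fun hi h => hi (σ.injective (h.trans hσ0.symm))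
  have cm : ∀ i j, ⟪(root C i).1, (root C j).1⟫ = ⟪(root C j).1, (root C i).1⟫ := fun i j =>
    real_inner_comm _ _
  have hg : ∀ i ≠ c0, ∀ j ≠ c0, ⟪(root C (σ i)).1, (root C (σ j)).1⟫ = ⟪(root C i).1, (root C j).1⟫ :=
    fun i hi j hj => by rw [← hσ, heq i hi, heq j hj]
  have hgθ : ∀ i ≠ c0, ⟪(root C i).1, (root P c0).1⟫ = ⟪(root C (σ i)).1, (root C c0).1⟫ :=
    fun i hi => by
      have := hσ i c0
      rwa [heq i hi, hσ0] at this
  have hup : ⟪(root C p).1, (root P c0).1⟫ = ⟪(root C q).1, (root C c0).1⟫ := hσp ▸ hgθ p hp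
  have huq : ⟪(root C q).1, (root P c0).1⟫ = ⟪(root C p).1, (root C c0).1⟫ := hσq ▸ hgθ q hq
  have hortho : (∀ i ≠ c0, ⟪(root C i).1, (root C c0).1⟫ = 0) → False := fun h =>
    root_ne_zero c0 (eq_zero_of_orthogonal C (i0 := c0) h)
  -- A further neighbour x of p is carried by σ to a neighbour z of q. The path x, p, q, z then
  -- leads to F̃₄. With no such neighbour the diagram at the vertex is the heavy edge alone.
  by_cases hx : ∃ x ≠ c0, x ≠ p ∧ x ≠ q ∧ ⟪(root C p).1, (root C x).1⟫ ≠ 0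
  · right; right
    obtain ⟨x, hx0, hxp, hxq, hpx⟩ := hx
    have ipx : ⟪(root C p).1, (root C x).1⟫ = -(1 / 2) := by
      rcases inner_root_le_or hC hxp.symm with h1 | h1 | h1
      · exact absurd h1 hpx
      · exact h1
      · rcases heavy_unique hC hs hp hq hp hx0 hpq hxp.symm h h1 with h2 | h2
        · exact absurd h2.2.symm hxq
        · exact absurd h2.1.symm hxp
    have ixp : ⟪(root C x).1, (root C p).1⟫ = -(1 / 2) := by rw [cm, ipx]
    obtain ⟨z, hσx⟩ : ∃ z, σ x = z := ⟨_, rfl⟩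
    have hz0 : z ≠ c0 := hσx ▸ hne hx0
    have hzp : z ≠ p := fun h => hxq (σ.injective (by rw [hσx, h, hσq]))
    have hzq : z ≠ q := fun h => hxp (σ.injective (by rw [hσx, h, hσp]))
    have iqz : ⟪(root C q).1, (root C z).1⟫ = -(1 / 2) := by
      have := hg p hp x hx0
      rw [hσp, hσx] at this
      rw [this, ipx]
    have ixq : ⟪(root C x).1, (root C q).1⟫ = 0 := by
      by_contra hcon
      exact inner_cycle_three_neg (norm_root C x) (norm_root C p) (norm_root C q) ixp.le
        (inner_root_le_of_ne hC hxq hcon) h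
    have ipz : ⟪(root C p).1, (root C z).1⟫ = 0 := by
      have := hg q hq x hx0
      rw [hσq, hσx, cm q x, ixq] at this
      exact this
    have hxz : x ≠ z := by
      rintro rfl
      rw [cm, ixq] at iqz
      norm_num at iqz
    have ixz : ⟪(root C x).1, (root C z).1⟫ = 0 := by
      by_contra hcon
      exact inner_cycle_four_neg (norm_root C x) (norm_root C p) (norm_root C q) (norm_root C z)
        ixp.le h iqz.le (inner_root_le_of_ne hC hxz hcon) ixq.le ipz.le
    have ipq : ⟪(root C p).1, (root C q).1⟫ = -(√2 / 2) := by
      have h1 := le_of_path_four (norm_root C x) (norm_root C p) (norm_root C q) (norm_root C z)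
        ixp.le iqz.le ixz.le ixq.le ipz.le
      rcases inner_root_cases hC hpq with h2 | h2 | h2 | h2 <;> linarith
    have izq : ⟪(root C z).1, (root C q).1⟫ = -(1 / 2) := by rw [cm, iqz]
    have iqp : ⟪(root C q).1, (root C p).1⟫ = -(√2 / 2) := by rw [cm, ipq]
    have hcov : ∀ i, i = c0 ∨ i = x ∨ i = p ∨ i = q ∨ i = z := by
      refine cover_of_orthogonal hC hs (S := {x, p, q, z}) hp (by simp) ?_
      intro i hi j hj hjS
      simp only [Set.mem_insert_iff, Set.mem_singleton_iff, not_or] at hjS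
      obtain ⟨hjx, hjp, hjq, hjz⟩ := hjS
      rcases hi with rfl | rfl | rfl | rfl
      · exact no_long_path hC hj hx0 hp hq hz0 hjx hjp hjq hjz hxq hxz hzp.symm ixp.le ipq.le iqz.le
      · exact no_branch hC hx0 hj hp hq (Ne.symm hjx) hxq hjp hjq ixp.le ipq.le
      · exact no_branch hC hz0 hj hq hp (Ne.symm hjz) hzp hjq hjp izq.le iqp.le
      · exact no_long_path hC hj hz0 hq hp hx0 hjz hjq hjp hjx hzp hxz.symm hxq.symm izq.le iqp.le ipx.le
    -- The facet c0 cannot branch off at p or at q. In each case the far end of the path is the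
    -- facet to omit.
    have ip : ⟪(root C p).1, (root C c0).1⟫ = 0 :=
      no_branch hC (j := z) hxz hz0.symm hzp.symm hzq.symm hx0 hxq hp.symm hq.symm ixp.le ipq.le
    have iq : ⟪(root C q).1, (root C c0).1⟫ = 0 :=
      no_branch hC (j := x) hxz.symm hx0.symm hxq.symm hxp.symm hz0 hzp hq.symm hp.symm izq.le iqp.le
    have hσz : σ z = x := by
      rcases hcov (σ z) with h1 | h1 | h1 | h1 | h1
      · exact absurd h1 (hne hz0)
      · exact h1
      · exact absurd (σ.injective (h1.trans hσq.symm)) hzq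
      · exact absurd (σ.injective (h1.trans hσp.symm)) hzp
      · exact absurd (σ.injective (h1.trans hσx.symm)) hxz.symm
    have hux : ⟪(root C x).1, (root P c0).1⟫ = ⟪(root C z).1, (root C c0).1⟫ := hσx ▸ hgθ x hx0
    have huz : ⟪(root C z).1, (root P c0).1⟫ = ⟪(root C x).1, (root C c0).1⟫ := hσz ▸ hgθ z hz0
    by_cases hix : ⟪(root C x).1, (root C c0).1⟫ = 0
    · by_cases hiz : ⟪(root C z).1, (root C c0).1⟫ = 0
      · refine (hortho fun i hi => ?_).elim
        rcases (hcov i).resolve_left hi with rfl | rfl | rfl | rfl <;> assumption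
      · exact ⟨_, _, _, _, rank_four_type hC hz0 hq hp hx0 hzq hzp hxz.symm hpq.symm hxq.symm hxp.symm
          (fun i => by have := hcov i; tauto) izq (by rw [cm, ipz]) (by rw [cm, ixz]) iqp
          (by rw [cm, ixq]) ipx hiz iq ip huz hux (huq.trans ip) (hup.trans iq)⟩
    · exact ⟨_, _, _, _, rank_four_type hC hx0 hp hq hz0 hxp hxq hxz hpq hzp.symm hzq.symm hcov
        ixp ixq ixz ipq ipz iqz hix ip iq hux huz (hup.trans iq) (huq.trans ip)⟩
  · push Not at hx
    have hx' : ∀ y ≠ c0, y ≠ p → y ≠ q → ⟪(root C q).1, (root C y).1⟫ = 0 := by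
      intro y hy0 hyp hyq
      obtain ⟨x, rfl⟩ := σ.surjective y
      have hx0 : x ≠ c0 := by rintro rfl; exact hy0 hσ0
      have := hx x hx0 (by rintro rfl; exact hyq hσp) (by rintro rfl; exact hyp hσq)
      rwa [← hg p hp x hx0, hσp] at this
    have hcov : ∀ i, i = c0 ∨ i = p ∨ i = q := by
      refine cover_of_orthogonal hC hs (S := {p, q}) hp (by simp) ?_
      rintro i (rfl | rfl) j hj hjS
      · exact hx j hj (fun h => hjS (by simp [h])) (fun h => hjS (by simp [h]))
      · exact hx' j hj (fun h => hjS (by simp [h])) (fun h => hjS (by simp [h]))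
    by_cases h0p : ⟪(root C p).1, (root C c0).1⟫ = 0
    · by_cases h0q : ⟪(root C q).1, (root C c0).1⟫ = 0
      · refine (hortho fun i hi => ?_).elim
        rcases (hcov i).resolve_left hi with rfl | rfl
        exacts [h0p, h0q]
      · have := rank_two_type hC (p := q) (q := p) hq hp hpq.symm
          (fun i => by have := hcov i; tauto) (by rwa [cm]) (by rwa [cm]) (by rwa [cm])
          (huq.trans h0p) (by rw [hup, cm])
        exact this.imp (fun h => ⟨_, _, h⟩) fun h => Or.inl ⟨_, _, h⟩
    · by_cases h0q : ⟪(root C q).1, (root C c0).1⟫ = 0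
      · have := rank_two_type hC (p := p) (q := q) hp hq hpq hcov h (by rwa [cm]) (by rwa [cm])
          (hup.trans h0q) (by rw [huq, cm])
        exact this.imp (fun h => ⟨_, _, h⟩) fun h => Or.inl ⟨_, _, h⟩
      · refine (inner_cycle_three_neg (norm_root C c0) (norm_root C p) (norm_root C q) ?_ ?_ h).elim
        · rw [cm]; exact inner_root_le_of_ne hC hp h0p
        · rw [cm]; exact inner_root_le_of_ne hC hq h0q

end Classification

/-! ### Translation lattices and the index as a power of the similarity ratio. -/

section Lattice

/-- Translations, as a homomorphism. -/
noncomputable def transHom : Multiplicative V →* (V ≃ᵃⁱ[ℝ] V) where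
  toFun t := trans t.toAdd
  map_one' := trans_zero
  map_mul' s t := trans_add s.toAdd t.toAdd

/-- The group of the translations contained in a group of isometries. -/
noncomputable def transGroup (G : Subgroup (V ≃ᵃⁱ[ℝ] V)) : AddSubgroup V :=
  Subgroup.toAddSubgroup' (G.comap transHom)

/-- By the decomposition every coset of H in G has a translation as representative, so the embedding
of the coset space of the translations is onto. -/
theorem relIndex_eq_relIndex_transGroup {H G : Subgroup (V ≃ᵃⁱ[ℝ] V)}
    (hdec : ∀ g ∈ G, ∃ t, trans t ∈ G ∧ ∃ h ∈ H, g = trans t * h) :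
    H.relIndex G = (transGroup H).relIndex (transGroup G) := by
  have hK : (G.comap transHom).map transHom ≤ G := Subgroup.map_comap_le _ _
  have h1 : H.relIndex ((G.comap transHom).map transHom) = H.relIndex G := by
    refine Nat.card_eq_of_bijective (Subgroup.quotientSubgroupOfEmbeddingOfLE H hK)
      ⟨(Subgroup.quotientSubgroupOfEmbeddingOfLE H hK).injective, fun x => ?_⟩
    obtain ⟨⟨g, hg⟩, rfl⟩ := QuotientGroup.mk_surjective x
    obtain ⟨t, ht, h, hh, hgt⟩ := hdec g hg
    refine ⟨QuotientGroup.mk ⟨trans t, Multiplicative.ofAdd t, ht, rfl⟩, ?_⟩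
    rw [Subgroup.quotientSubgroupOfEmbeddingOfLE_apply_mk, QuotientGroup.eq, Subgroup.mem_subgroupOf]
    change (trans t)⁻¹ * g ∈ H
    rwa [hgt, inv_mul_cancel_left]
  rw [← h1, ← Subgroup.relIndex_comap]
  rfl

/-- The translations contained in a group of isometries, as a lattice. -/
noncomputable def transLattice (G : Subgroup (V ≃ᵃⁱ[ℝ] V)) : Submodule ℤ V :=
  AddSubgroup.toIntSubmodule (transGroup G)

theorem conj_trans (g : V ≃ᵃⁱ[ℝ] V) (t : V) :
    g * trans t * g⁻¹ = trans (g.linearIsometryEquiv t) := by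
  rw [mul_inv_eq_iff_eq_mul]
  ext x
  have := g.map_vadd x t
  simpa using this

variable {n : ℕ} [NeZero n] {T : Affine.Simplex ℝ V n}
variable [FiniteDimensional ℝ V] [hV : Fact (finrank ℝ V = n)]

/-- A generator moves v by the translation that composes its mirror with the parallel mirror through
v. This extends to words since the translations are normalized by the group. -/
theorem trans_sub_mem {v : V} (hs : IsSpecial (reflGroup T) v) {g : V ≃ᵃⁱ[ℝ] V}
    (hg : g ∈ reflGroup T) : trans (g v - v) ∈ reflGroup T := by
  have key : ∀ {g t}, g ∈ reflGroup T → trans t ∈ reflGroup T →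
      trans (g.linearIsometryEquiv t) ∈ reflGroup T := fun hg ht => by
    rw [← conj_trans]; exact mul_mem (mul_mem hg ht) (inv_mem hg)
  have hlin : ∀ (g : V ≃ᵃⁱ[ℝ] V) (x y : V), g.linearIsometryEquiv (x - y) = g x - g y := fun g x y =>
    g.map_vsub x y
  have hg' := hg
  rw [← gp_root] at hg
  induction hg using Subgroup.closure_induction with
  | mem r hr =>
    obtain ⟨i, rfl⟩ := hr
    have h1 := mul_mem hg' (hs _ (root_mem_normals T i))
    have h2 : refl (root T i) * refl (rt (root T i).1 v) =
        trans ((2 * (-⟪(root T i).1, v⟫ - (root T i).2)) • (root T i).1) :=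
      refl_mul_refl_parallel (norm_root T i) _ _
    have h3 : refl (root T i) v - v =
        (2 * (-⟪(root T i).1, v⟫ - (root T i).2)) • (root T i).1 := by
      rw [refl_apply (norm_root T i)]
      simp only [ev]; module
    change trans (refl (root T i) v - v) ∈ _
    rw [h3, ← h2]; exact h1
  | one => simp [trans_zero, one_mem]
  | mul a b ha hb iha ihb =>
    have ha' : a ∈ reflGroup T := by rw [← gp_root]; exact ha
    have hb' : b ∈ reflGroup T := by rw [← gp_root]; exact hb
    have : (a * b) v - v = a.linearIsometryEquiv (b v - v) + (a v - v) := by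
      rw [hlin, AffineIsometryEquiv.coe_mul, Function.comp_apply]; abel
    rw [this, trans_add]
    exact mul_mem (key ha' (ihb hb')) (iha ha')
  | inv a ha iha =>
    have ha' : a ∈ reflGroup T := by rw [← gp_root]; exact ha
    have : a⁻¹ v - v = -(a⁻¹).linearIsometryEquiv (a v - v) := by
      rw [hlin, AffineIsometryEquiv.coe_inv, AffineIsometryEquiv.symm_apply_apply]; abel
    rw [this, trans_neg]
    exact inv_mem (key hg' (iha ha'))

theorem exists_eq_trans_mul {v : V} (hs : IsSpecial (reflGroup T) v) {g : V ≃ᵃⁱ[ℝ] V}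
    (hg : g ∈ reflGroup T) :
    ∃ t, trans t ∈ reflGroup T ∧ ∃ w ∈ reflGroup T, w v = v ∧ g = trans t * w := by
  have h1 := trans_sub_mem hs hg
  refine ⟨_, h1, (trans (g v - v))⁻¹ * g, mul_mem (inv_mem h1) hg, ?_, by group⟩
  rw [← trans_neg, AffineIsometryEquiv.coe_mul, Function.comp_apply, trans_apply]
  abel

theorem discrete_transLattice (hT : IsCoxeter T) : DiscreteTopology (transLattice (reflGroup T)) := by
  obtain ⟨p, hp⟩ := exists_interior T
  obtain ⟨ε, hε, h⟩ := exists_separation (isCoxFamily_root T hT) hp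
  rw [discreteTopology_iff_isOpen_singleton_zero, Metric.isOpen_singleton_iff]
  refine ⟨ε, hε, fun ⟨t, ht⟩ hd => ?_⟩
  have h1 := h (trans t) (by rw [gp_root]; exact ht) (by simpa [dist_eq_norm] using hd)
  rw [← trans_zero] at h1
  exact Subtype.ext (trans_injective h1)

/-- Let y be orthogonal to all translations in the group. A far point v + sy is carried into the
bounded simplex by some t ∘ w with w fixing v. But t is orthogonal to the image of y, so the
distance to v remains at least R + 1. -/
theorem span_transLattice (hT : IsCoxeter T) :
    Submodule.span ℝ (transLattice (reflGroup T) : Set V) = ⊤ := by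
  set U := Submodule.span ℝ (transLattice (reflGroup T) : Set V)
  obtain ⟨v, hs⟩ := exists_special T hT
  obtain ⟨p, hp⟩ := exists_interior T
  obtain ⟨R, hR, hbd⟩ := exists_region_bound T v
  rw [← Submodule.orthogonal_eq_bot_iff, Submodule.eq_bot_iff]
  intro y hy
  by_contra hy0
  have hy0' : 0 < ‖y‖ := norm_pos_iff.2 hy0
  set s := (R + 1) / ‖y‖ with hsdef
  obtain ⟨g, hg, hgx⟩ := exists_apply_mem_region (isCoxFamily_root T hT) hp (v + s • y)
  rw [gp_root] at hg
  obtain ⟨t, ht, w, hw, hwv, rfl⟩ := exists_eq_trans_mul hs hg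
  have h1 := hbd _ hgx
  have h2 : (trans t * w) (v + s • y) - v = t + s • w.linearIsometryEquiv y := by
    have := w.map_vadd v (s • y)
    simp only [vadd_eq_add, hwv, map_smul] at this
    rw [AffineIsometryEquiv.coe_mul, Function.comp_apply, trans_apply, add_comm v, this]
    abel
  have h3 : ⟪t, w.linearIsometryEquiv y⟫ = 0 := by
    have h4 : trans ((w⁻¹).linearIsometryEquiv t) ∈ reflGroup T := by
      rw [← conj_trans]; exact mul_mem (mul_mem (inv_mem hw) ht) (inv_mem (inv_mem hw))
    have h5 := (Submodule.mem_orthogonal _ _).1 hy _ (Submodule.subset_span h4)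
    have h6 := w.linearIsometryEquiv.inner_map_map ((w⁻¹).linearIsometryEquiv t) y
    have h7 : w.linearIsometryEquiv ((w⁻¹).linearIsometryEquiv t) = t :=
      w.linearIsometryEquiv.apply_symm_apply t
    rw [h7] at h6
    exact h6.trans h5
  rw [h2] at h1
  have h6 : ‖t + s • w.linearIsometryEquiv y‖ ^ 2 = ‖t‖ ^ 2 + (R + 1) ^ 2 := by
    rw [norm_add_sq_real, real_inner_smul_right, h3, norm_smul, LinearIsometryEquiv.norm_map, hsdef,
      Real.norm_eq_abs, abs_of_pos (by positivity)]
    field_simp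
    ring
  nlinarith [sq_nonneg ‖t‖, norm_nonneg (t + s • w.linearIsometryEquiv y)]

theorem abs_det_isometry (O : V ≃ₗᵢ[ℝ] V) : |LinearMap.det (O.toLinearEquiv : V →ₗ[ℝ] V)| = 1 := by
  let b := stdOrthonormalBasis ℝ V
  have h1 := Basis.det_comp b.toBasis (O.toLinearEquiv : V →ₗ[ℝ] V) b.toBasis
  have h2 : (O.toLinearEquiv : V →ₗ[ℝ] V) ∘ b.toBasis = b.map O := by ext; simp
  rw [Basis.det_self, mul_one, h2] at h1
  rcases b.det_to_matrix_orthonormalBasis_real (b.map O) with h | h <;> rw [← h1, h] <;> simp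

/-- The index is the quotient of covolumes, and the map r·O carries L₂ onto L₁ with determinant of
absolute value r to the dimension. -/
theorem relIndex_lattice_of_image {L₁ L₂ : Submodule ℤ V} [DiscreteTopology L₁] [IsZLattice ℝ L₁]
    [DiscreteTopology L₂] [IsZLattice ℝ L₂] (h : L₁ ≤ L₂) (O : V ≃ₗᵢ[ℝ] V) {r : ℝ} (hr : 0 < r)
    (h1 : ∀ t, t ∈ L₂ ↔ r • O t ∈ L₁) :
    (L₁.toAddSubgroup.relIndex L₂.toAddSubgroup : ℝ) = r ^ finrank ℝ V := by
  classical
  borelize V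
  rw [← ZLattice.covolume_div_covolume_eq_relIndex' L₁ L₂ h]
  let e : L₂ ≃ₗ[ℤ] L₁ :=
    { toFun := fun t => ⟨r • O t, (h1 t).1 t.2⟩
      map_add' := fun s t => by ext; simp
      map_smul' := fun z t => by ext; simp [smul_comm r z]
      invFun := fun t => ⟨r⁻¹ • O.symm t, (h1 _).2 (by simp [hr.ne'])⟩
      left_inv := fun t => by ext; simp [hr.ne']
      right_inv := fun t => by ext; simp [hr.ne'] }
  let b := Free.chooseBasis ℤ L₂
  let b0 := b.ofZLatticeBasis ℝ L₂
  rw [ZLattice.covolume_eq_det_mul_measureReal L₂ MeasureTheory.volume b b0,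
    ZLattice.covolume_eq_det_mul_measureReal L₁ MeasureTheory.volume (b.map e) b0]
  have h2 : ((↑) ∘ (b.map e) : _ → V) = (r • (O.toLinearEquiv : V →ₗ[ℝ] V)) ∘ ((↑) ∘ b) := by
    ext i; simp [e]
  have h3 := ZLattice.covolume_ne_zero L₂ MeasureTheory.volume
  rw [ZLattice.covolume_eq_det_mul_measureReal L₂ MeasureTheory.volume b b0] at h3
  rw [h2, Basis.det_comp, LinearMap.det_smul, abs_mul, abs_mul, abs_det_isometry, mul_one,
    abs_of_pos (by positivity), mul_assoc, mul_div_assoc, div_self h3, mul_one]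

/-- The stabilizer of v is generated by the facets of C through v, and specialness puts these
mirrors in G. -/
theorem mem_of_apply_eq {C : Affine.Simplex ℝ V n} {G : Subgroup (V ≃ᵃⁱ[ℝ] V)} (hC : IsCoxeter C)
    {v : V} (hvC : v ∈ region (root C)) (hN : normals G = normals (reflGroup C))
    (hs : IsSpecial G v) {w : V ≃ᵃⁱ[ℝ] V} (hw : w ∈ reflGroup C) (hwv : w v = v) : w ∈ G := by
  have h1 := (eq_and_mem_gpAt (isCoxFamily_root C hC) (by rwa [gp_root]) hvC (hwv.symm ▸ hvC)).2
  refine (Subgroup.closure_le (K := G)).2 ?_ h1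
  rintro _ ⟨i, hi, rfl⟩
  rw [eq_rt hi]
  exact hs _ (hN ▸ root_mem_normals C i)

/-- The index is a power of the ratio of similarity. -/
theorem relIndex_eq_pow {C P : Affine.Simplex ℝ V n} (hC : IsCoxeter C) (hP : IsCoxeter P)
    (hle : reflGroup P ≤ reflGroup C) (hN : normals (reflGroup P) = normals (reflGroup C))
    {v : V} (hvC : v ∈ region (root C)) (hs : IsSpecial (reflGroup P) v)
    {σ : Fin (n + 1) ≃ Fin (n + 1)} {S : Sim V} (hS : ∀ i, root C (σ i) = S.push (root P i)) :
    ((reflGroup P).relIndex (reflGroup C) : ℝ) = S.r⁻¹ ^ n := by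
  have := discrete_transLattice hC
  have := discrete_transLattice hP
  have : IsZLattice ℝ (transLattice (reflGroup C)) := ⟨span_transLattice hC⟩
  have : IsZLattice ℝ (transLattice (reflGroup P)) := ⟨span_transLattice hP⟩
  have hsC := hs.mono hle hN
  rw [relIndex_eq_relIndex_transGroup fun g hg => by
    obtain ⟨t, ht, w, hw, hwv, h⟩ := exists_eq_trans_mul hsC hg
    exact ⟨t, ht, w, mem_of_apply_eq hC hvC hN hs hw hwv, h⟩]
  have h1 := relIndex_lattice_of_image (L₁ := transLattice (reflGroup P))
    (L₂ := transLattice (reflGroup C)) (fun t ht => hle ht) S.symm.O S.symm.hr fun t =>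
      ⟨fun ht => Sim.trans_mem (Sim.symm_push hS) ht, fun ht => by
        have h2 := Sim.trans_mem hS (t := S.symm.r • S.symm.O t) ht
        rw [map_smul, smul_smul, show S.r * S.symm.r = 1 from mul_inv_cancel₀ S.hr.ne', one_smul,
          show S.O (S.symm.O t) = t from S.O.apply_symm_apply t] at h2
        exact h2⟩
  rw [hV.out] at h1
  exact h1

end Lattice

/-! ### Spacing of parallel mirrors and the possible heights. -/

/-- A set of reals that is closed under its own point reflections and has no small positive element
consists of integer multiples. -/
theorem exists_eq_int_mul {S : Set ℝ} (h0 : (0 : ℝ) ∈ S) (hS : ∀ a ∈ S, ∀ b ∈ S, 2 * a - b ∈ S)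
    {H f : ℝ} (hH : H ∈ S) (hpos : 0 < H) (hf : ∀ x ∈ S, 0 < x → f ≤ x) (hfH : 2 / 3 * H ≤ f) :
    ∀ x ∈ S, ∃ k : ℤ, x = k * H := by
  -- Two point reflections compose to a translation by twice the distance of their centres.
  have htr : ∀ a ∈ S, ∀ b ∈ S, ∀ x ∈ S, ∀ m : ℤ, x - m • (2 * (a - b)) ∈ S := by
    intro a ha b hb x hx m
    induction m using Int.induction_on with
    | zero => simpa using hx
    | succ k ih =>
      have := hS b hb _ (hS a ha _ ih)
      convert this using 1
      simp only [zsmul_eq_mul]; push_cast; ring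
    | pred k ih =>
      have := hS a ha _ (hS b hb _ ih)
      convert this using 1
      simp only [zsmul_eq_mul]; push_cast; ring
  have key : ∀ z ∈ S, 0 < z → z < H → False := by
    intro z hz hz0 hzH
    have hz1 := hf z hz hz0
    have hd : 0 < 2 * (H - z) := by linarith
    obtain ⟨m, ⟨hm1, hm2⟩, -⟩ := existsUnique_sub_zsmul_mem_Ioc hd H 0
    have h1 := htr H hH z hz H hH m
    have h2 := hf _ h1 hm1
    have h3 : z = 2 / 3 * H := by linarith
    have h4 := hS z hz H hH
    have := hf _ h4 (by linarith)
    linarith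
  intro x hx
  obtain ⟨m, ⟨hm1, hm2⟩, -⟩ := existsUnique_sub_zsmul_mem_Ico (by linarith : (0 : ℝ) < 2 * (H - 0)) x 0
  have h1 := htr H hH 0 h0 x hx m
  set y := x - m • (2 * (H - 0)) with hy
  rw [zsmul_eq_mul] at hy
  rcases hm1.eq_or_lt with h2 | h2
  · exact ⟨2 * m, by push_cast; linarith⟩
  rcases lt_trichotomy y H with h3 | h3 | h3
  · exact (key y h1 h2 h3).elim
  · exact ⟨2 * m + 1, by push_cast; linarith⟩
  · exact (key _ (hS H hH y h1) (by linarith) (by linarith)).elim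

/-- The affine function with gradient `u` and value `H` at `v`. -/
noncomputable def mirror (u v : V) (H : ℝ) : V × ℝ := (u, H - ⟪u, v⟫)

theorem ev_mirror (u v : V) (H : ℝ) (x : V) : ev (mirror u v H) x = ⟪u, x - v⟫ + H := by
  simp only [ev, mirror, inner_sub_right]; ring

theorem eq_mirror (a : V × ℝ) (v : V) : a = mirror a.1 v (ev a v) := by
  refine Prod.ext rfl ?_
  simp only [ev, mirror]; ring

theorem refl_mirror {u v : V} (hu : ‖u‖ = 1) (H K : ℝ) :
    refl (mirror u v (2 * H - K)) =
      refl (mirror u v H) * refl (mirror u v K) * (refl (mirror u v H))⁻¹ := by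
  rw [← refl_act _ (a := mirror u v K) hu, act_refl (a := mirror u v H) hu]
  rw [← refl_neg (a := mirror u v (2 * H - K)) hu]
  congr 1
  simp only [mirror, real_inner_self_eq_norm_sq, hu]
  ext
  · simp only [Prod.fst_neg, Prod.fst_sub, Prod.smul_fst]; module
  · simp only [Prod.snd_neg, Prod.snd_sub, Prod.smul_snd, smul_eq_mul]; ring

section Simplex

variable {n : ℕ} [NeZero n] {C P : Affine.Simplex ℝ V n}
variable [FiniteDimensional ℝ V] [hV : Fact (finrank ℝ V = n)] {c0 : Fin (n + 1)}

/-- The mirrors of a fixed direction are equally spaced if there is one that is close enough to the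
special vertex. -/
theorem exists_eq_nat_mul (hC : IsCoxeter C) (hs : IsSpecial (reflGroup C) (C.points c0))
    {b : V × ℝ} (hb : ‖b.1‖ = 1) (hbm : refl b ∈ reflGroup C) (hb0 : 0 < ev b (C.points c0))
    {i : Fin (n + 1)} (hi : ev b (C.points i) ≤ ev b (C.points c0) / 3)
    {a : V × ℝ} (hab : a.1 = b.1) (ham : refl a ∈ reflGroup C) (ha0 : 0 < ev a (C.points c0)) :
    ∃ k : ℕ, 0 < k ∧ ev a (C.points c0) = k * ev b (C.points c0) := by
  obtain ⟨q, hq⟩ := exists_interior C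
  set v := C.points c0
  have h0 : refl (mirror b.1 v 0) ∈ reflGroup C := by
    have := hs _ (mem_normals_of_refl_mem hb hbm)
    rwa [rt, ← zero_sub] at this
  obtain ⟨k, hk⟩ := exists_eq_int_mul (S := {H | refl (mirror b.1 v H) ∈ reflGroup C})
    (H := ev b v) (f := ev b v - ev b (C.points i)) h0
    (fun H hH K hK => by
      rw [Set.mem_ofPred_eq, refl_mirror hb]
      exact mul_mem (mul_mem hH hK) (inv_mem hH))
    (by rw [Set.mem_ofPred_eq, ← eq_mirror]; exact hbm) hb0
    -- A mirror of this direction that is positive at v cannot cut C, so it is nonnegative at the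
    -- vertex i as well. This bounds its height at v from below, and the factor 1/3 in the
    -- hypothesis makes the bound 2/3 of the height of b.
    (fun H hH hpos => by
      have h1 := nonneg_of_pos_of_refl_mem (isCoxFamily_root C hC) (b := mirror b.1 v H) hb
        (by rw [gp_root]; exact hH) hq (points_mem_region C c0)
        (by rw [ev_mirror, sub_self, inner_zero_right, zero_add]; exact hpos)
        (points_mem_region C i)
      rw [ev_mirror, ← ev_sub_ev] at h1
      linarith)
    (by linarith) (ev a v) (by rw [Set.mem_ofPred_eq, ← hab, ← eq_mirror]; exact ham)
  have hk0 : 0 < k := by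
    rw [hk] at ha0
    exact_mod_cast pos_of_mul_pos_left ha0 hb0.le
  refine ⟨k.toNat, by omega, ?_⟩
  rw [hk]
  congr 1
  exact_mod_cast (Int.toNat_of_nonneg hk0.le).symm

theorem act_refl_root (i : Fin (n + 1)) (b : V × ℝ) :
    act (refl (root C i)) b = b - (2 * ⟪(root C i).1, b.1⟫) • root C i :=
  act_refl (norm_root C i) b

theorem refl_act_mem {g : V ≃ᵃⁱ[ℝ] V} (hg : g ∈ reflGroup C) (i : Fin (n + 1)) :
    refl (act g (root C i)) ∈ reflGroup C := by
  rw [refl_act g (norm_root C i)]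
  refine mul_mem (mul_mem hg ?_) (inv_mem hg)
  rw [← gp_root]; exact refl_mem_gp _ _

theorem refl_root_mem (i : Fin (n + 1)) : refl (root C i) ∈ reflGroup C := by
  rw [← gp_root]; exact refl_mem_gp _ _

/-- This exhibits an actual mirror of G_C in the new direction and near the special vertex, as
`exists_eq_nat_mul` requires. The analogues for G̃₂ and F̃₄ play the same role. -/
theorem IsTypeC.act_eq {u : V} {f₀ f₁ f₂ : Fin (n + 1)} (h : IsTypeC C u f₀ f₁ f₂) :
    act (refl (root C f₀)) (root C f₁) = root C f₁ + √2 • root C f₀ := by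
  rw [act_refl_root, h.inner₀₁]; module

theorem IsTypeG.act_eq {u : V} {f₀ f₁ f₂ : Fin (n + 1)} (h : IsTypeG C u f₀ f₁ f₂) :
    act (refl (root C f₀) * refl (root C f₁)) (root C f₂) =
      root C f₂ + √3 • root C f₁ + √3 • root C f₀ := by
  rw [act_mul, act_refl_root f₁, act_refl_root f₀, h.inner₁₂]
  simp only [Prod.fst_sub, Prod.smul_fst, inner_sub_right, real_inner_smul_right, h.inner₀₁, h.inner₀₂]
  module

theorem IsTypeF.act_eq {u : V} {f₀ f₁ f₂ f₃ f₄ : Fin (n + 1)} (h : IsTypeF C u f₀ f₁ f₂ f₃ f₄) :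
    act (refl (root C f₄) * refl (root C f₃) * refl (root C f₂)) (root C f₁) =
      root C f₁ + √2 • (root C f₂ + root C f₃ + root C f₄) := by
  rw [act_mul, act_mul, act_refl_root f₂, act_refl_root f₃, act_refl_root f₄]
  simp only [Prod.fst_sub, Prod.smul_fst, inner_sub_right, real_inner_smul_right,
    real_inner_comm (root C f₁).1 (root C f₂).1, real_inner_comm (root C f₁).1 (root C f₃).1,
    real_inner_comm (root C f₁).1 (root C f₄).1, real_inner_comm (root C f₂).1 (root C f₃).1,
    real_inner_comm (root C f₂).1 (root C f₄).1, real_inner_comm (root C f₃).1 (root C f₄).1,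
    h.inner₁₂, h.inner₁₃, h.inner₁₄, h.inner₂₃, h.inner₂₄, h.inner₃₄]
  module

theorem IsTypeC.exists_height (hC : IsCoxeter C) {f₁ f₂ : Fin (n + 1)} {a : V × ℝ}
    (hs : IsSpecial (reflGroup C) (C.points c0)) (h : IsTypeC C a.1 c0 f₁ f₂)
    (ham : refl a ∈ reflGroup C) (ha0 : 0 < ev a (C.points c0)) :
    ∃ k : ℕ, 0 < k ∧ ev a (C.points c0) = k * (√2 * C.height c0) := by
  have h1 : ev (root C f₁ + √2 • root C c0) (C.points c0) = √2 * C.height c0 := by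
    rw [ev_add, ev_smul, ev_root_self, ev_root_of_ne C h.ne₀₁, zero_add]
  have hh := C.height_pos c0
  have h2 : ev (root C f₁ + √2 • root C c0) (C.points f₂) = 0 := by
    rw [ev_add, ev_smul, ev_root_of_ne C h.ne₁₂.symm, ev_root_of_ne C h.ne₀₂.symm]; simp
  rw [← h1]
  refine exists_eq_nat_mul hC hs ?_ ?_ ?_ (i := f₂) ?_ h.eq ham ha0
  · rw [← h.act_eq, norm_act, norm_root]
  · rw [← h.act_eq]; exact refl_act_mem (refl_root_mem _) _
  · rw [h1]; positivity
  · rw [h1, h2]; positivity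

/-- Unlike in types C̃₂ and F̃₄, the mirror does not pass through the test vertex. Its value there
is exactly one third of that at the special vertex, the limiting case of `exists_eq_nat_mul`. -/
theorem IsTypeG.exists_height (hC : IsCoxeter C) {f₁ f₂ : Fin (n + 1)} {a : V × ℝ}
    (hs : IsSpecial (reflGroup C) (C.points c0)) (h : IsTypeG C a.1 c0 f₁ f₂)
    (ham : refl a ∈ reflGroup C) (ha0 : 0 < ev a (C.points c0)) :
    ∃ k : ℕ, 0 < k ∧ ev a (C.points c0) = k * (√3 * C.height c0) := by
  have s3 : √3 * √3 = 3 := Real.mul_self_sqrt (by norm_num)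
  have h1 : ev (root C f₂ + √3 • root C f₁ + √3 • root C c0) (C.points c0) = √3 * C.height c0 := by
    rw [ev_add, ev_add, ev_smul, ev_smul, ev_root_self, ev_root_of_ne C h.ne₀₁,
      ev_root_of_ne C h.ne₀₂]
    simp
  have hh := C.height_pos c0
  have h2 : ev (root C f₂ + √3 • root C f₁ + √3 • root C c0) (C.points f₂) = C.height f₂ := by
    rw [ev_add, ev_add, ev_smul, ev_smul, ev_root_self, ev_root_of_ne C h.ne₁₂.symm,
      ev_root_of_ne C h.ne₀₂.symm]
    simp
  -- The null vector of G̃₂. Paired with an edge it gives the ratio √3 of the two heights.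
  have hnull : (root C c0).1 + (2 : ℝ) • (root C f₁).1 + √3 • (root C f₂).1 = 0 := by
    refine eq_zero_of_orthogonal C (i0 := c0) fun i hi => ?_
    have self : ∀ i, ⟪(root C i).1, (root C i).1⟫ = 1 := fun i => by
      rw [real_inner_self_eq_norm_sq, norm_root, one_pow]
    simp only [inner_add_right, real_inner_smul_right]
    rcases (h.cover i).resolve_left hi with rfl | rfl
    · rw [real_inner_comm, h.inner₀₁, self, h.inner₁₂]; linarith
    · rw [real_inner_comm, h.inner₀₂, real_inner_comm (root C f₁).1, h.inner₁₂, self]; ring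
  have h3 : √3 * C.height f₂ = C.height c0 := by
    have h4 := congrArg (fun x => ⟪x, C.points f₂ - C.points c0⟫) hnull
    simp only [inner_add_left, real_inner_smul_left, inner_zero_left, ← ev_sub_ev,
      ev_root_self, ev_root_of_ne C h.ne₁₂.symm, ev_root_of_ne C h.ne₀₂.symm,
      ev_root_of_ne C h.ne₀₁, ev_root_of_ne C h.ne₀₂] at h4
    linarith
  rw [← h1]
  refine exists_eq_nat_mul hC hs ?_ ?_ ?_ (i := f₂) ?_ h.eq ham ha0
  · rw [← h.act_eq, norm_act, norm_root]
  · rw [← h.act_eq]; exact refl_act_mem (mul_mem (refl_root_mem _) (refl_root_mem _)) _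
  · rw [h1]; positivity
  · rw [h1, h2, ← h3, ← mul_assoc, s3]; linarith

theorem IsTypeF.exists_height (hC : IsCoxeter C) {f₀ f₁ f₂ f₃ : Fin (n + 1)} {a : V × ℝ}
    (hs : IsSpecial (reflGroup C) (C.points c0)) (h : IsTypeF C a.1 f₀ f₁ f₂ f₃ c0)
    (ham : refl a ∈ reflGroup C) (ha0 : 0 < ev a (C.points c0)) :
    ∃ k : ℕ, 0 < k ∧ ev a (C.points c0) = k * (√2 * C.height c0) := by
  have h1 : ev (root C f₁ + √2 • (root C f₂ + root C f₃ + root C c0)) (C.points c0) =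
      √2 * C.height c0 := by
    simp only [ev_add, ev_smul, ev_root_self, ev_root_of_ne C h.ne₁₄.symm,
      ev_root_of_ne C h.ne₂₄.symm, ev_root_of_ne C h.ne₃₄.symm]
    ring
  have hh := C.height_pos c0
  have h2 : ev (root C f₁ + √2 • (root C f₂ + root C f₃ + root C c0)) (C.points f₀) = 0 := by
    simp only [ev_add, ev_smul, ev_root_of_ne C h.ne₀₁, ev_root_of_ne C h.ne₀₂,
      ev_root_of_ne C h.ne₀₃, ev_root_of_ne C h.ne₀₄]
    ring
  rw [← h1]
  refine exists_eq_nat_mul hC hs ?_ ?_ ?_ (i := f₀) ?_ h.eq ham ha0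
  · rw [← h.act_eq, norm_act, norm_root]
  · rw [← h.act_eq]
    exact refl_act_mem (mul_mem (mul_mem (refl_root_mem _) (refl_root_mem _)) (refl_root_mem _)) _
  · rw [h1]; positivity
  · rw [h1, h2]; positivity

/-- The fundamental simplex `C` of the larger group has the same cone as `P` at a vertex that is
special for the smaller group. -/
structure IsAligned (C P : Affine.Simplex ℝ V n) (c0 : Fin (n + 1)) : Prop where
  left : IsCoxeter C
  right : IsCoxeter P
  le : reflGroup P ≤ reflGroup C
  normals_eq : normals (reflGroup P) = normals (reflGroup C)
  special : IsSpecial (reflGroup P) (P.points c0)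
  vertex : C.points c0 = P.points c0
  root_eq : ∀ j ≠ c0, root P j = root C j
  gram : ∃ σ : Fin (n + 1) ≃ Fin (n + 1), σ c0 = c0 ∧
    ∀ i j, ⟪(root P i).1, (root P j).1⟫ = ⟪(root C (σ i)).1, (root C (σ j)).1⟫

theorem IsAligned.special' (h : IsAligned C P c0) : IsSpecial (reflGroup C) (C.points c0) :=
  h.vertex ▸ h.special.mono h.le h.normals_eq

theorem IsAligned.relIndex_eq (h : IsAligned C P c0) :
    ((reflGroup P).relIndex (reflGroup C) : ℝ) = (P.height c0 / C.height c0) ^ n := by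
  obtain ⟨σ, hσ0, hσ⟩ := h.gram
  obtain ⟨S, hS⟩ := exists_sim_of_gram hσ
  rw [relIndex_eq_pow h.left h.right h.le h.normals_eq (h.vertex ▸ points_mem_region C c0) h.special hS]
  have h1 := Sim.height hS c0
  have h2 := P.height_pos c0
  have h3 := S.hr
  rw [hσ0] at h1
  rw [h1]
  congr 1
  field_simp

theorem IsAligned.cases (h : IsAligned C P c0) :
    ((root P c0).1 = (root C c0).1 ∧ ∃ k : ℕ, 0 < k ∧ P.height c0 = k * C.height c0) ∨
    (∃ f₁ f₂, IsTypeC C (root P c0).1 c0 f₁ f₂ ∧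
      ∃ k : ℕ, 0 < k ∧ P.height c0 = k * (√2 * C.height c0)) ∨
    (∃ f₁ f₂, IsTypeG C (root P c0).1 c0 f₁ f₂ ∧
      ∃ k : ℕ, 0 < k ∧ P.height c0 = k * (√3 * C.height c0)) ∨
    ∃ f₀ f₁ f₂ f₃, IsTypeF C (root P c0).1 f₀ f₁ f₂ f₃ c0 ∧
      ∃ k : ℕ, 0 < k ∧ P.height c0 = k * (√2 * C.height c0) := by
  obtain ⟨σ, hσ0, hσ⟩ := h.gram
  have hev : P.height c0 = ev (root P c0) (C.points c0) := by rw [h.vertex, ev_root_self]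
  have hpos : 0 < ev (root P c0) (C.points c0) := by rw [← hev]; exact P.height_pos c0
  have hm : refl (root P c0) ∈ reflGroup C := h.le (refl_root_mem c0)
  rw [hev]
  rcases classification h.left h.special' h.right h.root_eq
    (mem_normals_of_refl_mem (norm_root P c0) hm) hσ0 hσ with h1 | ⟨f₁, f₂, h1⟩ | ⟨f₁, f₂, h1⟩ |
    ⟨f₀, f₁, f₂, f₃, h1⟩
  · refine Or.inl ⟨h1, ?_⟩
    obtain ⟨i, hi⟩ := exists_ne_index c0
    rw [← ev_root_self C c0]
    refine exists_eq_nat_mul h.left h.special' (norm_root C c0) (refl_root_mem c0)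
      (by rw [ev_root_self]; exact C.height_pos c0) (i := i) ?_ h1 hm hpos
    rw [ev_root_of_ne C hi, ev_root_self]
    exact div_nonneg (C.height_pos c0).le (by norm_num)
  · exact Or.inr (Or.inl ⟨f₁, f₂, h1, h1.exists_height h.left h.special' hm hpos⟩)
  · exact Or.inr (Or.inr (Or.inl ⟨f₁, f₂, h1, h1.exists_height h.left h.special' hm hpos⟩))
  · exact Or.inr (Or.inr (Or.inr ⟨f₀, f₁, f₂, f₃, h1, h1.exists_height h.left h.special' hm hpos⟩))

end Simplex

/-! ### Uniqueness for a given index, and maximality. -/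

section Simplex

variable {n : ℕ} [NeZero n] {C P F : Affine.Simplex ℝ V n}
variable [FiniteDimensional ℝ V] [hV : Fact (finrank ℝ V = n)] {c0 p0 : Fin (n + 1)}

theorem hasDiagram_of_gram {B : Type} {M : CoxeterMatrix B} (hC : HasDiagram C M)
    {e : Fin (n + 1) ≃ Fin (n + 1)}
    (h : ∀ i j, ⟪(root P i).1, (root P j).1⟫ = ⟪(root C (e i)).1, (root C (e j)).1⟫) :
    HasDiagram P M := by
  obtain ⟨σ, h1⟩ := hC
  refine ⟨e.trans σ, (matchesDiagram_iff P M _).2 fun i j => ?_⟩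
  rw [h, (matchesDiagram_iff C M σ).1 h1]
  rfl

theorem hasDiagram_move {B : Type} {M : CoxeterMatrix B} (hC : HasDiagram C M) (g : V ≃ᵃⁱ[ℝ] V) :
    HasDiagram (move g C) M :=
  hasDiagram_of_gram hC (e := Equiv.refl _) fun i j => by
    rw [root_move, root_move, inner_act]; rfl

theorem SameDiagram.move_left (h : SameDiagram P F) (g : V ≃ᵃⁱ[ℝ] V) : SameDiagram (move g P) F :=
  let ⟨M, h1, h2⟩ := h
  ⟨M, hasDiagram_move h1 g, h2⟩

theorem SameDiagram.move_right (h : SameDiagram P F) (g : V ≃ᵃⁱ[ℝ] V) : SameDiagram P (move g F) :=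
  let ⟨M, h1, h2⟩ := h
  ⟨M, h1, hasDiagram_move h2 g⟩

theorem exists_chamber_vertex (hF : IsCoxeter F) {v : V} (hs : IsSpecial (reflGroup F) v) :
    ∃ g ∈ reflGroup F, ∃ i, (move g F).points i = v := by
  obtain ⟨q, hq⟩ := exists_interior F
  obtain ⟨g, hg, hgv⟩ := exists_apply_mem_region (isCoxFamily_root F hF) hq v
  rw [gp_root] at hg
  obtain ⟨i, hi⟩ := eq_vertex_of_isSpecial F hF hgv (hs.apply hg)
  refine ⟨g⁻¹, inv_mem hg, i, ?_⟩
  rw [move_points, ← hi]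
  exact g.symm_apply_apply v

/-- The smaller simplex can be moved by its group, and its vertices relabelled, so that it becomes
aligned. -/
theorem exists_isAligned_move (h : SameDiagram P C) (hle : reflGroup P ≤ reflGroup C)
    (hv : C.points c0 = P.points p0) (hs : IsSpecial (reflGroup P) (P.points p0)) :
    ∃ Q : Affine.Simplex ℝ V n, reflGroup Q = reflGroup P ∧ IsAligned C Q c0 := by
  obtain ⟨hP, hC⟩ := h.isCoxeter
  have hN := normals_eq h hle
  obtain ⟨w, hw, hwv, ρ, hρ0, hρ⟩ := exists_aligned hC hP hle hN hv hs
  obtain ⟨τ, hτ⟩ := h.exists_equiv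
  have hG : reflGroup ((move w P).reindex ρ) = reflGroup P := by
    rw [reflGroup_reindex, reflGroup_move_of_mem P hw]
  have hpt : ((move w P).reindex ρ).points c0 = P.points p0 := by
    rw [Affine.Simplex.reindex_points, Function.comp_apply, ← hρ0, ρ.symm_apply_apply]
    exact hwv
  have hgram : ∀ i j, ⟪(root ((move w P).reindex ρ) i).1, (root ((move w P).reindex ρ) j).1⟫ =
      ⟪(root C ((ρ.symm.trans τ) i)).1, (root C ((ρ.symm.trans τ) j)).1⟫ := fun i j => by
    rw [root_reindex, root_reindex, root_move, root_move, inner_act, hτ]; rfl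
  have hs' : IsSpecial (reflGroup ((move w P).reindex ρ)) (((move w P).reindex ρ).points c0) := by
    rw [hG, hpt]; exact hs
  refine ⟨(move w P).reindex ρ, hG, hC, isCoxeter_of_gram hC _ hgram, hG.le.trans hle,
    by rw [hG, hN], hs', by rw [hpt, hv], fun j hj => ?_,
    exists_gram_equiv_fix hC hgram hs' (hv ▸ hs.mono hle hN)⟩
  obtain ⟨i, rfl⟩ := ρ.surjective j
  rw [root_reindex, ρ.symm_apply_apply, hρ i (by rintro rfl; exact hj hρ0)]

/-- There is a fundamental simplex of the larger group which is aligned with the given simplex. -/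
theorem exists_isAligned (h : SameDiagram P F) (hle : reflGroup P ≤ reflGroup F) :
    ∃ (C : Affine.Simplex ℝ V n) (c0 : Fin (n + 1)), IsChamber C F ∧ reflGroup C = reflGroup F ∧
      (∃ e : Fin (n + 1) ≃ Fin (n + 1), ∀ i j,
        ⟪(root F i).1, (root F j).1⟫ = ⟪(root C (e i)).1, (root C (e j)).1⟫) ∧ IsAligned C P c0 := by
  obtain ⟨hP, hF⟩ := h.isCoxeter
  have hN := normals_eq h hle
  obtain ⟨p0, hs⟩ := exists_special_vertex P hP
  obtain ⟨g, hg, c0, hgv⟩ := exists_chamber_vertex hF (hs.mono hle hN)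
  have hG : reflGroup (move g F) = reflGroup F := reflGroup_move_of_mem F hg
  have h' := h.move_right g
  rw [← hG] at hle hN
  -- The element w would move P. Its inverse is applied to the fundamental simplex instead, so P
  -- stays as given.
  obtain ⟨w, hw, hwv, ρ, hρ0, hρ⟩ := exists_aligned h'.isCoxeter.2 hP hle hN hgv hs
  have hwv' : w⁻¹ (P.points p0) = P.points p0 := by
    rw [AffineIsometryEquiv.coe_inv, AffineIsometryEquiv.symm_apply_eq, hwv]
  obtain ⟨τ, hτ⟩ := h.exists_equiv
  set C := (move w⁻¹ (move g F)).reindex ρ.symm with hCdef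
  have hroot : ∀ j, root C j = act w⁻¹ (act g (root F (ρ j))) := fun j => by
    rw [hCdef, root_reindex, root_move, root_move, Equiv.symm_symm]
  have hGC : reflGroup C = reflGroup F := by
    rw [hCdef, reflGroup_reindex, reflGroup_move_of_mem _ (inv_mem (hle hw)), hG]
  have hpt : C.points p0 = P.points p0 := by
    rw [hCdef, Affine.Simplex.reindex_points, Function.comp_apply, Equiv.symm_symm, hρ0,
      move_points, hgv, hwv']
  have hinner : ∀ i j, ⟪(root C i).1, (root C j).1⟫ = ⟪(root F (ρ i)).1, (root F (ρ j)).1⟫ :=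
    fun i j => by rw [hroot, hroot, inner_act, inner_act]
  have hCF : IsCoxeter C := isCoxeter_of_gram hF ρ hinner
  have hgram : ∀ i j, ⟪(root P i).1, (root P j).1⟫ =
      ⟪(root C ((τ.trans ρ.symm) i)).1, (root C ((τ.trans ρ.symm) j)).1⟫ := fun i j => by
    rw [hinner, hτ]; simp
  rw [hG] at hle hN
  refine ⟨C, p0, ⟨w⁻¹ * g, mul_mem (inv_mem (hle (hw))) hg, ?_⟩, hGC, ⟨ρ.symm, fun i j => ?_⟩,
    hCF, hP, by rw [hGC]; exact hle, by rw [hGC, hN], hs, hpt, fun j hj => ?_,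
    exists_gram_equiv_fix hCF hgram hs (by rw [hGC, hpt]; exact hs.mono hle hN)⟩
  · rw [hCdef, Affine.Simplex.reindex_range_points, ← Set.range_comp]
    rfl
  · rw [hinner]; simp
  · have h1 := hρ j hj
    rw [root_move, root_move] at h1
    rw [hroot, h1, ← act_mul, inv_mul_cancel, act_one]

theorem root_eq_mirror (i : Fin (n + 1)) :
    root P i = mirror (root P i).1 (P.points i) (P.height i) := by
  rw [← ev_root_self, ← eq_mirror]

theorem reflGroup_eq_of_root_eq {Q : Affine.Simplex ℝ V n} (h : ∀ i, root P i = root Q i) :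
    reflGroup P = reflGroup Q := by
  rw [← gp_root, ← gp_root, funext h]

theorem nat_mul_ne_of_irrational {μ x : ℝ} (hμ : Irrational μ) (hx : 0 < x) {k l : ℕ} (hl : 0 < l)
    (h : k * x = l * (μ * x)) : False := by
  have hl' : (0 : ℝ) < l := by exact_mod_cast hl
  refine hμ ⟨(k : ℚ) / l, ?_⟩
  push_cast
  rw [div_eq_iff hl'.ne']
  have := mul_right_cancel₀ hx.ne' (h.trans (mul_assoc _ _ _).symm)
  linarith

theorem irrational_sqrt_three : Irrational √3 := by
  exact_mod_cast Nat.prime_three.irrational_sqrt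

theorem IsAligned.height_eq {Q : Affine.Simplex ℝ V n} (hP : IsAligned C P c0)
    (hQ : IsAligned C Q c0)
    (h : (reflGroup P).relIndex (reflGroup C) = (reflGroup Q).relIndex (reflGroup C)) :
    P.height c0 = Q.height c0 := by
  have h1 := hP.relIndex_eq
  rw [h, hQ.relIndex_eq] at h1
  have h2 := C.height_pos c0
  have h3 := P.height_pos c0
  have h4 := Q.height_pos c0
  have h5 := (pow_left_inj₀ (by positivity) (by positivity) (NeZero.ne n)).1 h1
  field_simp at h5
  exact h5.symm

theorem IsAligned.normal_mem (h : IsAligned C P c0) : (root P c0).1 ∈ normals (reflGroup C) :=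
  h.normals_eq ▸ root_mem_normals P c0

/-- Aligned simplices whose groups have the same index have the same group. -/
theorem IsAligned.reflGroup_eq {Q : Affine.Simplex ℝ V n} (hP : IsAligned C P c0)
    (hQ : IsAligned C Q c0)
    (h : (reflGroup P).relIndex (reflGroup C) = (reflGroup Q).relIndex (reflGroup C)) :
    reflGroup P = reflGroup Q := by
  have hh := hP.height_eq hQ h
  have hC := C.height_pos c0
  -- If the last facet of P is parallel to that of C, the common height is an integer multiple of
  -- the height of C. In the other cases it would be an irrational multiple, so the last facet of Q
  -- is parallel too.
  have key : ∀ {P Q : Affine.Simplex ℝ V n}, IsAligned C P c0 → IsAligned C Q c0 →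
      P.height c0 = Q.height c0 → (root P c0).1 = (root C c0).1 →
      (root Q c0).1 = (root C c0).1 := by
    intro P Q hP hQ hh hPθ
    have hk : ∃ k : ℕ, 0 < k ∧ P.height c0 = k * C.height c0 := by
      obtain ⟨i, hi⟩ := exists_ne_index c0
      have hm : refl (root P c0) ∈ reflGroup C := hP.le (refl_root_mem c0)
      have := exists_eq_nat_mul hP.left hP.special' (norm_root C c0) (refl_root_mem c0)
        (by rw [ev_root_self]; exact hC) (i := i) (by
          rw [ev_root_of_ne C hi, ev_root_self]; positivity) hPθ hm
        (by rw [hP.vertex, ev_root_self]; exact P.height_pos c0)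
      rwa [hP.vertex, ev_root_self, ← hP.vertex, ev_root_self] at this
    obtain ⟨k, -, hk⟩ := hk
    rcases hQ.cases with ⟨h1, -⟩ | ⟨_, _, -, l, hl, h1⟩ | ⟨_, _, -, l, hl, h1⟩ |
      ⟨_, _, _, _, -, l, hl, h1⟩
    · exact h1
    · exact (nat_mul_ne_of_irrational irrational_sqrt_two hC hl (by rw [← hk, hh, h1])).elim
    · exact (nat_mul_ne_of_irrational irrational_sqrt_three hC hl (by rw [← hk, hh, h1])).elim
    · exact (nat_mul_ne_of_irrational irrational_sqrt_two hC hl (by rw [← hk, hh, h1])).elim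
  have hθ : (root P c0).1 = (root Q c0).1 := by
    by_cases h1 : (root P c0).1 = (root C c0).1
    · rw [h1, key hP hQ hh h1]
    · by_cases h2 : (root Q c0).1 = (root C c0).1
      · exact absurd (key hQ hP hh.symm h2) h1
      · exact eq_of_ne_of_ne hP.left hP.special' hP.right hQ.right hP.root_eq hQ.root_eq
          hP.normal_mem hQ.normal_mem h1 h2
  refine reflGroup_eq_of_root_eq fun i => ?_
  by_cases hi : i = c0
  · rw [hi, root_eq_mirror, root_eq_mirror (P := Q), hθ, hh, ← hP.vertex, ← hQ.vertex]
  · rw [hP.root_eq i hi, hQ.root_eq i hi]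

theorem relIndex_move (g : V ≃ᵃⁱ[ℝ] V) :
    (reflGroup (move g P)).relIndex (reflGroup (move g F)) =
      (reflGroup P).relIndex (reflGroup F) := by
  have key : ∀ T : Affine.Simplex ℝ V n,
      reflGroup (move g T) = (reflGroup T).map (MulAut.conj g).toMonoidHom := by
    intro T
    ext x
    rw [reflGroup_move, Subgroup.mem_map]
    constructor
    · intro h
      exact ⟨_, h, by simp [mul_assoc]⟩
    · rintro ⟨y, hy, rfl⟩
      simpa [mul_assoc] using hy
  rw [key, key]
  exact Subgroup.relIndex_map_map_of_injective _ _ (MulAut.conj g).injective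

/-- Subgroups of the same index are conjugate under an isometry that normalizes the larger group. -/
theorem exists_normalizing_isometry {Q : Affine.Simplex ℝ V n} (hP : SameDiagram P F)
    (hQ : SameDiagram Q F) (hPF : reflGroup P ≤ reflGroup F) (hQF : reflGroup Q ≤ reflGroup F)
    (h : (reflGroup P).relIndex (reflGroup F) = (reflGroup Q).relIndex (reflGroup F)) :
    ∃ g : V ≃ᵃⁱ[ℝ] V, reflGroup (move g F) = reflGroup F ∧ reflGroup (move g P) = reflGroup Q := by
  obtain ⟨p0, hsP⟩ := exists_special_vertex P hP.isCoxeter.1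
  obtain ⟨q0, hsQ⟩ := exists_special_vertex Q hQ.isCoxeter.1
  have hsPF := hsP.mono hPF (normals_eq hP hPF)
  have hsQF := hsQ.mono hQF (normals_eq hQ hQF)
  obtain ⟨g, hg, c0, hgv⟩ := exists_chamber_vertex hQ.isCoxeter.2 hsQF
  have hG : reflGroup (move g F) = reflGroup F := reflGroup_move_of_mem F hg
  -- Translating a special vertex of P to one of Q normalizes G_F, since both are special for G_F.
  -- Afterwards both simplices can be aligned with the same fundamental simplex.
  set t := Q.points q0 - P.points p0 with ht
  have hF : reflGroup (move (trans t) F) = reflGroup F := reflGroup_move_trans hsPF hsQF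
  refine ⟨trans t, hF, ?_⟩
  have hle : reflGroup (move (trans t) P) ≤ reflGroup (move g F) := by
    intro x hx
    rw [reflGroup_move] at hx
    rw [hG, ← hF, reflGroup_move]
    exact hPF hx
  have hpt : (move (trans t) P).points p0 = Q.points q0 := by simp [ht]
  have hs : IsSpecial (reflGroup (move (trans t) P)) ((move (trans t) P).points p0) := by
    intro u hu
    obtain ⟨h1, c, hc⟩ := hu
    rw [reflGroup_move] at hc ⊢
    have h2 : act (trans t)⁻¹ (u, c) = (u, c - ⟪u, -t⟫) := by rw [← trans_neg, act_trans]
    have h3 : refl (u, c - ⟪u, -t⟫) ∈ reflGroup P := by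
      rw [← h2, refl_act _ h1, inv_inv]; exact hc
    have h4 := hsP u ⟨h1, _, h3⟩
    have h5 : act (trans t)⁻¹ (rt u ((move (trans t) P).points p0)) = rt u (P.points p0) := by
      rw [← trans_neg, act_trans, hpt]
      refine Prod.ext rfl ?_
      simp only [rt, ht, inner_neg_right, inner_sub_right]; ring
    rwa [← h5, refl_act _ (a := rt u ((move (trans t) P).points p0)) h1, inv_inv] at h4
  obtain ⟨P', hP', hPA⟩ := exists_isAligned_move ((hP.move_left (trans t)).move_right g) hle
    (hgv.trans hpt.symm) hs
  obtain ⟨Q', hQ', hQA⟩ := exists_isAligned_move (hQ.move_right g) (hG ▸ hQF) hgv hsQ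
  rw [← hP', ← hQ']
  refine hPA.reflGroup_eq hQA ?_
  have hidx := relIndex_move (P := P) (F := F) (trans t)
  rw [hF] at hidx
  rw [hP', hQ', hG, ← h, hidx]

theorem root_dilate_eq_mirror (v : V) (r : ℝ) (hr : 0 < r) (i : Fin (n + 1)) :
    root (dilate v r hr P) i = mirror (root P i).1 v (r * ev (root P i) v) :=
  root_dilate P v r hr i

theorem eq_of_root_eq {Q : Affine.Simplex ℝ V n} (h : ∀ i, root P i = root Q i) (i : Fin (n + 1)) :
    P.points i = Q.points i :=
  eq_point_of_ev_root Q fun j hj => by rw [← h]; exact ev_root_of_ne P hj.symm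

/-- A dilation about the common vertex fixes the facets through it and multiplies the height of the
parallel opposite facet by k. -/
theorem IsAligned.isHomothetic (h : IsAligned C P c0) (hC : IsChamber C F)
    (hθ : (root P c0).1 = (root C c0).1) {k : ℕ} (hk : 0 < k)
    (hh : P.height c0 = k * C.height c0) : IsHomothetic P F := by
  have hk' : (0 : ℝ) < k := by exact_mod_cast hk
  refine ⟨C, hC, P.points c0, k, hk, fun i => ?_⟩
  rw [← dilate_points C (P.points c0) _ hk']
  refine eq_of_root_eq (fun j => ?_) i
  rw [root_dilate_eq_mirror, ← h.vertex]
  by_cases hj : j = c0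
  · rw [hj, ev_root_self, ← hh, ← hθ, h.vertex, ← root_eq_mirror]
  · rw [ev_root_of_ne C (Ne.symm hj), mul_zero, h.root_eq j hj]
    conv_lhs => rw [eq_mirror (root C j) (C.points c0), ev_root_of_ne C (Ne.symm hj)]

/-- A maximal subgroup is not obtained by a proper dilation from a proper subgroup. -/
theorem IsAligned.eq_one_of_isMaximalIn (h : IsAligned C P c0) (hmax : IsMaximalIn P C) {k : ℕ}
    (hk : 0 < k) {μ : ℝ} (hμ : 1 < μ) (hh : P.height c0 = k * (μ * C.height c0)) {b : V × ℝ}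
    (hbm : refl b ∈ reflGroup C) (hb : b.1 = (root P c0).1)
    (hbv : ev b (C.points c0) = μ * C.height c0) : k = 1 := by
  have hk' : (0 : ℝ) < k := by exact_mod_cast hk
  have hC := C.height_pos c0
  obtain ⟨v, hv⟩ : ∃ v, v = P.points c0 := ⟨_, rfl⟩
  have hCv : C.points c0 = v := h.vertex.trans hv.symm
  rw [hCv] at hbv
  -- Contracting P by 1/k towards the special vertex turns its last facet into the mirror b of G_C
  -- and keeps the other facets. So G_{P₁} lies between G_P and G_C.
  obtain ⟨P₁, hP₁⟩ : ∃ P₁, P₁ = dilate v (k : ℝ)⁻¹ (inv_pos.2 hk') P := ⟨_, rfl⟩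
  have hr : ∀ j ≠ c0, root P₁ j = root P j := fun j hj => by
    rw [hP₁, root_dilate_eq_mirror, hv, ev_root_of_ne P (Ne.symm hj), mul_zero]
    conv_rhs => rw [eq_mirror (root P j) (P.points c0), ev_root_of_ne P (Ne.symm hj)]
  have hr0 : root P₁ c0 = b := by
    rw [hP₁, root_dilate_eq_mirror, eq_mirror b v, hb, hbv, hv, ev_root_self, hh]
    congr 1
    field_simp
  have hfst : ∀ j, (root P₁ j).1 = (root P j).1 := fun j => by
    by_cases hj : j = c0
    · rw [hj, hr0, hb]
    · rw [hr j hj]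
  have hpt : P₁.points c0 = v := by rw [hP₁, dilate_points, hv, AffineMap.homothety_apply_same]
  have hle₁ : reflGroup P₁ ≤ reflGroup C := by
    conv_lhs => rw [← gp_root]
    refine (Subgroup.closure_le _).2 ?_
    rintro _ ⟨j, rfl⟩
    by_cases hj : j = c0
    · simp only [hj, hr0]; exact hbm
    · simp only [hr j hj]; exact h.le (refl_root_mem j)
  have hle : reflGroup P ≤ reflGroup P₁ := by
    -- The parallel mirror through v lies in the stabilizer of v in G_P, which is generated by the
    -- facets that P and P₁ share.
    have h0 : refl (mirror b.1 v 0) ∈ reflGroup P₁ := by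
      have h1 := h.special _ (root_mem_normals P c0)
      have h2 := (eq_and_mem_gpAt (isCoxFamily_root P h.right) (by rwa [gp_root])
        (points_mem_region P c0) (by
          rw [(refl_eq_self_iff (a := rt (root P c0).1 (P.points c0)) (norm_root P c0) _).2
            (by rw [ev_rt, sub_self, inner_zero_right])]
          exact points_mem_region P c0)).2
      rw [mirror, hb, zero_sub, hv]
      refine (Subgroup.closure_le (K := reflGroup P₁)).2 ?_ h2
      rintro _ ⟨j, hj, rfl⟩
      have hj0 : j ≠ c0 := by
        rintro rfl
        rw [ev_root_self] at hj
        exact (P.height_pos j).ne' hj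
      rw [← hr j hj0]; exact refl_root_mem j
    have h1 : refl (mirror b.1 v (ev b v)) ∈ reflGroup P₁ := by
      rw [← eq_mirror, ← hr0]; exact refl_root_mem c0
    -- Starting from the mirrors at heights 0 and H, reflecting each in the next reaches every
    -- multiple of H, in particular the last facet of P. Carrying two consecutive heights makes the
    -- induction work.
    have hall : ∀ l : ℕ, refl (mirror b.1 v (l * ev b v)) ∈ reflGroup P₁ ∧
        refl (mirror b.1 v ((l + 1 : ℕ) * ev b v)) ∈ reflGroup P₁ := by
      intro l
      induction l with
      | zero => simpa using ⟨h0, h1⟩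
      | succ l ih =>
        refine ⟨ih.2, ?_⟩
        have : ((l + 1 + 1 : ℕ) : ℝ) * ev b v = 2 * ((l + 1 : ℕ) * ev b v) - l * ev b v := by
          push_cast; ring
        rw [this, refl_mirror (by rw [hb, norm_root])]
        exact mul_mem (mul_mem ih.2 ih.1) (inv_mem ih.2)
    conv_lhs => rw [← gp_root]
    refine (Subgroup.closure_le _).2 ?_
    rintro _ ⟨j, rfl⟩
    by_cases hj : j = c0
    · simp only [hj]
      rw [root_eq_mirror, hh, ← hbv, ← hb, ← hv]
      exact (hall k).1
    · simp only [← hr j hj]; exact refl_root_mem j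
  have hN : normals (reflGroup P₁) = normals (reflGroup C) :=
    (normals_mono hle₁).antisymm (h.normals_eq ▸ normals_mono hle)
  have hA : IsAligned C P₁ c0 := by
    refine ⟨h.left, isCoxeter_of_gram h.right (Equiv.refl _) fun i j => by rw [hfst, hfst]; rfl,
      hle₁, hN, ?_, by rw [hpt, hCv], fun j hj => by rw [hr j hj, h.root_eq j hj], ?_⟩
    · rw [hpt, hv]; exact h.special.mono hle (by rw [h.normals_eq, hN])
    · obtain ⟨σ, h1, h2⟩ := h.gram
      exact ⟨σ, h1, fun i j => by rw [hfst, hfst, h2]⟩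
  have hh₁ : P₁.height c0 = μ * C.height c0 := by
    rw [← ev_root_self, hr0, hpt, hbv]
  have hidx := hA.relIndex_eq
  rw [hh₁, mul_div_assoc, div_self hC.ne', mul_one] at hidx
  have hn : n ≠ 0 := NeZero.ne n
  rcases hle.eq_or_lt with h1 | h1
  · have h2 := h.height_eq hA (by rw [h1])
    rw [hh, hh₁] at h2
    have h3 : (0 : ℝ) < μ * C.height c0 := by positivity
    have h4 : (k : ℝ) = 1 := by
      have := mul_right_cancel₀ h3.ne' (h2.trans (one_mul _).symm)
      exact this
    exact_mod_cast h4
  -- The index of G_{P₁} in G_C is μⁿ > 1, so the second inclusion is strict and maximality excludes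
  -- a strict first one.
  · rcases hle₁.eq_or_lt with h2 | h2
    · rw [h2, Subgroup.relIndex_self, Nat.cast_one] at hidx
      exact absurd hidx (one_lt_pow₀ hμ hn).ne
    · exact absurd ⟨P₁, hA.right, h1, h2⟩ hmax.2

end Simplex

/-! ### Reading off facets and named diagrams from Gram matrices. -/

section Diagrams

variable {n : ℕ} [NeZero n] {C P F T T' : Affine.Simplex ℝ V n}
variable [FiniteDimensional ℝ V] [hV : Fact (finrank ℝ V = n)] {c0 : Fin (n + 1)}

theorem facet_eq_of_root_eq {i j : Fin (n + 1)} (h : root T i = root T' j) :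
    facet T i = facet T' j := by
  ext x; rw [mem_facet, mem_facet, h]

theorem facet_eq_map_of_root_eq {i j : Fin (n + 1)} {g : V ≃ᵃⁱ[ℝ] V}
    (h : root T i = act g (root T' j)) : facet T i = (facet T' j).map g.toAffineMap := by
  ext x; rw [mem_facet, map_facet_eq, h]

theorem IsChamber.reindex (h : IsChamber C F) (e : Fin (n + 1) ≃ Fin (n + 1)) :
    IsChamber (C.reindex e) F :=
  let ⟨g, hg, h⟩ := h
  ⟨g, hg, by rw [Affine.Simplex.reindex_range_points, h]⟩

theorem inner_root_self (i : Fin (n + 1)) : ⟪(root C i).1, (root C i).1⟫ = 1 := by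
  rw [real_inner_self_eq_norm_sq, norm_root, one_pow]

theorem hasDiagram_of_reindex {M : CoxeterMatrix (Fin (n + 1))} {e : Fin (n + 1) ≃ Fin (n + 1)}
    (h : MatchesDiagram (C.reindex e) M (Equiv.refl _)) : HasDiagram C M :=
  hasDiagram_of_gram (e := e) ⟨_, h⟩ fun i j => by rw [root_reindex, root_reindex]; simp

theorem matchesDiagram_of_lt {M : CoxeterMatrix (Fin (n + 1))}
    (h : ∀ i j, i < j → ⟪(root T i).1, (root T j).1⟫ = -Real.cos (π / (M i j : ℝ))) :
    MatchesDiagram T M (Equiv.refl _) := by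
  refine (matchesDiagram_iff T M _).2 fun i j => ?_
  rcases lt_trichotomy i j with hij | rfl | hij
  · exact h i j hij
  · rw [inner_root_self, M.diagonal]; simp
  · rw [real_inner_comm, h j i hij, M.symmetric]; rfl

theorem neg_cos_pi_div_two : -Real.cos (π / ((2 : ℕ) : ℝ)) = 0 := by simp
theorem neg_cos_pi_div_three : -Real.cos (π / ((3 : ℕ) : ℝ)) = -(1 / 2) := by
  rw [← Real.cos_pi_div_three]; norm_num
theorem neg_cos_pi_div_four : -Real.cos (π / ((4 : ℕ) : ℝ)) = -(√2 / 2) := by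
  rw [← Real.cos_pi_div_four]; norm_num
theorem neg_cos_pi_div_six : -Real.cos (π / ((6 : ℕ) : ℝ)) = -(√3 / 2) := by
  rw [← Real.cos_pi_div_six]; norm_num

theorem exists_equiv_three {f₀ f₁ f₂ : Fin (n + 1)} (h₀₁ : f₀ ≠ f₁) (h₀₂ : f₀ ≠ f₂) (h₁₂ : f₁ ≠ f₂)
    (hc : ∀ i, i = f₀ ∨ i = f₁ ∨ i = f₂) :
    ∃ e : Fin 3 ≃ Fin (n + 1), e 0 = f₀ ∧ e 1 = f₁ ∧ e 2 = f₂ := by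
  refine ⟨Equiv.ofBijective ![f₀, f₁, f₂] ⟨?_, fun i => ?_⟩, rfl, rfl, rfl⟩
  · intro i j hij
    fin_cases i <;> fin_cases j <;> simp_all
  · rcases hc i with rfl | rfl | rfl
    exacts [⟨0, rfl⟩, ⟨1, rfl⟩, ⟨2, rfl⟩]

theorem exists_equiv_five {f₀ f₁ f₂ f₃ f₄ : Fin (n + 1)} {u : V} (h : IsTypeF C u f₀ f₁ f₂ f₃ f₄) :
    ∃ e : Fin 5 ≃ Fin (n + 1), e 0 = f₀ ∧ e 1 = f₁ ∧ e 2 = f₂ ∧ e 3 = f₃ ∧ e 4 = f₄ := by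
  obtain ⟨h01, h02, h03, h04, h12, h13, h14, h23, h24, h34, hc, -⟩ := h
  refine ⟨Equiv.ofBijective ![f₀, f₁, f₂, f₃, f₄] ⟨?_, fun i => ?_⟩, rfl, rfl, rfl, rfl, rfl⟩
  · intro i j hij
    fin_cases i <;> fin_cases j <;> first
      | rfl
      | exact absurd hij (by assumption)
      | exact absurd hij (Ne.symm (by assumption))
  · rcases hc i with rfl | rfl | rfl | rfl | rfl
    exacts [⟨0, rfl⟩, ⟨1, rfl⟩, ⟨2, rfl⟩, ⟨3, rfl⟩, ⟨4, rfl⟩]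

end Diagrams

section Planar

variable [FiniteDimensional ℝ V]

theorem matchesDiagram_affineC₂ [NeZero 2] [Fact (finrank ℝ V = 2)] {T : Affine.Simplex ℝ V 2}
    (h₀₁ : ⟪(root T 0).1, (root T 1).1⟫ = -(√2 / 2)) (h₀₂ : ⟪(root T 0).1, (root T 2).1⟫ = 0)
    (h₁₂ : ⟪(root T 1).1, (root T 2).1⟫ = -(√2 / 2)) :
    MatchesDiagram T affineC₂ (Equiv.refl _) := by
  refine matchesDiagram_of_lt fun i j hij => ?_
  fin_cases i <;> fin_cases j <;> first
    | exact absurd hij (by decide)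
    | exact h₀₁.trans neg_cos_pi_div_four.symm
    | exact h₀₂.trans neg_cos_pi_div_two.symm
    | exact h₁₂.trans neg_cos_pi_div_four.symm

theorem matchesDiagram_affineG₂ [NeZero 2] [Fact (finrank ℝ V = 2)] {T : Affine.Simplex ℝ V 2}
    (h₀₁ : ⟪(root T 0).1, (root T 1).1⟫ = -(1 / 2)) (h₀₂ : ⟪(root T 0).1, (root T 2).1⟫ = 0)
    (h₁₂ : ⟪(root T 1).1, (root T 2).1⟫ = -(√3 / 2)) :
    MatchesDiagram T affineG₂ (Equiv.refl _) := by
  refine matchesDiagram_of_lt fun i j hij => ?_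
  fin_cases i <;> fin_cases j <;> first
    | exact absurd hij (by decide)
    | exact h₀₁.trans neg_cos_pi_div_three.symm
    | exact h₀₂.trans neg_cos_pi_div_two.symm
    | exact h₁₂.trans neg_cos_pi_div_six.symm

theorem matchesDiagram_affineF₄ [NeZero 4] [Fact (finrank ℝ V = 4)] {T : Affine.Simplex ℝ V 4}
    (h₀₁ : ⟪(root T 0).1, (root T 1).1⟫ = -(1 / 2)) (h₀₂ : ⟪(root T 0).1, (root T 2).1⟫ = 0)
    (h₀₃ : ⟪(root T 0).1, (root T 3).1⟫ = 0) (h₀₄ : ⟪(root T 0).1, (root T 4).1⟫ = 0)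
    (h₁₂ : ⟪(root T 1).1, (root T 2).1⟫ = -(√2 / 2)) (h₁₃ : ⟪(root T 1).1, (root T 3).1⟫ = 0)
    (h₁₄ : ⟪(root T 1).1, (root T 4).1⟫ = 0) (h₂₃ : ⟪(root T 2).1, (root T 3).1⟫ = -(1 / 2))
    (h₂₄ : ⟪(root T 2).1, (root T 4).1⟫ = 0) (h₃₄ : ⟪(root T 3).1, (root T 4).1⟫ = -(1 / 2)) :
    MatchesDiagram T affineF₄ (Equiv.refl _) := by
  refine matchesDiagram_of_lt fun i j hij => ?_
  have c2 := neg_cos_pi_div_two.symm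
  have c3 := neg_cos_pi_div_three.symm
  fin_cases i <;> fin_cases j <;> first
    | exact absurd hij (by decide)
    | skip
  exacts [h₀₁.trans c3, h₀₂.trans c2, h₀₃.trans c2, h₀₄.trans c2,
    h₁₂.trans neg_cos_pi_div_four.symm, h₁₃.trans c2, h₁₄.trans c2, h₂₃.trans c3, h₂₄.trans c2,
    h₃₄.trans c3]

end Planar

/-! ### Index formula, exceptional subgroups and the automorphism. -/

section Types

variable {n : ℕ} [NeZero n] {C P F : Affine.Simplex ℝ V n}
variable [FiniteDimensional ℝ V] [hV : Fact (finrank ℝ V = n)] {c0 : Fin (n + 1)}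

theorem eq_of_equiv_fin {m n : ℕ} (e : Fin (m + 1) ≃ Fin (n + 1)) : n = m := by
  have := Fintype.card_congr e
  simp only [Fintype.card_fin] at this
  omega

theorem IsTypeC.dim {u : V} {f₀ f₁ f₂ : Fin (n + 1)} (h : IsTypeC C u f₀ f₁ f₂) : n = 2 :=
  let ⟨e, _⟩ := exists_equiv_three h.ne₀₁ h.ne₀₂ h.ne₁₂ h.cover
  eq_of_equiv_fin e

theorem IsTypeG.dim {u : V} {f₀ f₁ f₂ : Fin (n + 1)} (h : IsTypeG C u f₀ f₁ f₂) : n = 2 :=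
  let ⟨e, _⟩ := exists_equiv_three h.ne₀₁ h.ne₀₂ h.ne₁₂ h.cover
  eq_of_equiv_fin e

theorem IsTypeF.dim {u : V} {f₀ f₁ f₂ f₃ f₄ : Fin (n + 1)} (h : IsTypeF C u f₀ f₁ f₂ f₃ f₄) :
    n = 4 :=
  let ⟨e, _⟩ := exists_equiv_five h
  eq_of_equiv_fin e

theorem IsTypeC.hasDiagram {u : V} {f₀ f₁ f₂ : Fin (n + 1)} (h : IsTypeC C u f₀ f₁ f₂) :
    HasDiagram C affineC₂ := by
  obtain rfl := h.dim
  obtain ⟨e, he0, he1, he2⟩ := exists_equiv_three h.ne₀₁ h.ne₀₂ h.ne₁₂ h.cover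
  refine hasDiagram_of_reindex (e := e.symm) (matchesDiagram_affineC₂ ?_ ?_ ?_) <;>
    simp only [root_reindex, Equiv.symm_symm, he0, he1, he2]
  exacts [h.inner₀₁, h.inner₀₂, h.inner₁₂]

theorem IsTypeG.hasDiagram {u : V} {f₀ f₁ f₂ : Fin (n + 1)} (h : IsTypeG C u f₀ f₁ f₂) :
    HasDiagram C affineG₂ := by
  obtain rfl := h.dim
  obtain ⟨e, he0, he1, he2⟩ := exists_equiv_three h.ne₀₁ h.ne₀₂ h.ne₁₂ h.cover
  refine hasDiagram_of_reindex (e := e.symm) (matchesDiagram_affineG₂ ?_ ?_ ?_) <;>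
    simp only [root_reindex, Equiv.symm_symm, he0, he1, he2]
  exacts [h.inner₀₁, h.inner₀₂, h.inner₁₂]

theorem IsTypeF.hasDiagram {u : V} {f₀ f₁ f₂ f₃ f₄ : Fin (n + 1)}
    (h : IsTypeF C u f₀ f₁ f₂ f₃ f₄) : HasDiagram C affineF₄ := by
  obtain rfl := h.dim
  obtain ⟨e, he0, he1, he2, he3, he4⟩ := exists_equiv_five h
  refine hasDiagram_of_reindex (e := e.symm) (matchesDiagram_affineF₄ ?_ ?_ ?_ ?_ ?_ ?_ ?_ ?_ ?_ ?_) <;>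
    simp only [root_reindex, Equiv.symm_symm, he0, he1, he2, he3, he4]
  exacts [h.inner₀₁, h.inner₀₂, h.inner₀₃, h.inner₀₄, h.inner₁₂, h.inner₁₃, h.inner₁₄, h.inner₂₃,
    h.inner₂₄, h.inner₃₄]

theorem IsAligned.root_eq_of_ev_eq (h : IsAligned C P c0) {b : V × ℝ} (hb : (root P c0).1 = b.1)
    (hbv : ev b (C.points c0) = P.height c0) : root P c0 = b := by
  rw [root_eq_mirror, eq_mirror b (C.points c0), hb, hbv, h.vertex]

theorem IsAligned.relIndex_eq_mul_pow (h : IsAligned C P c0) {μ : ℝ} {k m : ℕ} (hμ : μ ^ n = m)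
    (hh : P.height c0 = k * (μ * C.height c0)) :
    (reflGroup P).relIndex (reflGroup C) = m * k ^ n := by
  have h1 := h.relIndex_eq
  have hC := C.height_pos c0
  rw [hh, show (k * (μ * C.height c0)) / C.height c0 = k * μ by field_simp, mul_pow, hμ] at h1
  rw [mul_comm]
  exact_mod_cast h1

theorem sqrt_two_pow_two : √2 ^ 2 = ((2 : ℕ) : ℝ) := Real.sq_sqrt (by norm_num)

theorem sqrt_three_pow_two : √3 ^ 2 = ((3 : ℕ) : ℝ) := Real.sq_sqrt (by norm_num)

theorem sqrt_two_pow_four : √2 ^ 4 = ((4 : ℕ) : ℝ) := by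
  rw [show 4 = 2 * 2 from rfl, pow_mul, sqrt_two_pow_two]; norm_num

theorem one_lt_sqrt_two : 1 < √2 := by rw [Real.lt_sqrt (by norm_num)]; norm_num

theorem one_lt_sqrt_three : 1 < √3 := by rw [Real.lt_sqrt (by norm_num)]; norm_num

/-- The index of a reflection subgroup with the same diagram. -/
theorem exists_relIndex_eq (h : SameDiagram P F) (hle : reflGroup P ≤ reflGroup F) :
    ∃ m k : ℕ, 0 < k ∧ (reflGroup P).relIndex (reflGroup F) = m * k ^ n ∧
      (m = 1 ∨ (HasDiagram F affineC₂ ∧ m = 2) ∨ (HasDiagram F affineG₂ ∧ m = 3) ∨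
        (HasDiagram F affineF₄ ∧ m = 4)) := by
  obtain ⟨C, c0, -, hG, ⟨e, he⟩, hA⟩ := exists_isAligned h hle
  rw [← hG]
  rcases hA.cases with ⟨-, k, hk, hh⟩ | ⟨_, _, hT, k, hk, hh⟩ | ⟨_, _, hT, k, hk, hh⟩ |
    ⟨_, _, _, _, hT, k, hk, hh⟩
  · exact ⟨1, k, hk, hA.relIndex_eq_mul_pow (μ := 1) (by simp) (by rw [hh, one_mul]), Or.inl rfl⟩
  · refine ⟨2, k, hk, hA.relIndex_eq_mul_pow ?_ hh,
      Or.inr (Or.inl ⟨hasDiagram_of_gram hT.hasDiagram he, rfl⟩)⟩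
    rw [hT.dim, sqrt_two_pow_two]
  · refine ⟨3, k, hk, hA.relIndex_eq_mul_pow ?_ hh,
      Or.inr (Or.inr (Or.inl ⟨hasDiagram_of_gram hT.hasDiagram he, rfl⟩))⟩
    rw [hT.dim, sqrt_three_pow_two]
  · refine ⟨4, k, hk, hA.relIndex_eq_mul_pow ?_ hh,
      Or.inr (Or.inr (Or.inr ⟨hasDiagram_of_gram hT.hasDiagram he, rfl⟩))⟩
    rw [hT.dim, sqrt_two_pow_four]

/-- With k = 1 the last facet function of P has the gradient and the value at the special vertex of
the image of f₁ under r₀, so the two coincide. The rest is relabelling. -/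
theorem IsTypeC.isExceptional {f₁ f₂ : Fin (n + 1)} (hT : IsTypeC C (root P c0).1 c0 f₁ f₂)
    (h : IsAligned C P c0) (hC : IsChamber C F) (hG : reflGroup C = reflGroup F)
    (hh : P.height c0 = √2 * C.height c0) : IsExceptionalC₂ P F := by
  obtain rfl := hT.dim
  have hb : root P c0 = act (refl (root C c0)) (root C f₁) := by
    rw [hT.act_eq]
    refine h.root_eq_of_ev_eq hT.eq ?_
    rw [ev_add, ev_smul, ev_root_self, ev_root_of_ne C hT.ne₀₁, zero_add, hh]
  obtain ⟨e, he0, he1, he2⟩ := exists_equiv_three hT.ne₀₁ hT.ne₀₂ hT.ne₁₂ hT.cover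
  obtain ⟨d, hd0, hd1, hd2⟩ := exists_equiv_three hT.ne₁₂ hT.ne₀₁.symm hT.ne₀₂.symm
    fun i => by have := hT.cover i; tauto
  have c0' : root (C.reindex e.symm) 0 = root C c0 := by rw [root_reindex, Equiv.symm_symm, he0]
  have c1 : root (C.reindex e.symm) 1 = root C f₁ := by rw [root_reindex, Equiv.symm_symm, he1]
  have c2 : root (C.reindex e.symm) 2 = root C f₂ := by rw [root_reindex, Equiv.symm_symm, he2]
  have d0 : root (P.reindex d.symm) 0 = root C f₁ := by
    rw [root_reindex, Equiv.symm_symm, hd0, h.root_eq _ hT.ne₀₁.symm]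
  have d1 : root (P.reindex d.symm) 1 = root C f₂ := by
    rw [root_reindex, Equiv.symm_symm, hd1, h.root_eq _ hT.ne₀₂.symm]
  have d2 : root (P.reindex d.symm) 2 = root P c0 := by rw [root_reindex, Equiv.symm_symm, hd2]
  refine ⟨C.reindex e.symm, P.reindex d.symm, hC.reindex _, Affine.Simplex.reindex_range_points _ _,
    matchesDiagram_affineC₂ ?_ ?_ ?_, matchesDiagram_affineC₂ ?_ ?_ ?_,
    facet_eq_of_root_eq (d0.trans c1.symm), facet_eq_of_root_eq (d1.trans c2.symm),
    facet_eq_map_of_root_eq ?_, ?_⟩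
  · rw [c0', c1, hT.inner₀₁]
  · rw [c0', c2, hT.inner₀₂]
  · rw [c1, c2, hT.inner₁₂]
  · rw [d0, d1, hT.inner₁₂]
  · rw [d0, d2, hT.eq, inner_add_right, real_inner_smul_right, inner_root_self,
      real_inner_comm, hT.inner₀₁]
    linarith [sqrt_two_facts.1]
  · rw [d1, d2, hT.eq, inner_add_right, real_inner_smul_right, real_inner_comm, hT.inner₁₂,
      real_inner_comm, hT.inner₀₂, mul_zero, add_zero]
  · rw [d2, c1, facetReflection_eq, c0', hb]
  · rw [← hG, h.relIndex_eq_mul_pow (k := 1) sqrt_two_pow_two (by rw [hh]; simp)]; norm_num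

theorem IsTypeG.isExceptional {f₁ f₂ : Fin (n + 1)} (hT : IsTypeG C (root P c0).1 c0 f₁ f₂)
    (h : IsAligned C P c0) (hC : IsChamber C F) (hG : reflGroup C = reflGroup F)
    (hh : P.height c0 = √3 * C.height c0) : IsExceptionalG₂ P F := by
  obtain rfl := hT.dim
  have s3 : √3 * √3 = 3 := Real.mul_self_sqrt (by norm_num)
  have hb : root P c0 = act (refl (root C c0) * refl (root C f₁)) (root C f₂) := by
    rw [hT.act_eq]
    refine h.root_eq_of_ev_eq hT.eq ?_
    rw [ev_add, ev_add, ev_smul, ev_smul, ev_root_self, ev_root_of_ne C hT.ne₀₁,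
      ev_root_of_ne C hT.ne₀₂, hh]
    ring
  obtain ⟨e, he0, he1, he2⟩ := exists_equiv_three hT.ne₀₁ hT.ne₀₂ hT.ne₁₂ hT.cover
  obtain ⟨d, hd0, hd1, hd2⟩ := exists_equiv_three hT.ne₀₂ hT.ne₀₁ hT.ne₁₂.symm
    fun i => by have := hT.cover i; tauto
  have c0' : root (C.reindex e.symm) 0 = root C c0 := by rw [root_reindex, Equiv.symm_symm, he0]
  have c1 : root (C.reindex e.symm) 1 = root C f₁ := by rw [root_reindex, Equiv.symm_symm, he1]
  have c2 : root (C.reindex e.symm) 2 = root C f₂ := by rw [root_reindex, Equiv.symm_symm, he2]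
  have d0 : root (P.reindex d.symm) 0 = root P c0 := by rw [root_reindex, Equiv.symm_symm, hd0]
  have d1 : root (P.reindex d.symm) 1 = root C f₂ := by
    rw [root_reindex, Equiv.symm_symm, hd1, h.root_eq _ hT.ne₀₂.symm]
  have d2 : root (P.reindex d.symm) 2 = root C f₁ := by
    rw [root_reindex, Equiv.symm_symm, hd2, h.root_eq _ hT.ne₀₁.symm]
  have i₂₁ : ⟪(root C f₂).1, (root C f₁).1⟫ = -(√3 / 2) := by rw [real_inner_comm, hT.inner₁₂]
  refine ⟨C.reindex e.symm, P.reindex d.symm, hC.reindex _, Affine.Simplex.reindex_range_points _ _,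
    matchesDiagram_affineG₂ ?_ ?_ ?_, matchesDiagram_affineG₂ ?_ ?_ ?_,
    facet_eq_map_of_root_eq ?_, facet_eq_of_root_eq (d1.trans c2.symm),
    facet_eq_of_root_eq (d2.trans c1.symm), ?_⟩
  · rw [c0', c1, hT.inner₀₁]
  · rw [c0', c2, hT.inner₀₂]
  · rw [c1, c2, hT.inner₁₂]
  · rw [d0, d1, hT.eq]
    simp only [inner_add_left, real_inner_smul_left, inner_root_self, hT.inner₁₂, hT.inner₀₂]
    linarith
  · rw [d0, d2, hT.eq]
    simp only [inner_add_left, real_inner_smul_left, inner_root_self, i₂₁, hT.inner₀₁]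
    ring
  · rw [d1, d2, i₂₁]
  · rw [d0, c2, facetReflection_eq, facetReflection_eq, c0', c1, hb]
  · rw [← hG, h.relIndex_eq_mul_pow (k := 1) sqrt_three_pow_two (by rw [hh]; simp)]; norm_num

theorem IsTypeF.isExceptional {f₀ f₁ f₂ f₃ : Fin (n + 1)}
    (hT : IsTypeF C (root P c0).1 f₀ f₁ f₂ f₃ c0) (h : IsAligned C P c0) (hC : IsChamber C F)
    (hG : reflGroup C = reflGroup F) (hh : P.height c0 = √2 * C.height c0) :
    IsExceptionalF₄ P F := by
  obtain rfl := hT.dim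
  have hb : root P c0 =
      act (refl (root C c0) * refl (root C f₃) * refl (root C f₂)) (root C f₁) := by
    rw [hT.act_eq]
    refine h.root_eq_of_ev_eq hT.eq ?_
    simp only [ev_add, ev_smul, ev_root_self, ev_root_of_ne C hT.ne₁₄.symm,
      ev_root_of_ne C hT.ne₂₄.symm, ev_root_of_ne C hT.ne₃₄.symm, hh]
    ring
  obtain ⟨e, he0, he1, he2, he3, he4⟩ := exists_equiv_five hT
  have c0' : root (C.reindex e.symm) 0 = root C f₀ := by rw [root_reindex, Equiv.symm_symm, he0]
  have c1 : root (C.reindex e.symm) 1 = root C f₁ := by rw [root_reindex, Equiv.symm_symm, he1]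
  have c2 : root (C.reindex e.symm) 2 = root C f₂ := by rw [root_reindex, Equiv.symm_symm, he2]
  have c3 : root (C.reindex e.symm) 3 = root C f₃ := by rw [root_reindex, Equiv.symm_symm, he3]
  have c4 : root (C.reindex e.symm) 4 = root C c0 := by rw [root_reindex, Equiv.symm_symm, he4]
  -- The first four nodes are reversed, because the diagram isomorphism flips the heavy edge, while
  -- the facet opposite the special vertex stays last.
  obtain ⟨r, hr0, hr1, hr2, hr3, hr4⟩ : ∃ r : Fin 5 ≃ Fin 5,
      r 0 = 3 ∧ r 1 = 2 ∧ r 2 = 1 ∧ r 3 = 0 ∧ r 4 = 4 :=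
    ⟨⟨![3, 2, 1, 0, 4], ![3, 2, 1, 0, 4], by decide, by decide⟩, rfl, rfl, rfl, rfl, rfl⟩
  set d := (r.trans e).symm with hd
  have d0 : root (P.reindex d) 0 = root C f₃ := by
    rw [root_reindex, hd, Equiv.symm_symm, Equiv.trans_apply, hr0, he3, h.root_eq _ hT.ne₃₄]
  have d1 : root (P.reindex d) 1 = root C f₂ := by
    rw [root_reindex, hd, Equiv.symm_symm, Equiv.trans_apply, hr1, he2, h.root_eq _ hT.ne₂₄]
  have d2 : root (P.reindex d) 2 = root C f₁ := by
    rw [root_reindex, hd, Equiv.symm_symm, Equiv.trans_apply, hr2, he1, h.root_eq _ hT.ne₁₄]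
  have d3 : root (P.reindex d) 3 = root C f₀ := by
    rw [root_reindex, hd, Equiv.symm_symm, Equiv.trans_apply, hr3, he0, h.root_eq _ hT.ne₀₄]
  have d4 : root (P.reindex d) 4 = root P c0 := by
    rw [root_reindex, hd, Equiv.symm_symm, Equiv.trans_apply, hr4, he4]
  have cm : ∀ i j, ⟪(root C i).1, (root C j).1⟫ = ⟪(root C j).1, (root C i).1⟫ := fun i j =>
    real_inner_comm _ _
  have s2 := sqrt_two_facts.1
  refine ⟨C.reindex e.symm, P.reindex d, hC.reindex _, Affine.Simplex.reindex_range_points _ _,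
    matchesDiagram_affineF₄ ?_ ?_ ?_ ?_ ?_ ?_ ?_ ?_ ?_ ?_,
    matchesDiagram_affineF₄ ?_ ?_ ?_ ?_ ?_ ?_ ?_ ?_ ?_ ?_,
    facet_eq_of_root_eq (d0.trans c3.symm), facet_eq_of_root_eq (d1.trans c2.symm),
    facet_eq_of_root_eq (d2.trans c1.symm), facet_eq_of_root_eq (d3.trans c0'.symm),
    facet_eq_map_of_root_eq ?_, ?_⟩
  · rw [c0', c1, hT.inner₀₁]
  · rw [c0', c2, hT.inner₀₂]
  · rw [c0', c3, hT.inner₀₃]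
  · rw [c0', c4, hT.inner₀₄]
  · rw [c1, c2, hT.inner₁₂]
  · rw [c1, c3, hT.inner₁₃]
  · rw [c1, c4, hT.inner₁₄]
  · rw [c2, c3, hT.inner₂₃]
  · rw [c2, c4, hT.inner₂₄]
  · rw [c3, c4, hT.inner₃₄]
  · rw [d0, d1, cm, hT.inner₂₃]
  · rw [d0, d2, cm, hT.inner₁₃]
  · rw [d0, d3, cm, hT.inner₀₃]
  · rw [d0, d4, hT.eq]
    simp only [inner_add_right, real_inner_smul_right, inner_root_self, cm f₃ f₁, cm f₃ f₂,
      hT.inner₁₃, hT.inner₂₃, hT.inner₃₄]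
    ring
  · rw [d1, d2, cm, hT.inner₁₂]
  · rw [d1, d3, cm, hT.inner₀₂]
  · rw [d1, d4, hT.eq]
    simp only [inner_add_right, real_inner_smul_right, inner_root_self, cm f₂ f₁,
      hT.inner₁₂, hT.inner₂₃, hT.inner₂₄]
    ring
  · rw [d2, d3, cm, hT.inner₀₁]
  · rw [d2, d4, hT.eq]
    simp only [inner_add_right, real_inner_smul_right, inner_root_self,
      hT.inner₁₂, hT.inner₁₃, hT.inner₁₄]
    linarith
  · rw [d3, d4, hT.eq]
    simp only [inner_add_right, real_inner_smul_right,
      hT.inner₀₁, hT.inner₀₂, hT.inner₀₃, hT.inner₀₄]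
    ring
  · rw [d4, c1, facetReflection_eq, facetReflection_eq, facetReflection_eq, c4, c3, c2, hb]
  · rw [← hG, h.relIndex_eq_mul_pow (k := 1) sqrt_two_pow_four (by rw [hh]; simp)]; norm_num

/-- The maximal reflection subgroups with the same diagram. -/
theorem homothetic_or_exceptional (h : SameDiagram P F) (hmax : IsMaximalIn P F) :
    IsHomothetic P F ∨ IsExceptionalC₂ P F ∨ IsExceptionalG₂ P F ∨ IsExceptionalF₄ P F := by
  obtain ⟨C, c0, hC, hG, -, hA⟩ := exists_isAligned h hmax.1
  have hmax' : IsMaximalIn P C := by unfold IsMaximalIn at hmax ⊢; rwa [hG]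
  rcases hA.cases with ⟨h1, k, hk, hh⟩ | ⟨f₁, f₂, hT, k, hk, hh⟩ | ⟨f₁, f₂, hT, k, hk, hh⟩ |
    ⟨f₀, f₁, f₂, f₃, hT, k, hk, hh⟩
  · exact Or.inl (hA.isHomothetic hC h1 hk hh)
  · refine Or.inr (Or.inl (hT.isExceptional hA hC hG ?_))
    obtain rfl := hA.eq_one_of_isMaximalIn hmax' hk one_lt_sqrt_two hh
      (hT.act_eq ▸ refl_act_mem (refl_root_mem _) _) hT.eq.symm (by
        rw [ev_add, ev_smul, ev_root_self, ev_root_of_ne C hT.ne₀₁, zero_add])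
    rw [hh, Nat.cast_one, one_mul]
  · refine Or.inr (Or.inr (Or.inl (hT.isExceptional hA hC hG ?_)))
    obtain rfl := hA.eq_one_of_isMaximalIn hmax' hk one_lt_sqrt_three hh
      (hT.act_eq ▸ refl_act_mem (mul_mem (refl_root_mem _) (refl_root_mem _)) _) hT.eq.symm (by
        rw [ev_add, ev_add, ev_smul, ev_smul, ev_root_self, ev_root_of_ne C hT.ne₀₁,
          ev_root_of_ne C hT.ne₀₂]
        ring)
    rw [hh, Nat.cast_one, one_mul]
  · refine Or.inr (Or.inr (Or.inr (hT.isExceptional hA hC hG ?_)))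
    obtain rfl := hA.eq_one_of_isMaximalIn hmax' hk one_lt_sqrt_two hh
      (hT.act_eq ▸ refl_act_mem
        (mul_mem (mul_mem (refl_root_mem _) (refl_root_mem _)) (refl_root_mem _)) _) hT.eq.symm (by
        simp only [ev_add, ev_smul, ev_root_self, ev_root_of_ne C hT.ne₁₄.symm,
          ev_root_of_ne C hT.ne₂₄.symm, ev_root_of_ne C hT.ne₃₄.symm]
        ring)
    rw [hh, Nat.cast_one, one_mul]

theorem exists_mulAut {Q : Affine.Simplex ℝ V n} {g : V ≃ᵃⁱ[ℝ] V}
    (hF : reflGroup (move g F) = reflGroup F) (hP : reflGroup (move g P) = reflGroup Q) :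
    ∃ φ : MulAut (reflGroup F),
      (∃ e : V ≃ᵃⁱ[ℝ] V, ∀ x : reflGroup F,
        ((φ x : reflGroup F) : V ≃ᵃⁱ[ℝ] V) = e * (x : V ≃ᵃⁱ[ℝ] V) * e⁻¹) ∧
      ((reflGroup P).subgroupOf (reflGroup F)).map φ.toMonoidHom =
        (reflGroup Q).subgroupOf (reflGroup F) := by
  have h1 : ∀ x ∈ reflGroup F, g⁻¹ * x * g ∈ reflGroup F := fun x hx => by
    rw [← reflGroup_move, hF]; exact hx
  have h2 : ∀ x ∈ reflGroup F, g * x * g⁻¹ ∈ reflGroup F := fun x hx => by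
    rw [← hF, reflGroup_move]; simpa [mul_assoc] using hx
  let φ : MulAut (reflGroup F) :=
    { toFun := fun x => ⟨g * x * g⁻¹, h2 _ x.2⟩
      invFun := fun x => ⟨g⁻¹ * x * g, h1 _ x.2⟩
      left_inv := fun x => by ext1; simp [mul_assoc]
      right_inv := fun x => by ext1; simp [mul_assoc]
      map_mul' := fun x y => by ext1; simp [mul_assoc] }
  refine ⟨φ, ⟨g, fun x => rfl⟩, ?_⟩
  ext x
  rw [Subgroup.mem_map, Subgroup.mem_subgroupOf, ← hP, reflGroup_move]
  constructor
  · rintro ⟨y, hy, rfl⟩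
    have h3 : g⁻¹ * ((φ y : reflGroup F) : V ≃ᵃⁱ[ℝ] V) * g = y := by simp [φ, mul_assoc]
    change g⁻¹ * ((φ y : reflGroup F) : V ≃ᵃⁱ[ℝ] V) * g ∈ _
    rw [h3]; exact hy
  · intro hx
    exact ⟨φ.symm x, hx, φ.apply_symm_apply x⟩

end Types

end CoxeterSimplex

theorem lemma11 {n : ℕ} [NeZero n] (F : Affine.Simplex ℝ (EuclideanSpace ℝ (Fin n)) n) :
    -- the index has the form `m * k ^ n`
    (∀ P : Affine.Simplex ℝ (EuclideanSpace ℝ (Fin n)) n,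
      CoxeterSimplex.SameDiagram P F →
      CoxeterSimplex.reflGroup P ≤ CoxeterSimplex.reflGroup F →
      ∃ m k : ℕ, 0 < k ∧
        (CoxeterSimplex.reflGroup P).relIndex (CoxeterSimplex.reflGroup F) = m * k ^ n ∧
        (m = 1 ∨
          (CoxeterSimplex.HasDiagram F CoxeterSimplex.affineC₂ ∧ m = 2) ∨
          (CoxeterSimplex.HasDiagram F CoxeterSimplex.affineG₂ ∧ m = 3) ∨
          (CoxeterSimplex.HasDiagram F CoxeterSimplex.affineF₄ ∧ m = 4))) ∧
    -- the index determines the subgroup up to an automorphism of `G_F`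
    (∀ P Q : Affine.Simplex ℝ (EuclideanSpace ℝ (Fin n)) n,
      CoxeterSimplex.SameDiagram P F → CoxeterSimplex.SameDiagram Q F →
      CoxeterSimplex.reflGroup P ≤ CoxeterSimplex.reflGroup F →
      CoxeterSimplex.reflGroup Q ≤ CoxeterSimplex.reflGroup F →
      (CoxeterSimplex.reflGroup P).relIndex (CoxeterSimplex.reflGroup F) =
        (CoxeterSimplex.reflGroup Q).relIndex (CoxeterSimplex.reflGroup F) →
      ∃ φ : MulAut (CoxeterSimplex.reflGroup F),
        (∃ e : EuclideanSpace ℝ (Fin n) ≃ᵃⁱ[ℝ] EuclideanSpace ℝ (Fin n),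
          ∀ x : CoxeterSimplex.reflGroup F,
            ((φ x : CoxeterSimplex.reflGroup F) :
              EuclideanSpace ℝ (Fin n) ≃ᵃⁱ[ℝ] EuclideanSpace ℝ (Fin n)) =
              e * (x : EuclideanSpace ℝ (Fin n) ≃ᵃⁱ[ℝ] EuclideanSpace ℝ (Fin n)) * e⁻¹) ∧
        ((CoxeterSimplex.reflGroup P).subgroupOf (CoxeterSimplex.reflGroup F)).map
            φ.toMonoidHom =
          (CoxeterSimplex.reflGroup Q).subgroupOf (CoxeterSimplex.reflGroup F)) ∧
    -- the maximal subgroups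
    (∀ P : Affine.Simplex ℝ (EuclideanSpace ℝ (Fin n)) n,
      CoxeterSimplex.SameDiagram P F →
      CoxeterSimplex.IsMaximalIn P F →
      CoxeterSimplex.IsHomothetic P F ∨
        CoxeterSimplex.IsExceptionalC₂ P F ∨
        CoxeterSimplex.IsExceptionalG₂ P F ∨
        CoxeterSimplex.IsExceptionalF₄ P F) := by
  have : Fact (Module.finrank ℝ (EuclideanSpace ℝ (Fin n)) = n) := ⟨by simp⟩
  refine ⟨fun P hP hle => CoxeterSimplex.exists_relIndex_eq hP hle,
    fun P Q hP hQ hPF hQF h => ?_, fun P hP hmax => CoxeterSimplex.homothetic_or_exceptional hP hmax⟩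
  obtain ⟨g, hF, hg⟩ := CoxeterSimplex.exists_normalizing_isometry hP hQ hPF hQF h
  exact CoxeterSimplex.exists_mulAut hF hg
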